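/- **Setting.** Let $\mathbb F$ be the family of plane convex bodies (compact, convex, non-empty interior) whose boundary is of class $C^3$ with positive curvature. For $h>0$ the Gauss digitization of $S\in\mathbb F$ is $D_h(S)=S\cap(h\mathbb Z\times h\mathbb Z)$. Its border, the set of its points that are 8-adjacent to a point outside $D_h(S)$, is run through clockwise as a closed 4-connected digital path; integer coordinates of the grid are used on it. The standard line of slope $a/b$ and shift $\mu$ (with $a,b,\mu\in\mathbb Z$) is $\{(x,y)\in\mathbb Z^2:\mu\le ax-by<\mu+|a|+|b|\}$. A digital straight segment (DSS) is a subpath of the border contained in a standard line; its slope is the slope $a/b$ of a standard line containing it with smallest $|a|+|b|$. A maximal segment is a DSS that can be extended neither by the next point at its front nor at its back. Let $M\in\partial S$. If the clockwise tangent of $\partial S$ at $M$ is in the first octant, a maximal segment lies below $M$ if it passes, from left to right, over the abscissa of $M$; the other octants are treated by symmetry. The estimator $\mathcal T_M^{\rm ms}$ of the tangent direction $\theta_M(S)$ of $\partial S$ at $M$ gives the arctangent of the slope of any maximal segment lying below $M$; directions are compared as directions of undirected lines, i.e. angles modulo $\pi$. **Theorem.** 1. *(Multigrid convergence.)* For every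 point $M$ of the plane, $\mathcal T_M^{\rm ms}$ is multigrid convergent toward $\theta_M$ for the shapes $S\in\mathbb F$ with $M\in\partial S$: there is a function $\tau>0$ with $\tau(h)\to0$ as $h\to0^+$ such that for each such $S$ there is $h_S>0$ such that for all $0<h<h_S$ some maximal segment lies below $M$ and every choice of a maximal segment below $M$ gives an estimate at distance at most $\tau(h)$ from $\theta_M(S)$. 2. *(Average speed.)* Let $S\in\mathbb F$ and assume that, as $h\to0$, the digital parameters of the edges of the convex hull of $D_h(S)$ behave on average as follows: writing (after the symmetry that brings it to the first octant) the vector of an edge as $h\,\delta\,(q,p)$ with $0\le p\le q$ coprime and $\delta\ge 1$ an integer, the means of $p$ and of $q$ over the edges are $\Theta(h^{-1/3})$ and the mean of $\delta$ over the edges is bounded. Then the speed of convergence is on average $O(h^{2/3})$: there are $K,h_0>0$ depending on $S$ such that, for $0<h<h_0$, a maximal segment lies below every point of $\partial S$, and the mean over $M\in\partial S$, with respect to arc length, of the largest error of the estimates $\mathcal T_M^{\rm ms}(D_h(S))$ is at most $K h^{2/3}$. 3. Both statements also hold for the estimates that are convex combinations of the directions of the maximal segments lying below $M$ (the directions being represented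 by angles in a common open interval of length $\pi/2$); this includes the Feschet–Tougne estimator (direction of the most centred maximal segment around $M$) and the $\lambda$-MST estimator (a weighted mean of the directions of all of them). -/

import Mathlib

open Set Filter Topology MeasureTheory

namespace DigitalTangent

/-! ### Plane shapes with `C^3` boundary and positive curvature -/

/-- `γ` is a counterclockwise arc-length parametrization, of class `C^3` and with positive
curvature, of the boundary of `S`; `L` is the perimeter. -/
structure IsBoundaryParam (S : Set (ℝ × ℝ)) (γ : ℝ → ℝ × ℝ) (L : ℝ) : Prop where
  length_pos : 0 < L
  contDiff : ContDiff ℝ 3 γ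
  periodic : Function.Periodic γ L
  injOn : InjOn γ (Ico 0 L)
  range_eq : range γ = frontier S
  unit_speed : ∀ s, (deriv γ s).1 ^ 2 + (deriv γ s).2 ^ 2 = 1
  curvature_pos : ∀ s,
    0 < (deriv γ s).1 * (deriv (deriv γ) s).2 - (deriv γ s).2 * (deriv (deriv γ) s).1

/-- Plane convex bodies with `C^3` boundary and positive curvature. -/
structure IsShape (S : Set (ℝ × ℝ)) : Prop where
  convex : Convex ℝ S
  isCompact : IsCompact S
  nonempty_interior : (interior S).Nonempty
  boundary : ∃ γ L, IsBoundaryParam S γ L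

/-- The angle of the tangent `γ' s` with the first coordinate axis. -/
noncomputable def tangentAngle (γ : ℝ → ℝ × ℝ) (s : ℝ) : ℝ :=
  Complex.arg ⟨(deriv γ s).1, (deriv γ s).2⟩

/-- The distance between two (undirected) line directions given by angles: the distance from
`α - β` to the nearest integer multiple of `π`. -/
noncomputable def angleError (α β : ℝ) : ℝ :=
  |(α - β) - round ((α - β) / Real.pi) * Real.pi|

/-! ### Digitization, digital contour, digital straight segments

Points of the digital plane `hℤ × hℤ` are represented by their integer coordinates:
`(i, j)` stands for `(h * i, h * j)`. -/

/-- Gauss digitization with grid step `h`. -/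
def gaussDigitization (h : ℝ) (S : Set (ℝ × ℝ)) : Set (ℤ × ℤ) :=
  {P | (h * (P.1 : ℝ), h * (P.2 : ℝ)) ∈ S}

/-- Quarter turn to the left. -/
def turnLeft (e : ℤ × ℤ) : ℤ × ℤ := (-e.2, e.1)

/-- `C` is the clockwise 4-connected border path of `Γ` (run through periodically if `Γ` is
finite): it makes unit horizontal or vertical steps inside `Γ`, has points outside `Γ`
immediately to the left of each of its steps, and is followed by always taking the leftmost
possible next step. For a convex digital polygon it visits exactly the points of `Γ` that are
8-adjacent to some point not in `Γ`. -/
structure IsContour (Γ : Set (ℤ × ℤ)) (C : ℤ → ℤ × ℤ) : Prop where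
  mem : ∀ i, C i ∈ Γ
  unit_step : ∀ i, |(C (i + 1) - C i).1| + |(C (i + 1) - C i).2| = 1
  outside_left : ∀ i,
    C i + turnLeft (C (i + 1) - C i) ∉ Γ ∨ C (i + 1) + turnLeft (C (i + 1) - C i) ∉ Γ
  next_step : ∀ i, ∀ P e e' : ℤ × ℤ,
    P = C (i + 1) → e = C (i + 1) - C i → e' = C (i + 1 + 1) - C (i + 1) →
      (P + turnLeft e ∈ Γ ∧ e' = turnLeft e) ∨
      (P + turnLeft e ∉ Γ ∧ P + e ∈ Γ ∧ e' = e) ∨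
      (P + turnLeft e ∉ Γ ∧ P + e ∉ Γ ∧ P - turnLeft e ∈ Γ ∧ e' = -turnLeft e) ∨
      (P + turnLeft e ∉ Γ ∧ P + e ∉ Γ ∧ P - turnLeft e ∉ Γ ∧ e' = -e)

/-- The standard line with slope `a / b` and shift `μ`. -/
def standardLine (a b μ : ℤ) : Set (ℤ × ℤ) :=
  {P | μ ≤ a * P.1 - b * P.2 ∧ a * P.1 - b * P.2 < μ + |a| + |b|}

/-- `(a, b, μ)` are characteristics of the digital straight segment `X`: a standard line
containing `X` with smallest `|a| + |b|`. -/
def IsCharacteristic (X : Set (ℤ × ℤ)) (a b μ : ℤ) : Prop :=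
  X ⊆ standardLine a b μ ∧
    ∀ a' b' μ' : ℤ, X ⊆ standardLine a' b' μ' → |a| + |b| ≤ |a'| + |b'|

/-- The portion of the path `C` between the indices `m` and `n` is a digital straight
segment. -/
def IsDSS (C : ℤ → ℤ × ℤ) (m n : ℤ) : Prop :=
  m ≤ n ∧ ∃ a b μ : ℤ, C '' Icc m n ⊆ standardLine a b μ

/-- Maximal segments: digital straight segments of the path that can be extended neither to
the back nor to the front. -/
def IsMaximalSegment (C : ℤ → ℤ × ℤ) (m n : ℤ) : Prop :=
  IsDSS C m n ∧ ¬ IsDSS C (m - 1) n ∧ ¬ IsDSS C m (n + 1)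

/-! ### Tangent estimators -/

/-- `c` is one of the four coordinate directions that is closest to the direction of `v`. The
first octant (shape below its boundary, clockwise tangent of slope in `[0, 1]`) has
`c = (1, 0)`. -/
def IsOctantAxis (v : ℝ × ℝ) (c : ℤ × ℤ) : Prop :=
  |c.1| + |c.2| = 1 ∧
    ∀ c' : ℤ × ℤ, |c'.1| + |c'.2| = 1 →
      (c'.1 : ℝ) * v.1 + (c'.2 : ℝ) * v.2 ≤ (c.1 : ℝ) * v.1 + (c.2 : ℝ) * v.2

/-- The abscissa along the coordinate direction `c` of a real point. -/
def abscissa (c : ℤ × ℤ) (M : ℝ × ℝ) : ℝ := (c.1 : ℝ) * M.1 + (c.2 : ℝ) * M.2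

/-- The same abscissa for a digital point. -/
def digitalAbscissa (c P : ℤ × ℤ) : ℤ := c.1 * P.1 + c.2 * P.2

/-- The portion of the clockwise path `C` between the indices `m` and `n` lies below `M`:
it passes, in the direction `c`, over the abscissa of `M`. As the path is clockwise, the
portions on the opposite side of the shape run in the direction `-c` and do not qualify. -/
def LiesBelow (h : ℝ) (C : ℤ → ℤ × ℤ) (m n : ℤ) (M : ℝ × ℝ) (c : ℤ × ℤ) : Prop :=
  digitalAbscissa c (C m) < digitalAbscissa c (C n) ∧
    h * (digitalAbscissa c (C m) : ℝ) ≤ abscissa c M ∧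
    abscissa c M ≤ h * (digitalAbscissa c (C n) : ℝ)

/-- A (possibly multivalued) tangent estimator: from a digitization, its grid step, the point
of interest and the octant direction, it gives a set of estimated angles. -/
abbrev TangentEstimator := Set (ℤ × ℤ) → ℝ → ℝ × ℝ → ℤ × ℤ → Set ℝ

/-- The estimator by maximal segments: the angles (determined modulo `π`) with tangent the
slope `a / b` of any maximal segment of the border of the digitization lying below `M`. -/
noncomputable def maximalSegmentEstimator : TangentEstimator := fun Γ h M c =>
  {α | ∃ (C : ℤ → ℤ × ℤ) (m n a b μ : ℤ),
    IsContour Γ C ∧ IsMaximalSegment C m n ∧ LiesBelow h C m n M c ∧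
    IsCharacteristic (C '' Icc m n) a b μ ∧ (b : ℝ) * Real.sin α = (a : ℝ) * Real.cos α}

/-- All convex combinations of directions of maximal segments lying below `M` (the directions
being represented by angles in a common interval of length `π / 2`). Choosing one particular
maximal segment, such as the most centred one around `M` (Feschet--Tougne), or a weighted mean of
the directions of all of them (`λ`-MST) gives an element of this set. -/
noncomputable def combinedEstimator : TangentEstimator := fun Γ h M c =>
  {α | ∃ β : ℝ,
    α ∈ convexHull ℝ (maximalSegmentEstimator Γ h M c ∩ Ioo β (β + Real.pi / 2))}

/-- The values of the estimator `A` at the boundary point `γ s` of `S`; the clockwise tangent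
is `-γ' s`. -/
def estimates (A : TangentEstimator) (S : Set (ℝ × ℝ)) (h : ℝ) (γ : ℝ → ℝ × ℝ) (s : ℝ) :
    Set ℝ :=
  {α | ∃ c : ℤ × ℤ, IsOctantAxis (-deriv γ s) c ∧ α ∈ A (gaussDigitization h S) h (γ s) c}

/-- The estimator `A` at the point `M` is multigrid convergent toward the tangent direction at
`M`, for the shapes whose boundary contains `M` and for Gauss digitization. -/
def MultigridConvergentAt (A : TangentEstimator) (M : ℝ × ℝ) : Prop :=
  ∃ τ : ℝ → ℝ, (∀ h, 0 < h → 0 < τ h) ∧ Tendsto τ (𝓝[>] 0) (𝓝 0) ∧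
    ∀ S : Set (ℝ × ℝ), IsShape S → M ∈ frontier S →
      ∃ h₀ : ℝ, 0 < h₀ ∧ ∀ h : ℝ, 0 < h → h < h₀ →
        ∀ (γ : ℝ → ℝ × ℝ) (L s : ℝ), IsBoundaryParam S γ L → γ s = M →
          (estimates A S h γ s).Nonempty ∧
          ∀ α ∈ estimates A S h γ s, angleError α (tangentAngle γ s) ≤ τ h

/-- On average over the points of the boundary of `S` (with respect to arc length), the largest
error of the estimates of the tangent direction given by `A` is `O(h^r)`. -/
def HasAverageSpeed (A : TangentEstimator) (S : Set (ℝ × ℝ)) (r : ℝ) : Prop :=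
  ∃ K h₀ : ℝ, 0 < K ∧ 0 < h₀ ∧ ∀ h : ℝ, 0 < h → h < h₀ →
    ∀ (γ : ℝ → ℝ × ℝ) (L : ℝ), IsBoundaryParam S γ L →
      (∀ s, (estimates A S h γ s).Nonempty) ∧
      (ENNReal.ofReal L)⁻¹ *
          ∫⁻ s in Ioc 0 L,
            ⨆ α ∈ estimates A S h γ s, ENNReal.ofReal (angleError α (tangentAngle γ s))
        ≤ ENNReal.ofReal (K * h ^ r)

/-! ### Edges of a convex digital polygon and their digital parameters -/

/-- The edges `(V, W)` (clockwise) of the convex hull of `Γ`: `V` and `W` are distinct points of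
`Γ`, no point of `Γ` is to the left of the line `V W`, and the points of `Γ` on this line are
between `V` and `W`. -/
def edges (Γ : Set (ℤ × ℤ)) : Set ((ℤ × ℤ) × (ℤ × ℤ)) :=
  {E | E.1 ∈ Γ ∧ E.2 ∈ Γ ∧ E.1 ≠ E.2 ∧
    ∀ P ∈ Γ,
      (E.2 - E.1).1 * (P - E.1).2 - (E.2 - E.1).2 * (P - E.1).1 ≤ 0 ∧
      ((E.2 - E.1).1 * (P - E.1).2 - (E.2 - E.1).2 * (P - E.1).1 = 0 →
        (P - E.1).1 * (P - E.2).1 + (P - E.1).2 * (P - E.2).2 ≤ 0)}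

/-- The number `δ` of repetitions of the pattern of an edge. -/
def edgeDelta (E : (ℤ × ℤ) × (ℤ × ℤ)) : ℕ := Int.gcd (E.2 - E.1).1 (E.2 - E.1).2

/-- The numerator `p` of the irreducible slope `p / q ≤ 1` of an edge, brought to the first
octant by symmetry. -/
def edgeP (E : (ℤ × ℤ) × (ℤ × ℤ)) : ℕ :=
  min (E.2 - E.1).1.natAbs (E.2 - E.1).2.natAbs / edgeDelta E

/-- The denominator `q` of the irreducible slope `p / q ≤ 1` of an edge, brought to the first
octant by symmetry. -/
def edgeQ (E : (ℤ × ℤ) × (ℤ × ℤ)) : ℕ :=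
  max (E.2 - E.1).1.natAbs (E.2 - E.1).2.natAbs / edgeDelta E

/-- The mean of the parameter `f` over the edges of `Γ`. -/
noncomputable def edgeMean (Γ : Set (ℤ × ℤ)) (f : (ℤ × ℤ) × (ℤ × ℤ) → ℕ) : ℝ :=
  (∑ᶠ E ∈ edges Γ, (f E : ℝ)) / ((edges Γ).ncard : ℝ)

/-- On average, the digital parameters `p` and `q` of the edges of the Gauss digitization of `S`
grow as `Θ(1 / h^(1/3))`, whereas `δ` is bounded, when `h` tends toward `0`. -/
def EdgeParameterGrowth (S : Set (ℝ × ℝ)) : Prop :=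
  ∃ k₁ k₂ B h₀ : ℝ, 0 < k₁ ∧ 0 < k₂ ∧ 0 < h₀ ∧ ∀ h : ℝ, 0 < h → h < h₀ →
    k₁ * (1 / h ^ (1 / 3 : ℝ)) ≤ edgeMean (gaussDigitization h S) edgeP ∧
    edgeMean (gaussDigitization h S) edgeP ≤ k₂ * (1 / h ^ (1 / 3 : ℝ)) ∧
    k₁ * (1 / h ^ (1 / 3 : ℝ)) ≤ edgeMean (gaussDigitization h S) edgeQ ∧
    edgeMean (gaussDigitization h S) edgeQ ≤ k₂ * (1 / h ^ (1 / 3 : ℝ)) ∧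
    edgeMean (gaussDigitization h S) edgeDelta ≤ B

end DigitalTangent

/-!
The shape is studied through the balls that roll inside it and around it, which exist with radii
depending on the shape only because the curvature is bounded above and below (`exists_isRolling`).
In grid units these radii are `r / h` and `R / h`, and the shape becomes a `RoundBody`: a union of
large balls, in which the midpoint of a chord is far from the outside.

A maximal segment whose steps are in two directions is a staircase path (`IsStair`) inside the body,
with points outside the body next to it. Three facts are known about it.

* It cannot be extended. This forces the extremal point of the body in the direction normal to the
  segment to be near the segment (`IsStair.support_lt_front`, `IsStair.back_lt_support`): the tangent
  there is exactly parallel to the segment, so that the error at a point over the segment is at most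
  proportional to the length `l` of the segment.
* If the slope of the segment has a rational approximation of denominator `k`, then there are lattice
  lines at distance of order `1 / k` in this direction. The body would contain a lattice point on the
  wrong side of the segment unless its sagitta `l ^ 2 / R` were `O(h / k)` (`IsStair.exists_flat`).
* Dirichlet's theorem provides such an approximation, that is, a vector `w ≠ 0` with integer
  coordinates that is almost parallel to the segment and satisfies `|w| * l ^ 2 ≤ c * h`.

Spikes, where the contour turns back at a single protruding point, are treated separately: there the
tangent is almost parallel to an axis, and one takes for `w` a vector of this axis. The outcome, for
all maximal segments, is `IsContour.exists_witness`, and after scaling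
`IsShape.exists_pointwise_bound`: each estimate at `γ s` has a length `l` and a vector `w ≠ 0` with
integer coordinates such that the error is at most `c * l`, and

`|w| * l ^ 2 ≤ c * h`, `|w.1 * (γ' s).2 - w.2 * (γ' s).1| * l ≤ c * h`.

As `|w| ≥ 1`, the first inequality bounds the error by `O(√h)`, which is multigrid convergence with
`τ h = h ^ (1 / 4)` whatever the shape. For the average speed, the error can be of order
`l ≥ h ^ (2 / 3)` only where the tangent is within `c * h / (l * |w|)` of the direction of some `w`
with `|w| ≤ c * h / l ^ 2`. By strict convexity this is a part of the boundary of length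
`O(h / (l * |w|))` for each `w`, hence of length `O(h ^ 2 / l ^ 3)` for all `w` together
(`IsBoundaryParam.volume_exists_cross_le`). Summing over the dyadic values of `l` gives
a mean error `O(h ^ (2 / 3))` (`IsShape.hasAverageSpeed`).

A maximal segment below each boundary point exists because contour tracking is a permutation of the
finitely many states (`exists_contour`), started at the outermost step that crosses the abscissa of
the point (`IsShape.exists_estimate`). Convex combinations of directions in an interval of length
`π / 2` inherit the error bounds, as the angles with error less than `e ≤ π / 4` in this interval
form a convex set (`exists_angleError_le`).
-/

namespace DigitalTangent

/-! ### Rolling balls inside and around a shape -/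

/-- The component of `v` along the unit inner normal at `γ s` of a counterclockwise
parametrization: the normal is the left quarter turn of `γ' s`. -/
noncomputable def inward (γ : ℝ → ℝ × ℝ) (s : ℝ) (v : ℝ × ℝ) : ℝ :=
  -(deriv γ s).2 * v.1 + (deriv γ s).1 * v.2

theorem convex_combo_mem {S : Set (ℝ × ℝ)} (hS : Convex ℝ S) {P Q : ℝ × ℝ} (hP : P ∈ S)
    (hQ : Q ∈ S) {t : ℝ} (h0 : 0 ≤ t) (h1 : t ≤ 1) {X : ℝ × ℝ}
    (hX1 : X.1 = P.1 + t * (Q.1 - P.1)) (hX2 : X.2 = P.2 + t * (Q.2 - P.2)) : X ∈ S := by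
  have := hS hP hQ (sub_nonneg.2 h1) h0 (by ring)
  convert this using 1
  ext
  · simp [hX1]; ring
  · simp [hX2]; ring

namespace IsBoundaryParam

variable {S : Set (ℝ × ℝ)} {γ : ℝ → ℝ × ℝ} {L : ℝ}

theorem contDiff_deriv (h : IsBoundaryParam S γ L) : ContDiff ℝ 2 (deriv γ) := by
  have h3 : ContDiff ℝ (2 + 1) γ := by
    have := h.contDiff
    norm_num
    exact this
  exact ((contDiff_succ_iff_deriv).1 h3).2.2

theorem hasDerivAt (h : IsBoundaryParam S γ L) (s : ℝ) : HasDerivAt γ (deriv γ s) s :=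
  (h.contDiff.differentiable (by norm_num) s).hasDerivAt

theorem hasDerivAt_fst (h : IsBoundaryParam S γ L) (s : ℝ) :
    HasDerivAt (fun t => (γ t).1) (deriv γ s).1 s :=
  (hasFDerivAt_fst (p := γ s)).comp_hasDerivAt s (h.hasDerivAt s)

theorem hasDerivAt_snd (h : IsBoundaryParam S γ L) (s : ℝ) :
    HasDerivAt (fun t => (γ t).2) (deriv γ s).2 s :=
  (hasFDerivAt_snd (p := γ s)).comp_hasDerivAt s (h.hasDerivAt s)

theorem hasDerivAt_deriv (h : IsBoundaryParam S γ L) (s : ℝ) :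
    HasDerivAt (deriv γ) (deriv (deriv γ) s) s :=
  (h.contDiff_deriv.differentiable (by norm_num) s).hasDerivAt

theorem hasDerivAt_deriv_fst (h : IsBoundaryParam S γ L) (s : ℝ) :
    HasDerivAt (fun t => (deriv γ t).1) (deriv (deriv γ) s).1 s :=
  (hasFDerivAt_fst (p := deriv γ s)).comp_hasDerivAt s (h.hasDerivAt_deriv s)

theorem hasDerivAt_deriv_snd (h : IsBoundaryParam S γ L) (s : ℝ) :
    HasDerivAt (fun t => (deriv γ t).2) (deriv (deriv γ) s).2 s :=
  (hasFDerivAt_snd (p := deriv γ s)).comp_hasDerivAt s (h.hasDerivAt_deriv s)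

theorem continuous_deriv (h : IsBoundaryParam S γ L) : Continuous (deriv γ) :=
  h.contDiff_deriv.continuous

theorem continuous_deriv_deriv (h : IsBoundaryParam S γ L) : Continuous (deriv (deriv γ)) :=
  h.contDiff_deriv.continuous_deriv (by norm_num)

/-- The curvature of the boundary. -/
noncomputable def curvature (γ : ℝ → ℝ × ℝ) (s : ℝ) : ℝ :=
  (deriv γ s).1 * (deriv (deriv γ) s).2 - (deriv γ s).2 * (deriv (deriv γ) s).1

/-- Frenet formula. -/
theorem deriv_deriv_eq (h : IsBoundaryParam S γ L) (s : ℝ) :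
    (deriv (deriv γ) s).1 = -curvature γ s * (deriv γ s).2 ∧
      (deriv (deriv γ) s).2 = curvature γ s * (deriv γ s).1 := by
  have h1 := ((h.hasDerivAt_deriv_fst s).pow 2).add ((h.hasDerivAt_deriv_snd s).pow 2)
  have h2 : (deriv γ s).1 * (deriv (deriv γ) s).1 + (deriv γ s).2 * (deriv (deriv γ) s).2 = 0 := by
    have h3 : HasDerivAt (fun _ : ℝ => (1 : ℝ)) 0 s := hasDerivAt_const s 1
    have h4 := h3.unique (h1.congr_of_eventuallyEq (Eventually.of_forall fun t => by
      simpa using (h.unit_speed t).symm))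
    simp at h4
    linarith
  have hu := h.unit_speed s
  unfold curvature
  constructor
  · linear_combination (-(deriv (deriv γ) s).1) * hu + (deriv γ s).1 * h2
  · linear_combination (-(deriv (deriv γ) s).2) * hu + (deriv γ s).2 * h2

theorem periodic_curvature (h : IsBoundaryParam S γ L) :
    Function.Periodic (curvature γ) L := by
  have h1 : ∀ f : ℝ → ℝ × ℝ, Function.Periodic f L → Function.Periodic (deriv f) L := by
    intro f hf s
    have : (fun t => f (t + L)) = f := funext hf
    rw [← deriv_comp_add_const, this]
  intro s
  simp only [curvature, h1 _ h.periodic s, h1 _ (h1 _ h.periodic) s]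

theorem curvature_bounds (h : IsBoundaryParam S γ L) :
    ∃ k K : ℝ, 0 < k ∧ ∀ s, k ≤ curvature γ s ∧ curvature γ s ≤ K := by
  have hc : Continuous (curvature γ) := by
    have h1 := h.continuous_deriv
    have h2 := h.continuous_deriv_deriv
    unfold curvature
    fun_prop
  have hne : (Icc 0 L).Nonempty := nonempty_Icc.2 h.length_pos.le
  obtain ⟨s₀, -, hs₀⟩ := isCompact_Icc.exists_isMinOn hne hc.continuousOn
  obtain ⟨s₁, -, hs₁⟩ := isCompact_Icc.exists_isMaxOn hne hc.continuousOn
  refine ⟨curvature γ s₀, curvature γ s₁, h.curvature_pos s₀, fun s => ?_⟩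
  obtain ⟨y, hy, hys⟩ := h.periodic_curvature.exists_mem_Ico₀ h.length_pos s
  rw [hys]
  exact ⟨hs₀ (Ico_subset_Icc_self hy), hs₁ (Ico_subset_Icc_self hy)⟩

theorem hasDerivAt_inward_sub (h : IsBoundaryParam S γ L) (s t : ℝ) :
    HasDerivAt (fun t => inward γ s (γ t - γ s)) (inward γ s (deriv γ t)) t := by
  have := ((h.hasDerivAt_fst t).sub_const (γ s).1).const_mul (-(deriv γ s).2) |>.add
    (((h.hasDerivAt_snd t).sub_const (γ s).2).const_mul (deriv γ s).1)
  exact this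

theorem hasDerivAt_inward_deriv (h : IsBoundaryParam S γ L) (s t : ℝ) :
    HasDerivAt (fun t => inward γ s (deriv γ t)) (inward γ s (deriv (deriv γ) t)) t := by
  have := (h.hasDerivAt_deriv_fst t).const_mul (-(deriv γ s).2) |>.add
    ((h.hasDerivAt_deriv_snd t).const_mul (deriv γ s).1)
  exact this

end IsBoundaryParam

/-- A function that vanishes at `0` together with its derivative is trapped between two parabolas
where its second derivative is bounded. -/
theorem quadratic_bounds {g g' g'' : ℝ → ℝ} (hg : ∀ t, HasDerivAt g (g' t) t)
    (hg' : ∀ t, HasDerivAt g' (g'' t) t) (h0 : g 0 = 0) (h0' : g' 0 = 0) {c C T : ℝ}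
    (hb : ∀ t, 0 ≤ t → t ≤ T → c ≤ g'' t ∧ g'' t ≤ C) {t : ℝ} (ht : 0 ≤ t) (htT : t ≤ T) :
    c * t ^ 2 / 2 ≤ g t ∧ g t ≤ C * t ^ 2 / 2 := by
  have key : ∀ {f f' : ℝ → ℝ}, (∀ t, HasDerivAt f (f' t) t) → f 0 = 0 →
      (∀ t, 0 ≤ t → t ≤ T → 0 ≤ f' t) → ∀ t, 0 ≤ t → t ≤ T → 0 ≤ f t := by
    intro f f' hf hf0 hpos t ht htT
    have hmono : MonotoneOn f (Icc 0 T) := by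
      apply monotoneOn_of_deriv_nonneg (convex_Icc 0 T)
        (fun x _ => (hf x).continuousAt.continuousWithinAt)
        (fun x _ => (hf x).differentiableAt.differentiableWithinAt)
      intro x hx
      rw [interior_Icc] at hx
      rw [(hf x).deriv]
      exact hpos x hx.1.le hx.2.le
    have := hmono ⟨le_rfl, ht.trans htT⟩ ⟨ht, htT⟩ ht
    linarith
  have lin : ∀ a : ℝ, ∀ t, HasDerivAt (fun t => a * t) a t := fun a t => by
    simpa using (hasDerivAt_id t).const_mul a
  have quad : ∀ a : ℝ, ∀ t, HasDerivAt (fun t => a * t ^ 2 / 2) (a * t) t := fun a t => by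
    exact (((hasDerivAt_pow 2 t).const_mul a).div_const 2).congr_deriv (by push_cast; ring)
  have e1 : ∀ t, 0 ≤ t → t ≤ T → 0 ≤ g' t - c * t :=
    key (fun t => (hg' t).sub (lin c t)) (by simp [h0']) fun t h1 h2 => by
      linarith [(hb t h1 h2).1]
  have e2 : ∀ t, 0 ≤ t → t ≤ T → 0 ≤ C * t - g' t :=
    key (fun t => (lin C t).sub (hg' t)) (by simp [h0']) fun t h1 h2 => by
      linarith [(hb t h1 h2).2]
  have e3 := key (fun t => (hg t).sub (quad c t)) (by simp [h0]) e1 t ht htT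
  have e4 := key (fun t => (quad C t).sub (hg t)) (by simp [h0]) e2 t ht htT
  simp only [Pi.sub_apply] at e3 e4
  constructor <;> linarith

namespace IsBoundaryParam

variable {S : Set (ℝ × ℝ)} {γ : ℝ → ℝ × ℝ} {L : ℝ}

/-- Near each of its points the boundary is trapped between two parabolas, uniformly. -/
theorem inward_bounds (h : IsBoundaryParam S γ L) :
    ∃ η c C : ℝ, 0 < η ∧ 0 < c ∧ 0 < C ∧ ∀ s t, |t - s| ≤ η →
      c * (t - s) ^ 2 ≤ inward γ s (γ t - γ s) ∧ inward γ s (γ t - γ s) ≤ C * (t - s) ^ 2 ∧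
      1 / 2 ≤ (deriv γ s).1 * (deriv γ t).1 + (deriv γ s).2 * (deriv γ t).2 := by
  obtain ⟨k, K, hk, hkK⟩ := h.curvature_bounds
  have hK : 0 < K := hk.trans_le ((hkK 0).1.trans (hkK 0).2)
  have hcos : ∀ s t, |t - s| ≤ 1 / (2 * K) →
      1 / 2 ≤ (deriv γ s).1 * (deriv γ t).1 + (deriv γ s).2 * (deriv γ t).2 := by
    intro s t hst
    have hd : ∀ t, HasDerivAt
        (fun t => (deriv γ s).1 * (deriv γ t).1 + (deriv γ s).2 * (deriv γ t).2)
        ((deriv γ s).1 * (deriv (deriv γ) t).1 + (deriv γ s).2 * (deriv (deriv γ) t).2) t :=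
      fun t => ((h.hasDerivAt_deriv_fst t).const_mul _).add
        ((h.hasDerivAt_deriv_snd t).const_mul _)
    have hle : ∀ t, ‖(deriv γ s).1 * (deriv (deriv γ) t).1
        + (deriv γ s).2 * (deriv (deriv γ) t).2‖ ≤ K := by
      intro t
      obtain ⟨e1, e2⟩ := h.deriv_deriv_eq t
      rw [e1, e2, Real.norm_eq_abs]
      have hc : |(deriv γ s).2 * (deriv γ t).1 - (deriv γ s).1 * (deriv γ t).2| ≤ 1 := by
        apply abs_le_of_sq_le_sq _ zero_le_one
        nlinarith [h.unit_speed s, h.unit_speed t,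
          sq_nonneg ((deriv γ s).1 * (deriv γ t).1 + (deriv γ s).2 * (deriv γ t).2)]
      have : (deriv γ s).1 * (-curvature γ t * (deriv γ t).2)
          + (deriv γ s).2 * (curvature γ t * (deriv γ t).1)
          = curvature γ t * ((deriv γ s).2 * (deriv γ t).1 - (deriv γ s).1 * (deriv γ t).2) := by
        ring
      rw [this, abs_mul, abs_of_pos (hk.trans_le (hkK t).1)]
      calc _ ≤ curvature γ t * 1 :=
            mul_le_mul_of_nonneg_left hc (hk.trans_le (hkK t).1).le
        _ ≤ K := by linarith [(hkK t).2]
    have := (convex_univ (𝕜 := ℝ) (E := ℝ)).norm_image_sub_le_of_norm_hasDerivWithin_le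
      (fun x _ => (hd x).hasDerivWithinAt) (fun x _ => hle x) (mem_univ s) (mem_univ t)
    rw [Real.norm_eq_abs, Real.norm_eq_abs] at this
    have h2 : K * |t - s| ≤ 1 / 2 := by
      calc _ ≤ K * (1 / (2 * K)) := mul_le_mul_of_nonneg_left hst hK.le
        _ = 1 / 2 := by field_simp
    have h3 := neg_abs_le ((deriv γ s).1 * (deriv γ t).1 + (deriv γ s).2 * (deriv γ t).2
      - ((deriv γ s).1 * (deriv γ s).1 + (deriv γ s).2 * (deriv γ s).2))
    nlinarith [h.unit_speed s]
  have hsecond : ∀ s t, |t - s| ≤ 1 / (2 * K) → k / 2 ≤ inward γ s (deriv (deriv γ) t) ∧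
      inward γ s (deriv (deriv γ) t) ≤ K := by
    intro s t hst
    have h1 := hcos s t hst
    obtain ⟨e1, e2⟩ := h.deriv_deriv_eq t
    have h2 : (deriv γ s).1 * (deriv γ t).1 + (deriv γ s).2 * (deriv γ t).2 ≤ 1 := by
      nlinarith [h.unit_speed s, h.unit_speed t,
        sq_nonneg ((deriv γ s).1 - (deriv γ t).1), sq_nonneg ((deriv γ s).2 - (deriv γ t).2)]
    have h3 : inward γ s (deriv (deriv γ) t) = curvature γ t *
        ((deriv γ s).1 * (deriv γ t).1 + (deriv γ s).2 * (deriv γ t).2) := by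
      unfold inward
      rw [e1, e2]; ring
    rw [h3]
    have h4 := hkK t
    constructor <;> nlinarith
  refine ⟨1 / (2 * K), k / 4, K / 2, by positivity, by positivity, by positivity,
    fun s t hst => ?_⟩
  have hself : inward γ s (γ s - γ s) = 0 := by simp [inward]
  have hself' : inward γ s (deriv γ s) = 0 := by simp only [inward]; ring
  rcases le_total s t with hle | hle
  · have := quadratic_bounds (g := fun x => inward γ s (γ (s + x) - γ s))
      (g' := fun x => inward γ s (deriv γ (s + x)))
      (g'' := fun x => inward γ s (deriv (deriv γ) (s + x))) (c := k / 2) (C := K)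
      (T := 1 / (2 * K)) (t := t - s)
      (fun x => (h.hasDerivAt_inward_sub s (s + x)).comp_const_add s x)
      (fun x => (h.hasDerivAt_inward_deriv s (s + x)).comp_const_add s x)
      (by simpa using hself) (by simpa using hself')
      (fun x hx hxT => hsecond s (s + x) (by simpa [abs_of_nonneg hx] using hxT))
      (by linarith) (by rwa [abs_of_nonneg (by linarith)] at hst)
    simp only [add_sub_cancel] at this
    refine ⟨by linarith [this.1], by linarith [this.2], hcos s t hst⟩
  · have := quadratic_bounds (g := fun x => inward γ s (γ (s - x) - γ s))
      (g' := fun x => -inward γ s (deriv γ (s - x)))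
      (g'' := fun x => inward γ s (deriv (deriv γ) (s - x))) (c := k / 2) (C := K)
      (T := 1 / (2 * K)) (t := s - t)
      (fun x => (h.hasDerivAt_inward_sub s (s - x)).comp_const_sub s x)
      (fun x => by simpa using ((h.hasDerivAt_inward_deriv s (s - x)).comp_const_sub s x).fun_neg)
      (by simpa using hself) (by simpa using hself')
      (fun x hx hxT => hsecond s (s - x) (by
        rw [show s - x - s = -x by ring, abs_neg, abs_of_nonneg hx]; exact hxT))
      (by linarith) (by rw [abs_of_nonpos (by linarith)] at hst; linarith)
    simp only [sub_sub_cancel] at this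
    refine ⟨by nlinarith [this.1], by nlinarith [this.2], hcos s t hst⟩

/-- Near each of its points the boundary is a graph over the tangent line, between two parabolas
that do not depend on the point. -/
theorem exists_graph (h : IsBoundaryParam S γ L) :
    ∃ δ c C : ℝ, 0 < δ ∧ 0 < c ∧ 0 < C ∧ ∀ s x, |x| ≤ δ → ∃ t y,
      (γ t).1 = (γ s).1 + x * (deriv γ s).1 - y * (deriv γ s).2 ∧
      (γ t).2 = (γ s).2 + x * (deriv γ s).2 + y * (deriv γ s).1 ∧
      c * x ^ 2 ≤ y ∧ y ≤ C * x ^ 2 ∧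
      0 < (deriv γ s).1 * (deriv γ t).1 + (deriv γ s).2 * (deriv γ t).2 := by
  obtain ⟨η, c, C, hη, hc, hC, hb⟩ := h.inward_bounds
  -- the tangential coordinate `X` grows with a speed between `1 / 2` and `1`, and takes the value `x`
  refine ⟨η / 2, c, 4 * C, by positivity, hc, by positivity, fun s x hx => ?_⟩
  set X : ℝ → ℝ := fun t =>
    (deriv γ s).1 * ((γ t).1 - (γ s).1) + (deriv γ s).2 * ((γ t).2 - (γ s).2) with hX
  have hXd : ∀ t, HasDerivAt X
      ((deriv γ s).1 * (deriv γ t).1 + (deriv γ s).2 * (deriv γ t).2) t := fun t =>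
    (((h.hasDerivAt_fst t).sub_const _).const_mul _).add
      (((h.hasDerivAt_snd t).sub_const _).const_mul _)
  have hXs : X s = 0 := by simp [hX]
  have hXcont : Continuous X := continuous_iff_continuousAt.2 fun t => (hXd t).continuousAt
  have hup : ∀ a b, |a - s| ≤ η → |b - s| ≤ η → a ≤ b →
      (b - a) / 2 ≤ X b - X a ∧ X b - X a ≤ b - a := by
    intro a b ha hb' hab
    have hin : ∀ t ∈ Icc a b, |t - s| ≤ η := by
      intro t ht
      rw [abs_le] at *
      constructor <;> linarith [ht.1, ht.2]
    constructor
    · have := (convex_Icc a b).mul_sub_le_image_sub_of_le_deriv (C := 1 / 2)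
        hXcont.continuousOn (fun t _ => (hXd t).differentiableAt.differentiableWithinAt)
        (fun t ht => by
          rw [(hXd t).deriv]; exact (hb s t (hin t (interior_subset ht))).2.2)
        a ⟨le_rfl, hab⟩ b ⟨hab, le_rfl⟩ hab
      linarith
    · have := (convex_Icc a b).image_sub_le_mul_sub_of_deriv_le (C := 1)
        hXcont.continuousOn (fun t _ => (hXd t).differentiableAt.differentiableWithinAt)
        (fun t ht => by
          rw [(hXd t).deriv]
          nlinarith [h.unit_speed s, h.unit_speed t,
            sq_nonneg ((deriv γ s).1 - (deriv γ t).1), sq_nonneg ((deriv γ s).2 - (deriv γ t).2)])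
        a ⟨le_rfl, hab⟩ b ⟨hab, le_rfl⟩ hab
      linarith
  have habs0 : |s - s| ≤ η := by simpa using hη.le
  have hend1 : |s + η - s| ≤ η := by rw [add_sub_cancel_left, abs_of_pos hη]
  have hend2 : |s - η - s| ≤ η := by
    rw [show s - η - s = -η by ring, abs_neg, abs_of_pos hη]
  have hx' := abs_le.1 hx
  obtain ⟨t, ht, hXt⟩ : ∃ t ∈ Icc (s - η) (s + η), X t = x := by
    apply intermediate_value_Icc (by linarith) hXcont.continuousOn
    constructor
    · have := (hup (s - η) s hend2 habs0 (by linarith)).1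
      linarith
    · have := (hup s (s + η) habs0 hend1 (by linarith)).1
      linarith
  have hts : |t - s| ≤ η := by rw [abs_le]; constructor <;> linarith [ht.1, ht.2]
  have hsq : x ^ 2 ≤ (t - s) ^ 2 ∧ (t - s) ^ 2 ≤ 4 * x ^ 2 := by
    rcases le_total s t with hle | hle
    · have := hup s t habs0 hts hle
      rw [hXs, hXt] at this
      constructor <;> nlinarith
    · have := hup t s hts habs0 hle
      rw [hXs, hXt] at this
      constructor <;> nlinarith
  obtain ⟨b1, b2, b3⟩ := hb s t hts
  have hu := h.unit_speed s
  refine ⟨t, inward γ s (γ t - γ s), ?_, ?_, ?_, ?_, by linarith⟩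
  · rw [← hXt]
    simp only [hX, inward, Prod.fst_sub, Prod.snd_sub]
    linear_combination (-((γ t).1 - (γ s).1)) * hu
  · rw [← hXt]
    simp only [hX, inward, Prod.fst_sub, Prod.snd_sub]
    linear_combination (-((γ t).2 - (γ s).2)) * hu
  · nlinarith
  · nlinarith

end IsBoundaryParam

namespace IsBoundaryParam

variable {S : Set (ℝ × ℝ)} {γ : ℝ → ℝ × ℝ} {L : ℝ}

theorem mem (h : IsBoundaryParam S γ L) (hS : IsShape S) (s : ℝ) : γ s ∈ S :=
  hS.isCompact.isClosed.frontier_subset (h.range_eq ▸ mem_range_self s)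

/-- The inner normal is the only direction supporting the shape at a boundary point. -/
theorem support_direction (h : IsBoundaryParam S γ L) (hS : IsShape S) {s : ℝ} {u : ℝ × ℝ}
    (hu : ∀ P ∈ S, 0 ≤ u.1 * (P.1 - (γ s).1) + u.2 * (P.2 - (γ s).2)) :
    ∃ c : ℝ, 0 ≤ c ∧ u.1 = -c * (deriv γ s).2 ∧ u.2 = c * (deriv γ s).1 := by
  have hd : HasDerivAt (fun t => u.1 * ((γ t).1 - (γ s).1) + u.2 * ((γ t).2 - (γ s).2))
      (u.1 * (deriv γ s).1 + u.2 * (deriv γ s).2) s :=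
    (((h.hasDerivAt_fst s).sub_const _).const_mul _).add
      (((h.hasDerivAt_snd s).sub_const _).const_mul _)
  have hmin : IsLocalMin
      (fun t => u.1 * ((γ t).1 - (γ s).1) + u.2 * ((γ t).2 - (γ s).2)) s := by
    refine Eventually.of_forall fun t => ?_
    simpa using hu _ (h.mem hS t)
  have h0 := hmin.hasDerivAt_eq_zero hd
  have hu1 := h.unit_speed s
  set c : ℝ := -u.1 * (deriv γ s).2 + u.2 * (deriv γ s).1 with hc
  have e1 : u.1 = -c * (deriv γ s).2 := by
    rw [hc]; linear_combination (-u.1) * hu1 + (deriv γ s).1 * h0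
  have e2 : u.2 = c * (deriv γ s).1 := by
    rw [hc]; linear_combination (-u.2) * hu1 + (deriv γ s).2 * h0
  refine ⟨c, ?_, e1, e2⟩
  obtain ⟨δ, k, K, hδ, hk, -, hg⟩ := h.exists_graph
  obtain ⟨t, y, t1, t2, hy, -, -⟩ := hg s δ (abs_of_pos hδ).le
  have h1 := hu _ (h.mem hS t)
  rw [e1, e2, t1, t2] at h1
  have h2 : 0 ≤ c * y := by
    have : c * y = -c * (deriv γ s).2 * ((γ s).1 + δ * (deriv γ s).1 - y * (deriv γ s).2
        - (γ s).1) + c * (deriv γ s).1 * ((γ s).2 + δ * (deriv γ s).2 + y * (deriv γ s).1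
        - (γ s).2) := by linear_combination (-c * y) * hu1
    rw [this]; exact h1
  have hy0 : 0 < y := lt_of_lt_of_le (by positivity) hy
  exact nonneg_of_mul_nonneg_left h2 hy0

/-- The tangent lines support the shape. -/
theorem inward_nonneg (h : IsBoundaryParam S γ L) (hS : IsShape S) (s : ℝ) {P : ℝ × ℝ}
    (hP : P ∈ S) : 0 ≤ inward γ s (P - γ s) := by
  have hfr : γ s ∉ interior S := by
    have : γ s ∈ frontier S := h.range_eq ▸ mem_range_self s
    exact this.2
  obtain ⟨f, hf0, hf⟩ :=
    geometric_hahn_banach_of_nonempty_interior_point hS.convex hfr hS.nonempty_interior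
  have hlin : ∀ v : ℝ × ℝ, f v = v.1 * f (1, 0) + v.2 * f (0, 1) := by
    intro v
    conv_lhs => rw [show v = v.1 • ((1 : ℝ), (0 : ℝ)) + v.2 • ((0 : ℝ), (1 : ℝ)) by ext <;> simp]
    rw [map_add, map_smul, map_smul, smul_eq_mul, smul_eq_mul]
  obtain ⟨c, hc, h1, h2⟩ := h.support_direction hS (s := s) (u := (-f (1, 0), -f (0, 1)))
    (fun Q hQ => by
      have := hf Q hQ
      rw [hlin Q, hlin (γ s)] at this
      simp only
      linarith)
  simp only at h1 h2
  have hcpos : 0 < c := by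
    rcases hc.lt_or_eq with h | h
    · exact h
    · refine absurd ?_ hf0
      ext
      · simp [← h] at h1 ⊢; linarith
      · simp [← h] at h2 ⊢; linarith
  have hle := hf P hP
  rw [hlin P, hlin (γ s)] at hle
  have : 0 ≤ c * inward γ s (P - γ s) := by
    simp only [inward, Prod.fst_sub, Prod.snd_sub]
    have e1 : f (1, 0) = c * (deriv γ s).2 := by linarith
    have e2 : f (0, 1) = -c * (deriv γ s).1 := by linarith
    rw [e1, e2] at hle
    linarith
  exact nonneg_of_mul_nonneg_right this hcpos

end IsBoundaryParam

/-- The shape `S` with boundary `γ` rolls inside a ball of radius `R`, and a ball of radius `r`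
rolls inside `S`. -/
structure IsRolling (S : Set (ℝ × ℝ)) (γ : ℝ → ℝ × ℝ) (r R : ℝ) : Prop where
  inner : ∀ s v, v.1 ^ 2 + v.2 ^ 2 ≤ 2 * r * inward γ s v → γ s + v ∈ S
  outer : ∀ s, ∀ P ∈ S,
    (P.1 - (γ s).1) ^ 2 + (P.2 - (γ s).2) ^ 2 ≤ 2 * R * inward γ s (P - γ s)

theorem IsShape.exists_bound {S : Set (ℝ × ℝ)} (hS : IsShape S) :
    ∃ D : ℝ, 0 < D ∧ ∀ P ∈ S, ∀ Q ∈ S, |P.1 - Q.1| ≤ D ∧ |P.2 - Q.2| ≤ D := by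
  obtain ⟨D, hD⟩ := Metric.isBounded_iff.1 hS.isCompact.isBounded
  refine ⟨max D 1, by positivity, fun P hP Q hQ => ?_⟩
  have h1 := hD hP hQ
  rw [Prod.dist_eq, Real.dist_eq, Real.dist_eq] at h1
  exact ⟨(le_max_left _ _).trans (h1.trans (le_max_left _ _)),
    (le_max_right _ _).trans (h1.trans (le_max_left _ _))⟩

namespace IsBoundaryParam

variable {S : Set (ℝ × ℝ)} {γ : ℝ → ℝ × ℝ} {L : ℝ}

/-- The shape rolls inside a ball: near `γ s` this is the lower parabola of the graph, and points
far away are moved towards `γ s` by convexity. -/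
theorem exists_outer (h : IsBoundaryParam S γ L) (hS : IsShape S) :
    ∃ R : ℝ, 0 < R ∧ ∀ s, ∀ P ∈ S,
      (P.1 - (γ s).1) ^ 2 + (P.2 - (γ s).2) ^ 2 ≤ 2 * R * inward γ s (P - γ s) := by
  obtain ⟨δ, c, C, hδ, hc, hC, hg⟩ := h.exists_graph
  obtain ⟨D, hD, hDb⟩ := hS.exists_bound
  -- points of `S` above the abscissa `x` of a graph point are above the graph
  have hnear : ∀ s, ∀ P ∈ S, |(deriv γ s).1 * (P.1 - (γ s).1) + (deriv γ s).2 * (P.2 - (γ s).2)|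
      ≤ δ → c * ((deriv γ s).1 * (P.1 - (γ s).1) + (deriv γ s).2 * (P.2 - (γ s).2)) ^ 2
        ≤ inward γ s (P - γ s) := by
    intro s P hP hx
    obtain ⟨t, y, t1, t2, hy, -, hcos⟩ := hg s _ hx
    have h1 := h.inward_nonneg hS t hP
    have hu := h.unit_speed s
    set x := (deriv γ s).1 * (P.1 - (γ s).1) + (deriv γ s).2 * (P.2 - (γ s).2) with hxdef
    set Y := inward γ s (P - γ s) with hY
    have e1 : P.1 = (γ s).1 + x * (deriv γ s).1 - Y * (deriv γ s).2 := by
      rw [hxdef, hY]; simp only [inward, Prod.fst_sub, Prod.snd_sub]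
      linear_combination (-(P.1 - (γ s).1)) * hu
    have e2 : P.2 = (γ s).2 + x * (deriv γ s).2 + Y * (deriv γ s).1 := by
      rw [hxdef, hY]; simp only [inward, Prod.fst_sub, Prod.snd_sub]
      linear_combination (-(P.2 - (γ s).2)) * hu
    have h2 : 0 ≤ (Y - y) *
        ((deriv γ s).1 * (deriv γ t).1 + (deriv γ s).2 * (deriv γ t).2) := by
      simp only [inward, Prod.fst_sub, Prod.snd_sub] at h1
      rw [e1, e2, t1, t2] at h1
      linarith
    have h3 := nonneg_of_mul_nonneg_left h2 hcos
    linarith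
  set c' : ℝ := min c (c * δ / (2 * D)) with hc'
  have hc'pos : 0 < c' := lt_min hc (by positivity)
  refine ⟨(1 / c' + 2 * D) / 2, by positivity, fun s P hP => ?_⟩
  have hu := h.unit_speed s
  have hpp := h.inward_nonneg hS s hP
  obtain ⟨d1, d2⟩ := hDb P hP _ (h.mem hS s)
  have hp1 : |(deriv γ s).1| ≤ 1 := abs_le_of_sq_le_sq (by nlinarith [sq_nonneg (deriv γ s).2]) zero_le_one
  have hp2 : |(deriv γ s).2| ≤ 1 := abs_le_of_sq_le_sq (by nlinarith [sq_nonneg (deriv γ s).1]) zero_le_one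
  set x := (deriv γ s).1 * (P.1 - (γ s).1) + (deriv γ s).2 * (P.2 - (γ s).2) with hxdef
  set Y := inward γ s (P - γ s) with hY
  have hsum : (P.1 - (γ s).1) ^ 2 + (P.2 - (γ s).2) ^ 2 = x ^ 2 + Y ^ 2 := by
    rw [hxdef, hY]; simp only [inward, Prod.fst_sub, Prod.snd_sub]
    linear_combination (-((P.1 - (γ s).1) ^ 2 + (P.2 - (γ s).2) ^ 2)) * hu
  have hbound : ∀ a b X Z : ℝ, |a| ≤ 1 → |b| ≤ 1 → |X| ≤ D → |Z| ≤ D → |a * X + b * Z| ≤ 2 * D := by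
    intro a b X Z ha hb hX hZ
    calc _ ≤ |a| * |X| + |b| * |Z| := by
          rw [← abs_mul, ← abs_mul]; exact abs_add_le _ _
      _ ≤ 1 * D + 1 * D := by gcongr
      _ = 2 * D := by ring
  have hxD : |x| ≤ 2 * D := hbound _ _ _ _ hp1 hp2 d1 d2
  have hYD : Y ≤ 2 * D := by
    refine (le_abs_self _).trans ?_
    rw [hY]; simp only [inward, Prod.fst_sub, Prod.snd_sub]
    exact hbound _ _ _ _ (by rwa [abs_neg]) hp1 d1 d2
  have hmain : c' * x ^ 2 ≤ Y := by
    rcases le_total |x| δ with hx | hx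
    · have := hnear s P hP hx
      calc c' * x ^ 2 ≤ c * x ^ 2 := by gcongr; exact min_le_left _ _
        _ ≤ Y := this
    · -- shrink the point towards `γ s`
      have hxpos : 0 < |x| := hδ.trans_le hx
      set l := δ / |x| with hl
      have hl0 : 0 ≤ l := by positivity
      have hl1 : l ≤ 1 := (div_le_one hxpos).2 hx
      have hmem := convex_combo_mem hS.convex (h.mem hS s) hP hl0 hl1
        (X := ((γ s).1 + l * (P.1 - (γ s).1), (γ s).2 + l * (P.2 - (γ s).2))) rfl rfl
      have hlx : (deriv γ s).1 * ((γ s).1 + l * (P.1 - (γ s).1) - (γ s).1)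
          + (deriv γ s).2 * ((γ s).2 + l * (P.2 - (γ s).2) - (γ s).2) = l * x := by
        rw [hxdef]; ring
      have habs : |l * x| = δ := by
        rw [abs_mul, abs_of_nonneg hl0, hl]; field_simp
      have := hnear s _ hmem (by simp only; rw [hlx, habs])
      simp only [hlx] at this
      have hYl : inward γ s (((γ s).1 + l * (P.1 - (γ s).1), (γ s).2 + l * (P.2 - (γ s).2)) - γ s)
          = l * Y := by
        rw [hY]; simp only [inward, Prod.fst_sub, Prod.snd_sub]; ring
      rw [hYl, ← sq_abs, habs] at this
      have h5 : c * δ * |x| ≤ Y := by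
        have : c * δ ^ 2 * |x| ≤ δ * Y := by
          calc c * δ ^ 2 * |x| ≤ l * Y * |x| := by gcongr
            _ = δ * Y := by rw [hl]; field_simp
        nlinarith
      calc c' * x ^ 2 ≤ c * δ / (2 * D) * x ^ 2 := by gcongr; exact min_le_right _ _
        _ = c * δ * |x| * (|x| / (2 * D)) := by rw [← sq_abs]; field_simp
        _ ≤ c * δ * |x| * 1 := by
          gcongr
          rw [div_le_one (by positivity)]; exact hxD
        _ ≤ Y := by linarith
  rw [hsum]
  have h6 : x ^ 2 ≤ 1 / c' * Y := by
    rw [one_div, inv_mul_eq_div, le_div_iff₀ hc'pos]; linarith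
  nlinarith

/-- A ball rolls inside the shape: if it is small, it lies between the upper parabola of the graph
and a chord of the graph. -/
theorem exists_inner (h : IsBoundaryParam S γ L) (hS : IsShape S) :
    ∃ r : ℝ, 0 < r ∧ ∀ s v, v.1 ^ 2 + v.2 ^ 2 ≤ 2 * r * inward γ s v → γ s + v ∈ S := by
  obtain ⟨δ, c, C, hδ, hc, hC, hg⟩ := h.exists_graph
  obtain ⟨r, hr⟩ : ∃ r, r = min (min (1 / (2 * C)) (c * δ ^ 2 / 2)) (δ / 2) := ⟨_, rfl⟩
  have hr0 : 0 < r := hr ▸ lt_min (lt_min (by positivity) (by positivity)) (by positivity)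
  have hr1 : 2 * r * C ≤ 1 := by
    have : r ≤ 1 / (2 * C) := hr ▸ (min_le_left _ _).trans (min_le_left _ _)
    rw [le_div_iff₀ (by positivity)] at this
    linarith
  have hr2 : 2 * r ≤ c * δ ^ 2 := by
    have : r ≤ c * δ ^ 2 / 2 := hr ▸ (min_le_left _ _).trans (min_le_right _ _)
    linarith
  have hr3 : 2 * r ≤ δ := by
    have : r ≤ δ / 2 := hr ▸ min_le_right _ _
    linarith
  refine ⟨r, hr0, fun s v hv => ?_⟩
  have hu := h.unit_speed s
  obtain ⟨x, hx⟩ : ∃ x, x = (deriv γ s).1 * v.1 + (deriv γ s).2 * v.2 := ⟨_, rfl⟩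
  obtain ⟨Y, hY⟩ : ∃ Y, Y = inward γ s v := ⟨_, rfl⟩
  rw [← hY] at hv
  have e1 : v.1 = x * (deriv γ s).1 - Y * (deriv γ s).2 := by
    rw [hx, hY]; simp only [inward]
    linear_combination (-v.1) * hu
  have e2 : v.2 = x * (deriv γ s).2 + Y * (deriv γ s).1 := by
    rw [hx, hY]; simp only [inward]
    linear_combination (-v.2) * hu
  have hsum : v.1 ^ 2 + v.2 ^ 2 = x ^ 2 + Y ^ 2 := by
    rw [e1, e2]; linear_combination (x ^ 2 + Y ^ 2) * hu
  rw [hsum] at hv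
  have hY0 : 0 ≤ Y := by nlinarith [sq_nonneg x, sq_nonneg Y]
  have hY1 : Y ≤ 2 * r := by
    by_contra hcon
    push Not at hcon
    nlinarith [sq_nonneg x]
  have hxr : x ^ 2 ≤ (2 * r) ^ 2 := by nlinarith [sq_nonneg Y]
  have hxδ : |x| ≤ δ := by
    have := abs_le_of_sq_le_sq hxr (by positivity)
    linarith
  obtain ⟨hxl, hxu⟩ := abs_le.1 hxδ
  -- the chord between the two ends of the local graph, at abscissa `x`
  obtain ⟨t₁, y₁, a1, a2, hy₁, -, -⟩ := hg s δ (abs_of_pos hδ).le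
  obtain ⟨t₂, y₂, b1, b2, hy₂, -, -⟩ := hg s (-δ) (by rw [abs_neg, abs_of_pos hδ])
  obtain ⟨t, y, d1, d2, -, hy, -⟩ := hg s x hxδ
  obtain ⟨l, hl⟩ : ∃ l, l = (x + δ) / (2 * δ) := ⟨_, rfl⟩
  have hl0 : 0 ≤ l := hl ▸ div_nonneg (by linarith) (by positivity)
  have hl1 : l ≤ 1 := hl ▸ (div_le_one (by positivity)).2 (by linarith)
  have hlx : -δ + l * (2 * δ) = x := by rw [hl]; field_simp; ring
  obtain ⟨Z, hZ⟩ : ∃ Z, Z = y₂ + l * (y₁ - y₂) := ⟨_, rfl⟩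
  have hZl : c * δ ^ 2 ≤ Z := by
    rw [neg_sq] at hy₂
    have i1 := mul_nonneg (sub_nonneg.2 hl1) (sub_nonneg.2 hy₂)
    have i2 := mul_nonneg hl0 (sub_nonneg.2 hy₁)
    rw [hZ]
    linarith
  have hchord := convex_combo_mem hS.convex (h.mem hS t₂) (h.mem hS t₁) hl0 hl1
    (X := ((γ s).1 + x * (deriv γ s).1 - Z * (deriv γ s).2,
      (γ s).2 + x * (deriv γ s).2 + Z * (deriv γ s).1))
    (by simp only; rw [a1, b1, hZ, ← hlx]; ring) (by simp only; rw [a2, b2, hZ, ← hlx]; ring)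
  have hyY : y ≤ Y := by
    have i1 : C * x ^ 2 ≤ C * (2 * r * Y) :=
      mul_le_mul_of_nonneg_left (by linarith [sq_nonneg Y]) hC.le
    have i2 : 2 * r * C * Y ≤ 1 * Y := mul_le_mul_of_nonneg_right hr1 hY0
    linarith
  have hYZ : Y ≤ Z := by linarith
  rcases hYZ.lt_or_eq with hlt | heq
  · refine convex_combo_mem hS.convex (h.mem hS t) hchord (t := (Y - y) / (Z - y))
      (div_nonneg (by linarith) (by linarith)) ((div_le_one (by linarith)).2 (by linarith)) ?_ ?_
    · simp only [Prod.fst_add]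
      have : (Y - y) / (Z - y) * (Z - y) = Y - y := div_mul_cancel₀ _ (by linarith)
      rw [d1, e1]
      linear_combination (deriv γ s).2 * this
    · simp only [Prod.snd_add]
      have : (Y - y) / (Z - y) * (Z - y) = Y - y := div_mul_cancel₀ _ (by linarith)
      rw [d2, e2]
      linear_combination (-(deriv γ s).1) * this
  · convert hchord using 1
    ext
    · simp only [Prod.fst_add]; rw [e1, heq]; ring
    · simp only [Prod.snd_add]; rw [e2, heq]; ring

/-- Two parametrizations of the same boundary have the same normals, so that rolling radii found
for one of them serve for all. -/
theorem isRolling_of_isRolling {γ' : ℝ → ℝ × ℝ} {L' r R : ℝ} (h : IsBoundaryParam S γ L)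
    (h' : IsBoundaryParam S γ' L') (hS : IsShape S) (hr : IsRolling S γ r R) :
    IsRolling S γ' r R := by
  have key : ∀ s, ∃ t, γ t = γ' s ∧ ∀ v, inward γ t v = inward γ' s v := by
    intro s
    have : γ' s ∈ range γ := by rw [h.range_eq, ← h'.range_eq]; exact mem_range_self s
    obtain ⟨t, ht⟩ := this
    refine ⟨t, ht, fun v => ?_⟩
    obtain ⟨c, hc, h1, h2⟩ := h'.support_direction hS (s := s)
      (u := (-(deriv γ t).2, (deriv γ t).1)) (fun P hP => by
        have := h.inward_nonneg hS t hP
        simpa only [inward, Prod.fst_sub, Prod.snd_sub, ht] using this)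
    simp only at h1 h2
    have hc1 : c = 1 := by
      have e1 := h.unit_speed t
      have e2 := h'.unit_speed s
      have : (c - 1) * (c + 1) = 0 := by
        have e3 : (deriv γ t).2 = c * (deriv γ' s).2 := by linarith
        rw [h2, e3] at e1
        linear_combination e1 - c ^ 2 * e2
      rcases mul_eq_zero.1 this with h | h <;> linarith
    simp only [inward]
    rw [h1, h2, hc1]; ring
  constructor
  · intro s v hv
    obtain ⟨t, ht, hi⟩ := key s
    rw [← ht]
    exact hr.inner t v (by rwa [hi])
  · intro s P hP
    obtain ⟨t, ht, hi⟩ := key s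
    rw [← ht, ← hi]
    exact hr.outer t P hP

end IsBoundaryParam

/-- Rolling radii that depend on the shape only, not on the parametrization. -/
theorem IsShape.exists_isRolling {S : Set (ℝ × ℝ)} (hS : IsShape S) :
    ∃ r R : ℝ, 0 < r ∧ r ≤ R ∧ ∀ γ L, IsBoundaryParam S γ L → IsRolling S γ r R := by
  obtain ⟨γ, L, h⟩ := hS.boundary
  obtain ⟨R, hR, ho⟩ := h.exists_outer hS
  obtain ⟨r, hr, hi⟩ := h.exists_inner hS
  refine ⟨min r R, R, lt_min hr hR, min_le_right _ _, fun γ' L' h' =>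
    h.isRolling_of_isRolling h' hS ⟨fun s v hv => hi s v (hv.trans ?_), ho⟩⟩
  have : 0 ≤ inward γ s v := by
    have h1 : 0 ≤ 2 * min r R * inward γ s v := (by positivity : 0 ≤ v.1 ^ 2 + v.2 ^ 2).trans hv
    exact nonneg_of_mul_nonneg_right h1 (by have := lt_min hr hR; positivity)
  gcongr
  exact min_le_left _ _

namespace IsBoundaryParam

variable {S : Set (ℝ × ℝ)} {γ : ℝ → ℝ × ℝ} {L : ℝ}

theorem exists_support (h : IsBoundaryParam S γ L) (hS : IsShape S) {u : ℝ × ℝ} (hu : u ≠ 0) :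
    ∃ t, ∀ P ∈ S, 0 ≤ u.1 * (P.1 - (γ t).1) + u.2 * (P.2 - (γ t).2) := by
  have hcont : Continuous fun P : ℝ × ℝ => u.1 * P.1 + u.2 * P.2 := by fun_prop
  have hne : S.Nonempty := hS.nonempty_interior.mono interior_subset
  obtain ⟨V, hV, hmin⟩ := hS.isCompact.exists_isMinOn hne hcont.continuousOn
  have hpos : 0 < u.1 ^ 2 + u.2 ^ 2 := by
    rcases eq_or_ne u.1 0 with h1 | h1
    · have h2 : u.2 ≠ 0 := fun h2 => hu (Prod.ext h1 h2)
      positivity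
    · positivity
  have hfr : V ∈ frontier S := by
    refine ⟨subset_closure hV, fun hint => ?_⟩
    have hc : ContinuousAt (fun e : ℝ => (V.1 - e * u.1, V.2 - e * u.2)) 0 := by fun_prop
    have hmem : ∀ᶠ e : ℝ in 𝓝 0, (V.1 - e * u.1, V.2 - e * u.2) ∈ interior S :=
      hc (by simpa using isOpen_interior.mem_nhds hint)
    obtain ⟨e, he, hepos⟩ := ((hmem.filter_mono nhdsWithin_le_nhds).and
      (self_mem_nhdsWithin : ∀ᶠ e : ℝ in 𝓝[>] 0, e ∈ Ioi 0)).exists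
    have := hmin (interior_subset he)
    simp only [mem_ofPred_eq] at this
    have hepos : 0 < e := hepos
    nlinarith [mul_pos hepos hpos]
  rw [← h.range_eq] at hfr
  obtain ⟨t, rfl⟩ := hfr
  refine ⟨t, fun P hP => ?_⟩
  have := hmin hP
  simp only [mem_ofPred_eq] at this
  linarith

theorem exists_inward_neg (h : IsBoundaryParam S γ L) (hS : IsShape S) {W : ℝ × ℝ}
    (hW : W ∉ S) : ∃ t, inward γ t (W - γ t) < 0 := by
  obtain ⟨f, a, hfW, hf⟩ :=
    geometric_hahn_banach_point_closed hS.convex hS.isCompact.isClosed hW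
  have hlin : ∀ v : ℝ × ℝ, f v = v.1 * f (1, 0) + v.2 * f (0, 1) := by
    intro v
    conv_lhs => rw [show v = v.1 • ((1 : ℝ), (0 : ℝ)) + v.2 • ((0 : ℝ), (1 : ℝ)) by ext <;> simp]
    rw [map_add, map_smul, map_smul, smul_eq_mul, smul_eq_mul]
  have hu : (f (1, 0), f (0, 1)) ≠ 0 := by
    intro h0
    rw [Prod.mk_eq_zero] at h0
    obtain ⟨Q, hQ⟩ := hS.nonempty_interior.mono interior_subset
    have := hf Q hQ
    rw [hlin, h0.1, h0.2] at hfW this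
    linarith
  obtain ⟨t, ht⟩ := h.exists_support hS hu
  obtain ⟨c, hc, h1, h2⟩ := h.support_direction hS ht
  simp only at h1 h2
  have h3 := hf _ (h.mem hS t)
  rw [hlin] at h3 hfW
  refine ⟨t, ?_⟩
  have h4 : c * inward γ t (W - γ t) < 0 := by
    simp only [inward, Prod.fst_sub, Prod.snd_sub]
    rw [h1, h2] at h3 hfW
    linarith
  by_contra hcon
  push Not at hcon
  nlinarith

theorem abs_inward_le (h : IsBoundaryParam S γ L) (s : ℝ) {v : ℝ × ℝ} {a : ℝ} (ha : 0 ≤ a)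
    (hv : v.1 ^ 2 + v.2 ^ 2 ≤ a ^ 2) : |inward γ s v| ≤ a := by
  apply abs_le_of_sq_le_sq _ ha
  have : inward γ s v ^ 2 + ((deriv γ s).1 * v.1 + (deriv γ s).2 * v.2) ^ 2
      = v.1 ^ 2 + v.2 ^ 2 := by
    simp only [inward]
    linear_combination (v.1 ^ 2 + v.2 ^ 2) * h.unit_speed s
  nlinarith [sq_nonneg ((deriv γ s).1 * v.1 + (deriv γ s).2 * v.2)]

theorem periodic_deriv (h : IsBoundaryParam S γ L) : Function.Periodic (deriv γ) L := by
  intro s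
  have : (fun t => γ (t + L)) = γ := funext h.periodic
  rw [← deriv_comp_add_const, this]

end IsBoundaryParam

/-- A convex set that is a union of balls of radius `ρ` and in which the midpoint of each chord
`P Q` has a neighbourhood of radius at least `|P Q| ^ 2 / (8 * ϱ)`, as is the case for an
intersection of balls of radius `ϱ`. -/
structure RoundBody (K : Set (ℝ × ℝ)) (ρ ϱ : ℝ) : Prop where
  convex : Convex ℝ K
  ball : ∀ P ∈ K, ∃ u : ℝ × ℝ, u.1 ^ 2 + u.2 ^ 2 ≤ ρ ^ 2 ∧
    ∀ v : ℝ × ℝ, (v.1 - u.1) ^ 2 + (v.2 - u.2) ^ 2 ≤ ρ ^ 2 → P + v ∈ K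
  round : ∀ P ∈ K, ∀ Q ∈ K, ∀ v : ℝ × ℝ,
    v.1 ^ 2 + v.2 ^ 2 ≤ (((P.1 - Q.1) ^ 2 + (P.2 - Q.2) ^ 2) / (8 * ϱ)) ^ 2 →
      ((P.1 + Q.1) / 2 + v.1, (P.2 + Q.2) / 2 + v.2) ∈ K

/-- A shape with rolling balls is round: each of its points is the centre of a ball of radius `r`
in the shape or belongs to such a ball touching the nearest boundary point, and each ball of radius `R` around it satisfies the sagitta inequality. -/
theorem IsShape.roundBody {S : Set (ℝ × ℝ)} {γ : ℝ → ℝ × ℝ} {L r R : ℝ} (hS : IsShape S)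
    (h : IsBoundaryParam S γ L) (hr : 0 < r) (hR : 0 < R) (hrol : IsRolling S γ r R) :
    RoundBody S r R := by
  refine ⟨hS.convex, fun P hP => ?_, fun P hP Q hQ v hv => ?_⟩
  · -- the deepest ball containing `P` touches the closest tangent line
    have hcont : Continuous fun t => inward γ t (P - γ t) := by
      have h1 := h.continuous_deriv
      have h2 := h.contDiff.continuous
      unfold inward
      fun_prop
    have hper : Function.Periodic (fun t => inward γ t (P - γ t)) L := fun t => by
      simp only [inward, h.periodic_deriv t, h.periodic t]
    obtain ⟨t, -, ht⟩ := isCompact_Icc.exists_isMinOn (nonempty_Icc.2 h.length_pos.le)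
      (hcont.continuousOn (s := Icc 0 L))
    have hmin : ∀ t', inward γ t (P - γ t) ≤ inward γ t' (P - γ t') := fun t' => by
      obtain ⟨y, hy, hys⟩ := hper.exists_mem_Ico₀ h.length_pos t'
      refine le_of_le_of_eq ?_ hys.symm
      exact ht (Ico_subset_Icc_self hy)
    obtain ⟨d, hd⟩ : ∃ d, d = inward γ t (P - γ t) := ⟨_, rfl⟩
    rw [← hd] at hmin
    have hd0 : 0 ≤ d := hd ▸ h.inward_nonneg hS t hP
    rcases le_total r d with hrd | hrd
    · refine ⟨0, by simp; positivity, fun v hv => ?_⟩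
      by_contra hcon
      obtain ⟨t', ht'⟩ := h.exists_inward_neg hS hcon
      have h1 := hmin t'
      have h2 := abs_le.1 (h.abs_inward_le t' hr.le (v := v) (by simpa using hv))
      have h3 : inward γ t' (P + v - γ t') = inward γ t' (P - γ t') + inward γ t' v := by
        simp only [inward, Prod.fst_sub, Prod.snd_sub, Prod.fst_add, Prod.snd_add]; ring
      linarith [h2.1]
    · have hu := h.unit_speed t
      have hWS : P - d • (-(deriv γ t).2, (deriv γ t).1) ∈ S := by
        by_contra hcon
        obtain ⟨t', ht'⟩ := h.exists_inward_neg hS hcon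
        have h1 := hmin t'
        have h2 := abs_le.1 (h.abs_inward_le t' zero_le_one (v := (-(deriv γ t).2, (deriv γ t).1))
          (by simp only; linarith))
        have h3 : inward γ t' (P - d • (-(deriv γ t).2, (deriv γ t).1) - γ t')
            = inward γ t' (P - γ t') - d * inward γ t' (-(deriv γ t).2, (deriv γ t).1) := by
          simp only [inward, Prod.fst_sub, Prod.snd_sub, Prod.smul_fst, Prod.smul_snd, smul_eq_mul]
          ring
        nlinarith [h2.2]
      have h1 := hrol.outer t _ hWS
      have h2 : inward γ t (P - d • (-(deriv γ t).2, (deriv γ t).1) - γ t) = 0 := by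
        rw [show (0 : ℝ) = d - d by ring]
        nth_rw 2 [hd]
        simp only [inward, Prod.fst_sub, Prod.snd_sub, Prod.smul_fst, Prod.smul_snd, smul_eq_mul]
        linear_combination (-d) * hu
      rw [h2, mul_zero] at h1
      simp only [Prod.fst_sub, Prod.snd_sub, Prod.smul_fst, Prod.smul_snd, smul_eq_mul] at h1
      have e1 : P.1 - d * -(deriv γ t).2 - (γ t).1 = 0 := by
        nlinarith [sq_nonneg (P.1 - d * -(deriv γ t).2 - (γ t).1),
          sq_nonneg (P.2 - d * (deriv γ t).1 - (γ t).2)]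
      have e2 : P.2 - d * (deriv γ t).1 - (γ t).2 = 0 := by
        nlinarith [sq_nonneg (P.1 - d * -(deriv γ t).2 - (γ t).1),
          sq_nonneg (P.2 - d * (deriv γ t).1 - (γ t).2)]
      refine ⟨(r - d) • (-(deriv γ t).2, (deriv γ t).1), ?_, fun v hv => ?_⟩
      · simp only [Prod.smul_fst, Prod.smul_snd, smul_eq_mul]
        have e : ((r - d) * -(deriv γ t).2) ^ 2 + ((r - d) * (deriv γ t).1) ^ 2 = (r - d) ^ 2 := by
          linear_combination (r - d) ^ 2 * hu
        rw [e]
        gcongr; linarith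
      · have h3 := hrol.inner t (v + d • (-(deriv γ t).2, (deriv γ t).1)) (by
          simp only [inward, Prod.fst_add, Prod.snd_add, Prod.smul_fst, Prod.smul_snd,
            smul_eq_mul] at hv ⊢
          nlinarith)
        convert h3 using 1
        ext
        · simp only [Prod.fst_add, Prod.smul_fst, smul_eq_mul]; linarith
        · simp only [Prod.snd_add, Prod.smul_snd, smul_eq_mul]; linarith
  · by_contra hcon
    obtain ⟨t, ht⟩ := h.exists_inward_neg hS hcon
    have h1 := hrol.outer t P hP
    have h2 := hrol.outer t Q hQ
    have h3 := abs_le.1 (h.abs_inward_le t (by positivity) hv)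
    have h4 : inward γ t (((P.1 + Q.1) / 2 + v.1, (P.2 + Q.2) / 2 + v.2) - γ t)
        = (inward γ t (P - γ t) + inward γ t (Q - γ t)) / 2 + inward γ t v := by
      simp only [inward, Prod.fst_sub, Prod.snd_sub]; ring
    rw [h4] at ht
    have h5 : ((P.1 - Q.1) ^ 2 + (P.2 - Q.2) ^ 2) / (8 * R) * (8 * R)
        = (P.1 - Q.1) ^ 2 + (P.2 - Q.2) ^ 2 := div_mul_cancel₀ _ (by positivity)
    have h6 : (inward γ t (P - γ t) + inward γ t (Q - γ t)) / 2 * (8 * R)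
        < (P.1 - Q.1) ^ 2 + (P.2 - Q.2) ^ 2 := by
      rw [← h5]
      exact mul_lt_mul_of_pos_right (by linarith [h3.1]) (by positivity)
    nlinarith [sq_nonneg (P.1 + Q.1 - 2 * (γ t).1), sq_nonneg (P.2 + Q.2 - 2 * (γ t).2)]

/-- The shape in grid units. -/
def scaled (h : ℝ) (S : Set (ℝ × ℝ)) : Set (ℝ × ℝ) := {x | (h * x.1, h * x.2) ∈ S}

theorem RoundBody.scaled {S : Set (ℝ × ℝ)} {r R h : ℝ} (hS : RoundBody S r R) (hh : 0 < h)
    (hR : 0 < R) : RoundBody (scaled h S) (r / h) (R / h) := by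
  have hne : h ≠ 0 := hh.ne'
  refine ⟨?_, fun P hP => ?_, fun P hP Q hQ v hv => ?_⟩
  · intro P hP Q hQ a b ha hb hab
    have := hS.convex hP hQ ha hb hab
    simp only [DigitalTangent.scaled, mem_ofPred_eq] at this ⊢
    convert this using 1
    ext <;> simp <;> ring
  · obtain ⟨u, hu, hv⟩ := hS.ball _ hP
    refine ⟨(u.1 / h, u.2 / h), ?_, fun v hvu => ?_⟩
    · simp only [div_pow, ← add_div]
      gcongr
    · have := hv (h * v.1, h * v.2) (by
        have e : (h * v.1 - u.1) ^ 2 + (h * v.2 - u.2) ^ 2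
          = h ^ 2 * ((v.1 - u.1 / h) ^ 2 + (v.2 - u.2 / h) ^ 2) := by field_simp
        simp only
        rw [e]
        calc _ ≤ h ^ 2 * (r / h) ^ 2 := by gcongr
          _ = r ^ 2 := by field_simp)
      simp only [DigitalTangent.scaled, mem_ofPred_eq]
      convert this using 1
      ext <;> simp <;> ring
  · have := hS.round _ hP _ hQ (h * v.1, h * v.2) (by
      have e : (((h * P.1 - h * Q.1) ^ 2 + (h * P.2 - h * Q.2) ^ 2) / (8 * R)) ^ 2
        = h ^ 2 * (((P.1 - Q.1) ^ 2 + (P.2 - Q.2) ^ 2) / (8 * (R / h))) ^ 2 := by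
        field_simp
      simp only
      rw [e]
      calc _ = h ^ 2 * (v.1 ^ 2 + v.2 ^ 2) := by ring
        _ ≤ _ := by gcongr)
    simp only [DigitalTangent.scaled, mem_ofPred_eq]
    convert this using 1
    ext <;> simp <;> ring

/-! ### Staircase paths along the boundary of a round body -/

/-- A digital point as a real point. -/
def pt (P : ℤ × ℤ) : ℝ × ℝ := ((P.1 : ℝ), (P.2 : ℝ))

@[simp] theorem pt_fst (P : ℤ × ℤ) : (pt P).1 = (P.1 : ℝ) := rfl
@[simp] theorem pt_snd (P : ℤ × ℤ) : (pt P).2 = (P.2 : ℝ) := rfl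

/-- The portion of `C` between `m` and `n` climbs inside `K` by unit steps to the right and
upwards, and its upper left diagonal neighbours are outside `K`. Such paths are graphs over the
coordinate `x + y`, which increases by one at each step. -/
structure IsStair (K : Set (ℝ × ℝ)) (C : ℤ → ℤ × ℤ) (m n : ℤ) : Prop where
  mem : ∀ i, m ≤ i → i ≤ n → pt (C i) ∈ K
  step : ∀ i, m ≤ i → i < n → C (i + 1) = C i + (1, 0) ∨ C (i + 1) = C i + (0, 1)
  out : ∀ i, m ≤ i → i ≤ n → pt (C i + (-1, 1)) ∉ K

theorem mem_of_antidiagonal {K : Set (ℝ × ℝ)} (hK : Convex ℝ K) {P Q V : ℝ × ℝ} (hP : P ∈ K)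
    (hQ : Q ∈ K) (h1 : P.1 + P.2 = V.1 + V.2) (h2 : Q.1 + Q.2 = V.1 + V.2) (h3 : P.2 ≤ V.2)
    (h4 : V.2 ≤ Q.2) : V ∈ K := by
  rcases h3.lt_or_eq with h | h
  · have h5 : (V.2 - P.2) / (Q.2 - P.2) * (Q.2 - P.2) = V.2 - P.2 :=
      div_mul_cancel₀ _ (by linarith)
    refine convex_combo_mem hK hP hQ (t := (V.2 - P.2) / (Q.2 - P.2))
      (div_nonneg (by linarith) (by linarith)) ((div_le_one (by linarith)).2 (by linarith)) ?_ ?_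
    · linear_combination (-1) * h1 + (V.2 - P.2) / (Q.2 - P.2) * (h1 - h2) + h5
    · linarith
  · have : V = P := Prod.ext (by linarith) h.symm
    rwa [this]

theorem steps_monotone {C : ℤ → ℤ × ℤ} {m n : ℤ}
    (h : ∀ i, m ≤ i → i < n → C (i + 1) = C i + (1, 0) ∨ C (i + 1) = C i + (0, 1))
    {i j : ℤ} (hi : m ≤ i) (hij : i ≤ j) (hj : j ≤ n) :
    (C i).1 ≤ (C j).1 ∧ (C i).2 ≤ (C j).2 ∧ (C j).1 + (C j).2 = (C i).1 + (C i).2 + (j - i) := by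
  induction j, hij using Int.leInduction with
  | base => simp
  | succ k hk ih =>
    obtain ⟨h1, h2, h3⟩ := ih (by omega)
    rcases h k (by omega) (by omega) with e | e <;> rw [e] <;>
      simp only [Prod.fst_add, Prod.snd_add] <;> omega

namespace IsStair

variable {K : Set (ℝ × ℝ)} {C : ℤ → ℤ × ℤ} {m n : ℤ}

theorem monotone (h : IsStair K C m n) {i j : ℤ} (hi : m ≤ i) (hij : i ≤ j) (hj : j ≤ n) :
    (C i).1 ≤ (C j).1 ∧ (C i).2 ≤ (C j).2 ∧ (C j).1 + (C j).2 = (C i).1 + (C i).2 + (j - i) :=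
  steps_monotone h.step hi hij hj

theorem lt_of_mem (h : IsStair K C m n) (hK : Convex ℝ K) {i : ℤ} (hi : m ≤ i) (hi' : i ≤ n)
    {X : ℝ × ℝ} (hX : X ∈ K) (hs : X.1 + X.2 = (C i).1 + (C i).2) : X.2 < (C i).2 + 1 := by
  by_contra hcon
  push Not at hcon
  refine h.out i hi hi' (mem_of_antidiagonal hK (h.mem i hi hi') hX ?_ ?_ ?_ ?_) <;>
    simp <;> linarith

theorem snd_le_of_mem (h : IsStair K C m n) (hK : Convex ℝ K) {i : ℤ} (hi : m ≤ i) (hi' : i ≤ n)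
    {Z : ℤ × ℤ} (hZ : pt Z ∈ K) (hs : Z.1 + Z.2 = (C i).1 + (C i).2) : Z.2 ≤ (C i).2 := by
  have := h.lt_of_mem hK hi hi' hZ (by simp only [pt_fst, pt_snd]; exact_mod_cast hs)
  simp only [pt_snd] at this
  exact_mod_cast Int.lt_add_one_iff.1 (by exact_mod_cast this)

end IsStair

theorem exists_residue {k j : ℤ} (hk : 0 < k) (hkj : IsCoprime j k) (l s₀ : ℤ) :
    ∃ s y : ℤ, s₀ ≤ s ∧ s < s₀ + k ∧ k * y - j * s = l := by
  obtain ⟨u, v, huv⟩ := hkj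
  refine ⟨s₀ + (-l * u - s₀) % k, j * (-((-l * u - s₀) / k)) + l * v, ?_, ?_, ?_⟩
  · linarith [Int.emod_nonneg (-l * u - s₀) hk.ne']
  · linarith [Int.emod_lt_of_pos (-l * u - s₀) hk]
  · have := Int.emod_add_mul_ediv (-l * u - s₀) k
    linear_combination l * huv - j * this

set_option maxHeartbeats 1000000 in
/-- **Flatness of digital straight segments.** If a stair of length `N` is a digital straight
segment, then its slope is approximated up to `8 / N` by a fraction of denominator
`O(ϱ / N ^ 2)`. Indeed, consider a Diophantine approximation of denominator `k ≤ N / 8`. All lattice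
lines in this direction that carry a lattice point of `K` above the stair are, up to a bounded
number of them, below both ends of the stair; as consecutive ones are `1 / k` apart, the
sagitta `N ^ 2 / ϱ` of `K` is `O(1 / k)`. -/
theorem IsStair.exists_flat {K : Set (ℝ × ℝ)} {C : ℤ → ℤ × ℤ} {m n : ℤ} {ρ ϱ : ℝ}
    (hst : IsStair K C m n) (hK : RoundBody K ρ ϱ) (hϱ : 0 < ϱ) (hmn : m + 8 ≤ n) {a b μ : ℤ}
    (ha : 0 ≤ a) (hb : 0 ≤ b) (hab : 0 < a + b)
    (hlow : ∀ i, m ≤ i → i ≤ n → μ ≤ a * (C i).1 - b * (C i).2)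
    (hup : ∀ i, m ≤ i → i ≤ n → a * (C i).1 - b * (C i).2 < μ + (a + b)) :
    ∃ k j : ℤ, 0 < k ∧ 0 ≤ j ∧ j ≤ k ∧ (k : ℝ) * (n - m) ^ 2 ≤ 2304 * ϱ ∧
      |(k : ℝ) * a - j * (a + b)| * (n - m) ≤ 8 * (a + b) := by
  obtain ⟨N, hN⟩ : ∃ N : ℕ, (N : ℤ) = n - m := ⟨(n - m).toNat, by omega⟩
  have hNr : (N : ℝ) = n - m := by exact_mod_cast congrArg (Int.cast (R := ℝ)) hN
  have hQ : 0 < N / 8 := by omega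
  have hA : (0 : ℝ) < a + b := by exact_mod_cast hab
  have haR : (0 : ℝ) ≤ a := by exact_mod_cast ha
  have hbR : (0 : ℝ) ≤ b := by exact_mod_cast hb
  -- by Dirichlet's theorem, `a / (a + b)` is close to `j / k`
  obtain ⟨q, hq1, hq2⟩ := Real.exists_rat_abs_sub_le_and_den_le ((a : ℝ) / (a + b)) hQ
  obtain ⟨k, hk⟩ : ∃ k : ℤ, k = q.den := ⟨_, rfl⟩
  obtain ⟨j, hj⟩ : ∃ j : ℤ, j = q.num := ⟨_, rfl⟩
  have hk0 : 0 < k := by rw [hk]; exact_mod_cast q.den_pos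
  have hkR : (0 : ℝ) < k := by exact_mod_cast hk0
  have hkN : 8 * k ≤ n - m := by rw [hk, ← hN]; omega
  have hkNR : 8 * (k : ℝ) ≤ N := by rw [hNr]; exact_mod_cast hkN
  have hcop : IsCoprime j k := by
    rw [hj, hk, Int.isCoprime_iff_gcd_eq_one]
    exact q.reduced
  have hqjk : (q : ℝ) = j / k := by
    rw [hj, hk]
    exact_mod_cast (Rat.cast_def (K := ℝ) q)
  have hdiff : |(k : ℝ) * a - j * (a + b)| * ((N / 8 : ℕ) + 1) ≤ a + b := by
    have e : (a : ℝ) / (a + b) - q = (k * a - j * (a + b)) / (k * (a + b)) := by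
      rw [hqjk]; field_simp
    rw [e, abs_div, abs_of_pos (mul_pos hkR hA), div_le_div_iff₀ (by positivity) (by positivity),
      show (q.den : ℝ) = k by rw [hk]; simp] at hq1
    have : (k : ℝ) * (|(k : ℝ) * a - j * (a + b)| * ((N / 8 : ℕ) + 1)) ≤ k * (a + b) := by
      linarith
    exact le_of_mul_le_mul_left this hkR
  have hθ : |(k : ℝ) * a - j * (a + b)| * N ≤ 8 * (a + b) := by
    have h8 : (N : ℝ) ≤ 8 * ((N / 8 : ℕ) + 1) := by
      have : N ≤ 8 * (N / 8 + 1) := by omega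
      exact_mod_cast this
    calc _ ≤ |(k : ℝ) * a - j * (a + b)| * (8 * ((N / 8 : ℕ) + 1)) := by gcongr
      _ = 8 * (|(k : ℝ) * a - j * (a + b)| * ((N / 8 : ℕ) + 1)) := by ring
      _ ≤ 8 * (a + b) := by gcongr
  have hθ2 : |(k : ℝ) * a - j * (a + b)| < a + b := by
    have hN8 : (8 : ℝ) ≤ N := by
      have : 8 ≤ N := by omega
      exact_mod_cast this
    have h2 : (2 : ℝ) ≤ (N / 8 : ℕ) + 1 := by
      have : 2 ≤ N / 8 + 1 := by omega
      exact_mod_cast this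
    nlinarith [abs_nonneg ((k : ℝ) * a - j * (a + b))]
  have hj0 : 0 ≤ j := by
    by_contra hcon
    have h1 : (j : ℝ) ≤ -1 := by
      have : j ≤ -1 := by omega
      exact_mod_cast this
    have h2 := (abs_lt.1 hθ2).2
    nlinarith [mul_nonneg hkR.le haR]
  have hjk : j ≤ k := by
    by_contra hcon
    have h1 : (k : ℝ) + 1 ≤ j := by
      have : k + 1 ≤ j := by omega
      exact_mod_cast this
    have h2 := (abs_lt.1 hθ2).1
    nlinarith [mul_nonneg hkR.le hbR]
  refine ⟨k, j, hk0, hj0, hjk, ?_, by rw [← hNr]; exact hθ⟩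
  rw [← hNr]
  by_contra hcon
  push Not at hcon
  have hN0 : (0 : ℝ) < N := by
    have : 0 < N := by omega
    exact_mod_cast this
  -- `θ` measures the slope of the strip in the direction of the approximation
  obtain ⟨θ, hθd⟩ : ∃ θ : ℝ, θ = k * a - j * (a + b) := ⟨_, rfl⟩
  rw [← hθd] at hθ
  obtain ⟨β, hβ⟩ : ∃ β : ℝ, β = (θ * ((C m).1 + (C m).2) - k * μ) / (a + b) := ⟨_, rfl⟩
  have hβA : (a + b) * β = θ * ((C m).1 + (C m).2) - k * μ := by
    rw [hβ]; field_simp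
  have hdrift : ∀ d : ℝ, 0 ≤ d → d ≤ N → |θ * d| ≤ 8 * (a + b) := by
    intro d h0 h1
    rw [abs_mul, abs_of_nonneg h0]
    exact (mul_le_mul_of_nonneg_left h1 (abs_nonneg θ)).trans hθ
  -- levels of the points of the stair
  have hpath : ∀ i, m ≤ i → i ≤ n →
      (k : ℝ) * (C i).2 - j * ((C i).1 + (C i).2) ≤ β + 8 := by
    intro i h1 h2
    have h3 : (C i).1 + (C i).2 = (C m).1 + (C m).2 + (i - m) :=
      (hst.monotone le_rfl h1 h2).2.2
    have h3 : ((C i).1 : ℝ) + (C i).2 = (C m).1 + (C m).2 + (i - m) := by exact_mod_cast h3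
    have h4 : (μ : ℝ) ≤ a * (C i).1 - b * (C i).2 := by exact_mod_cast hlow i h1 h2
    have h5 := (abs_le.1 (hdrift (i - m) (by simpa using h1) (by rw [hNr]; simpa using h2))).2
    have h6 : (a + b) * ((k : ℝ) * (C i).2 - j * ((C i).1 + (C i).2)) ≤ (a + b) * (β + 8) := by
      have e : (a + b) * ((k : ℝ) * (C i).2 - j * ((C i).1 + (C i).2))
        = θ * ((C i).1 + (C i).2) - k * (a * (C i).1 - b * (C i).2) := by rw [hθd]; ring
      rw [e, mul_add (a + b : ℝ) β, hβA, h3]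
      have := mul_le_mul_of_nonneg_left h4 hkR.le
      linarith
    exact le_of_mul_le_mul_left h6 hA
  -- each window of `k` antidiagonals contains a point of the stair of high level: the lattice point
  -- of level `⌊β - 8⌋` in this window satisfies `μ ≤ a x - b y`, hence it is not above the stair
  have hwindow : ∀ s₀ : ℤ, (C m).1 + (C m).2 ≤ s₀ → s₀ + k ≤ (C m).1 + (C m).2 + (n - m) + 1 →
      ∃ i, m ≤ i ∧ i ≤ n ∧ s₀ ≤ (C i).1 + (C i).2 ∧ (C i).1 + (C i).2 < s₀ + k ∧
        β - 9 ≤ (k : ℝ) * (C i).2 - j * ((C i).1 + (C i).2) := by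
    intro s₀ h1 h2
    obtain ⟨s, y, hs1, hs2, hsy⟩ := exists_residue hk0 hcop ⌊β - 8⌋ s₀
    obtain ⟨i, hi⟩ : ∃ i : ℤ, i = m + (s - ((C m).1 + (C m).2)) := ⟨_, rfl⟩
    have hmi : m ≤ i := by omega
    have hin : i ≤ n := by omega
    have h3 : (C i).1 + (C i).2 = s := by
      have : (C i).1 + (C i).2 = (C m).1 + (C m).2 + (i - m) :=
        (hst.monotone le_rfl hmi hin).2.2
      omega
    refine ⟨i, hmi, hin, by omega, by omega, ?_⟩
    have hsR : ((C i).1 : ℝ) + (C i).2 = s := by exact_mod_cast h3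
    have hsm : (s : ℝ) = (C m).1 + (C m).2 + (i - m) := by
      rw [hi]; push_cast; ring
    have hsyR : (k : ℝ) * y - j * s = (⌊β - 8⌋ : ℝ) := by exact_mod_cast hsy
    have h5 := (abs_le.1 (hdrift (i - m) (by simpa using hmi) (by rw [hNr]; simpa using hin))).1
    have hfl := Int.floor_le (β - 8)
    have hfl2 := Int.lt_floor_add_one (β - 8)
    have hyle : y ≤ (C i).2 := by
      have e1 : (k : ℝ) * (a * s - (a + b) * y - μ) ≥ 0 := by
        have : (a + b) * ((k : ℝ) * y - j * s) ≤ (a + b) * (β - 8) := by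
          rw [hsyR]; gcongr
        rw [mul_sub (a + b : ℝ) β, hβA] at this
        have e2 : (k : ℝ) * (a * s - (a + b) * y - μ)
          = θ * s - k * μ - (a + b) * ((k : ℝ) * y - j * s) := by rw [hθd]; ring
        rw [e2]
        have e3 : θ * s = θ * ((C m).1 + (C m).2) + θ * (i - m) := by rw [hsm]; ring
        rw [e3]
        linarith
      have e4 : (0 : ℝ) ≤ a * s - (a + b) * y - μ := nonneg_of_mul_nonneg_right e1 hkR
      have e5 : (0 : ℤ) ≤ a * s - (a + b) * y - μ := by exact_mod_cast e4
      have e6 := hup i hmi hin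
      have e7 : (a + b) * y < (a + b) * ((C i).2 + 1) := by
        rw [← h3] at e5
        linarith
      have := lt_of_mul_lt_mul_left e7 hab.le
      omega
    have : (k : ℝ) * y ≤ k * (C i).2 := by
      have : (y : ℝ) ≤ (C i).2 := by exact_mod_cast hyle
      gcongr
    rw [hsR]
    linarith
  obtain ⟨il, hl1, hl2, hl3, hl4, hl5⟩ := hwindow ((C m).1 + (C m).2) le_rfl (by omega)
  obtain ⟨ir, hr1, hr2, hr3, hr4, hr5⟩ :=
    hwindow ((C m).1 + (C m).2 + (n - m) + 1 - k) (by omega) (by omega)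
  have hl6 := hpath il hl1 hl2
  have hr6 := hpath ir hr1 hr2
  have hPl := hst.mem il hl1 hl2
  have hPr := hst.mem ir hr1 hr2
  obtain ⟨sl, hsl⟩ : ∃ sl : ℝ, sl = (C il).1 + (C il).2 := ⟨_, rfl⟩
  obtain ⟨sr, hsr⟩ : ∃ sr : ℝ, sr = (C ir).1 + (C ir).2 := ⟨_, rfl⟩
  rw [← hsl] at hl5 hl6
  rw [← hsr] at hr5 hr6
  have hgap : 3 / 4 * (N : ℝ) ≤ sr - sl := by
    have e1 : (C ir).1 + (C ir).2 - ((C il).1 + (C il).2) ≥ (n - m) - 2 * k := by omega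
    have e2 : (sr - sl : ℝ) ≥ (n - m) - 2 * k := by rw [hsr, hsl]; exact_mod_cast e1
    rw [← hNr] at e2
    linarith
  -- by roundness, the midpoint of the two high points can be raised by `η` inside `K`
  obtain ⟨η, hη⟩ : ∃ η : ℝ, η = N ^ 2 / (64 * ϱ) := ⟨_, rfl⟩
  have hη0 : 0 < η := by rw [hη]; positivity
  have hkη : 36 ≤ k * η := by
    rw [hη, ← mul_div_assoc, le_div_iff₀ (by positivity)]; linarith
  have hG := hK.round _ hPl _ hPr (-η, η) (by
    simp only [pt_fst, pt_snd]
    have e1 : (9 / 32 : ℝ) * N ^ 2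
        ≤ (((C il).1 : ℝ) - (C ir).1) ^ 2 + (((C il).2 : ℝ) - (C ir).2) ^ 2 := by
      have e2 : (3 / 4 * (N : ℝ)) ^ 2 ≤ (sr - sl) ^ 2 := by gcongr
      have e3 : (sr - sl) ^ 2
        ≤ 2 * ((((C il).1 : ℝ) - (C ir).1) ^ 2 + (((C il).2 : ℝ) - (C ir).2) ^ 2) := by
        rw [hsr, hsl]
        nlinarith [sq_nonneg ((((C il).1 : ℝ) - (C ir).1) - (((C il).2 : ℝ) - (C ir).2))]
      have e5 : (3 / 4 * (N : ℝ)) ^ 2 = 9 / 16 * N ^ 2 := by ring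
      linarith
    have e4 : 3 / 2 * η
        ≤ ((((C il).1 : ℝ) - (C ir).1) ^ 2 + (((C il).2 : ℝ) - (C ir).2) ^ 2) / (8 * ϱ) := by
      rw [hη, le_div_iff₀ (by positivity)]
      calc _ = 3 / 16 * (N : ℝ) ^ 2 := by field_simp; ring
        _ ≤ 9 / 32 * (N : ℝ) ^ 2 := by nlinarith [sq_nonneg (N : ℝ)]
        _ ≤ _ := e1
    calc (-η) ^ 2 + η ^ 2 ≤ (3 / 2 * η) ^ 2 := by nlinarith
      _ ≤ _ := by gcongr)
  simp only [pt_fst, pt_snd] at hG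
  -- the first lattice line above the stair meets `K` in a long chord
  obtain ⟨l, hl⟩ : ∃ l : ℤ, l = ⌊β + 8⌋ + 1 := ⟨_, rfl⟩
  have hlR : (l : ℝ) = ⌊β + 8⌋ + 1 := by rw [hl]; push_cast; ring
  have hla : β + 8 < l := by rw [hlR]; exact Int.lt_floor_add_one _
  have hlb : (l : ℝ) ≤ β + 9 := by rw [hlR]; linarith [Int.floor_le (β + 8)]
  obtain ⟨G, hGd⟩ : ∃ G : ℝ × ℝ, G = ((((C il).1 : ℝ) + (C ir).1) / 2 + -η,
    (((C il).2 : ℝ) + (C ir).2) / 2 + η) := ⟨_, rfl⟩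
  rw [← hGd] at hG
  have hGs : G.1 + G.2 = (sl + sr) / 2 := by rw [hGd, hsl, hsr]; ring
  have hGl : (k : ℝ) * G.2 - j * (G.1 + G.2) = ((k * (C il).2 - j * sl)
      + (k * (C ir).2 - j * sr)) / 2 + k * η := by rw [hGs, hGd, hsl, hsr]; ring
  have hcross : ∀ P ∈ K, β - 9 ≤ (k : ℝ) * P.2 - j * (P.1 + P.2) →
      (k : ℝ) * P.2 - j * (P.1 + P.2) ≤ β + 8 →
      ∃ X ∈ K, (k : ℝ) * X.2 - j * (X.1 + X.2) = l ∧ ∃ t, 0 ≤ t ∧ t ≤ 1 / 2 ∧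
        X.1 + X.2 = P.1 + P.2 + t * ((sl + sr) / 2 - (P.1 + P.2)) := by
    intro P hP h1 h2
    obtain ⟨p, hp⟩ : ∃ p : ℝ, p = (k : ℝ) * P.2 - j * (P.1 + P.2) := ⟨_, rfl⟩
    obtain ⟨g, hg⟩ : ∃ g : ℝ, g = (k : ℝ) * G.2 - j * (G.1 + G.2) := ⟨_, rfl⟩
    rw [← hp] at h1 h2
    rw [← hg] at hGl
    have hpg : 0 < g - p := by linarith
    have ht : (l - p) / (g - p) * (g - p) = l - p := div_mul_cancel₀ _ hpg.ne'
    have ht0 : 0 ≤ (l - p) / (g - p) := div_nonneg (by linarith) hpg.le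
    have ht1 : (l - p) / (g - p) ≤ 1 / 2 := by
      rw [div_le_iff₀ hpg]; linarith
    refine ⟨(P.1 + (l - p) / (g - p) * (G.1 - P.1), P.2 + (l - p) / (g - p) * (G.2 - P.2)),
      convex_combo_mem hK.convex hP hG ht0 (by linarith) rfl rfl, ?_, _, ht0, ht1, ?_⟩
    · simp only
      rw [hg, hp] at ht ⊢
      linear_combination ht
    · simp only
      rw [← hGs]; ring
  obtain ⟨Xl, hXl, hXl2, tl, htl0, htl1, hXl3⟩ := hcross _ hPl
    (by simp only [pt_fst, pt_snd]; rw [← hsl]; exact hl5)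
    (by simp only [pt_fst, pt_snd]; rw [← hsl]; exact hl6)
  obtain ⟨Xr, hXr, hXr2, tr, htr0, htr1, hXr3⟩ := hcross _ hPr
    (by simp only [pt_fst, pt_snd]; rw [← hsr]; exact hr5)
    (by simp only [pt_fst, pt_snd]; rw [← hsr]; exact hr6)
  simp only [pt_fst, pt_snd] at hXl3 hXr3
  rw [← hsl] at hXl3
  rw [← hsr] at hXr3
  have hd0 : 0 ≤ sr - sl := by linarith
  have hl7 := mul_le_mul_of_nonneg_right htl1 hd0
  have hl8 := mul_nonneg htl0 hd0
  have hr7 := mul_le_mul_of_nonneg_right htr1 hd0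
  have hr8 := mul_nonneg htr0 hd0
  have hXl4 : Xl.1 + Xl.2 ≤ sl + (sr - sl) / 4 := by rw [hXl3]; linarith
  have hXl5 : sl ≤ Xl.1 + Xl.2 := by rw [hXl3]; linarith
  have hXr4 : sr - (sr - sl) / 4 ≤ Xr.1 + Xr.2 := by rw [hXr3]; linarith
  have hXr5 : Xr.1 + Xr.2 ≤ sr := by rw [hXr3]; linarith
  -- the chord is longer than `k`, hence it contains a lattice point; being above the stair, this
  -- point should not belong to `K`
  obtain ⟨s, y, hs1, hs2, hsy⟩ := exists_residue hk0 hcop l ⌈Xl.1 + Xl.2⌉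
  have hsyR : (k : ℝ) * y - j * s = l := by exact_mod_cast hsy
  have hs3 : Xl.1 + Xl.2 ≤ s := (Int.le_ceil _).trans (by exact_mod_cast hs1)
  have hs4 : (s : ℝ) ≤ Xr.1 + Xr.2 := by
    have e1 : (s : ℝ) + 1 ≤ ⌈Xl.1 + Xl.2⌉ + k := by exact_mod_cast hs2
    have e2 := Int.ceil_lt_add_one (Xl.1 + Xl.2)
    linarith
  have hd : 0 < Xr.1 + Xr.2 - (Xl.1 + Xl.2) := by linarith
  have ht : (s - (Xl.1 + Xl.2)) / (Xr.1 + Xr.2 - (Xl.1 + Xl.2))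
      * (Xr.1 + Xr.2 - (Xl.1 + Xl.2)) = s - (Xl.1 + Xl.2) := div_mul_cancel₀ _ hd.ne'
  obtain ⟨t, htd⟩ : ∃ t, t = (s - (Xl.1 + Xl.2)) / (Xr.1 + Xr.2 - (Xl.1 + Xl.2)) := ⟨_, rfl⟩
  rw [← htd] at ht
  have hy2 : (y : ℝ) = Xl.2 + t * (Xr.2 - Xl.2) := by
    have : (k : ℝ) * y = k * (Xl.2 + t * (Xr.2 - Xl.2)) := by
      linear_combination hsyR - hXl2 + t * (hXl2 - hXr2) - j * ht
    exact mul_left_cancel₀ hkR.ne' this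
  have hZ : pt (s - y, y) ∈ K := by
    refine convex_combo_mem hK.convex hXl hXr (t := t)
      (htd ▸ div_nonneg (by linarith) hd.le) (htd ▸ (div_le_one hd).2 (by linarith)) ?_ ?_
    · simp only [pt_fst]; push_cast; linarith
    · simp only [pt_snd]; exact hy2
  have hsls : (C il).1 + (C il).2 ≤ s := by
    have : sl ≤ s := by linarith
    rw [hsl] at this; exact_mod_cast this
  have hssr : s ≤ (C ir).1 + (C ir).2 := by
    have : (s : ℝ) ≤ sr := by linarith
    rw [hsr] at this; exact_mod_cast this
  obtain ⟨i, hi⟩ : ∃ i : ℤ, i = m + (s - ((C m).1 + (C m).2)) := ⟨_, rfl⟩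
  have hmi : m ≤ i := by omega
  have hin : i ≤ n := by
    have : (C ir).1 + (C ir).2 = (C m).1 + (C m).2 + (ir - m) :=
      (hst.monotone le_rfl hr1 hr2).2.2
    omega
  have h3 : (C i).1 + (C i).2 = s := by
    have : (C i).1 + (C i).2 = (C m).1 + (C m).2 + (i - m) :=
      (hst.monotone le_rfl hmi hin).2.2
    omega
  have hle := hst.snd_le_of_mem hK.convex hmi hin hZ (by simp only; omega)
  simp only at hle
  have h7 := hpath i hmi hin
  have h8 : ((C i).1 : ℝ) + (C i).2 = s := by exact_mod_cast h3
  rw [h8] at h7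
  have h9 : (k : ℝ) * y ≤ k * (C i).2 := by
    have : (y : ℝ) ≤ (C i).2 := by exact_mod_cast hle
    gcongr
  linarith

/-! ### Extension and exits of a digital straight staircase -/

/-- A digital straight stair can be extended by an upward step to a point of the convex set:
if the given strip does not work, take the line through the new point `W` and the point of the stair
from which the slope to `W` is smallest. -/
theorem IsStair.exists_standardLine_up {K : Set (ℝ × ℝ)} {C : ℤ → ℤ × ℤ} {m n : ℤ}
    (hst : IsStair K C m n) (hK : Convex ℝ K) (hmn : m ≤ n) {a b μ : ℤ}
    (ha : 0 ≤ a) (hb : 0 ≤ b)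
    (hlow : ∀ i, m ≤ i → i ≤ n → μ ≤ a * (C i).1 - b * (C i).2)
    (hup : ∀ i, m ≤ i → i ≤ n → a * (C i).1 - b * (C i).2 < μ + (a + b))
    (hW : pt (C n + (0, 1)) ∈ K) :
    ∃ a' b' μ' : ℤ, (∀ i, m ≤ i → i ≤ n → C i ∈ standardLine a' b' μ') ∧
      C n + (0, 1) ∈ standardLine a' b' μ' := by
  obtain ⟨W, hWd⟩ : ∃ W, W = C n + (0, 1) := ⟨_, rfl⟩
  have hW1 : W.1 = (C n).1 := by rw [hWd]; simp
  have hW2 : W.2 = (C n).2 + 1 := by rw [hWd]; simp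
  rw [← hWd] at hW ⊢
  have hn1 := hlow n hmn le_rfl
  have hn2 := hup n hmn le_rfl
  by_cases hlev : μ ≤ a * W.1 - b * W.2
  · refine ⟨a, b, μ, fun i h1 h2 => ⟨hlow i h1 h2, ?_⟩, hlev, ?_⟩
    · rw [abs_of_nonneg ha, abs_of_nonneg hb]; linarith [hup i h1 h2]
    · rw [abs_of_nonneg ha, abs_of_nonneg hb, hW1, hW2]; linarith
  push Not at hlev
  have hmono : ∀ i, m ≤ i → i ≤ n → (C i).1 ≤ W.1 ∧ (C i).2 + 1 ≤ W.2 ∧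
      W.1 + W.2 = (C i).1 + (C i).2 + (n - i) + 1 := by
    intro i h1 h2
    obtain ⟨e1, e2, e3⟩ := hst.monotone h1 h2 le_rfl
    omega
  -- the slope is measured as the share of upward steps, whose denominator is positive
  obtain ⟨i₀, hi₀, hmin⟩ := Finset.exists_min_image (Finset.Icc m n)
    (fun i => ((W.2 - (C i).2 : ℤ) : ℚ) / ((W.1 + W.2 - (C i).1 - (C i).2 : ℤ) : ℚ))
    ⟨m, by simp [hmn]⟩
  rw [Finset.mem_Icc] at hi₀
  obtain ⟨a', ha'⟩ : ∃ a', a' = W.2 - (C i₀).2 := ⟨_, rfl⟩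
  obtain ⟨b', hb'⟩ : ∃ b', b' = W.1 - (C i₀).1 := ⟨_, rfl⟩
  obtain ⟨e1, e2, e3⟩ := hmono i₀ hi₀.1 hi₀.2
  have ha0 : 0 ≤ a' := by omega
  have hb0 : 0 ≤ b' := by omega
  have hab : 0 < a' + b' := by omega
  have hlow' : ∀ i, m ≤ i → i ≤ n → a' * W.1 - b' * W.2 ≤ a' * (C i).1 - b' * (C i).2 := by
    intro i h1 h2
    obtain ⟨f1, f2, f3⟩ := hmono i h1 h2
    have h := hmin i (by simp [h1, h2])
    rw [div_le_div_iff₀ (by exact_mod_cast (by omega)) (by exact_mod_cast (by omega))] at h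
    have h' : (W.2 - (C i₀).2) * (W.1 + W.2 - (C i).1 - (C i).2)
        ≤ (W.2 - (C i).2) * (W.1 + W.2 - (C i₀).1 - (C i₀).2) := by exact_mod_cast h
    rw [ha', hb']
    linarith
  have hup' : ∀ i, m ≤ i → i ≤ n →
      a' * (C i).1 - b' * (C i).2 < a' * W.1 - b' * W.2 + (a' + b') := by
    intro i h1 h2
    by_contra hcon
    push Not at hcon
    rcases lt_or_ge i i₀ with hi | hi
    -- before `i₀`, the given strip bounds the level, as the new line is steeper
    · obtain ⟨f1, f2, f3⟩ := hst.monotone h1 hi.le hi₀.2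
      have h3 := hup i h1 h2
      have h4 := hlow i₀ hi₀.1 hi₀.2
      have h5 : a' * ((C i).1 - (C i₀).1) - b' * ((C i).2 - (C i₀).2) ≥ a' + b' := by
        have : a' * W.1 - b' * W.2 = a' * (C i₀).1 - b' * (C i₀).2 := by rw [ha', hb']; ring
        linarith
      have h6 : a * ((C i).1 - (C i₀).1) - b * ((C i).2 - (C i₀).2) < a + b := by linarith
      have h7 : a * b' < b * a' := by rw [ha', hb']; linarith
      obtain ⟨d, hd⟩ : ∃ d, d = i₀ - i := ⟨_, rfl⟩
      have hdy : (C i).2 - (C i₀).2 = -d - ((C i).1 - (C i₀).1) := by omega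
      rw [hdy] at h5 h6
      obtain ⟨x, hx⟩ : ∃ x, x = (C i).1 - (C i₀).1 := ⟨_, rfl⟩
      rw [← hx] at h5 h6
      have hd0 : 0 < d := by omega
      have h8 : (a + b) * (-(b' * d)) ≤ (a + b) * ((a' + b') * (x - 1)) :=
        mul_le_mul_of_nonneg_left (by linarith) (by omega)
      have h9 : (a' + b') * ((a + b) * (x - 1)) < (a' + b') * (-(b * d)) :=
        mul_lt_mul_of_pos_left (by linarith) hab
      have h10 : 0 < d * (b * a' - a * b') := mul_pos hd0 (by linarith)
      linarith
    -- after `i₀`, the point of the chord from `C i₀` to `W` belongs to `K`, which bounds the level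
    · obtain ⟨f1, f2, f3⟩ := hst.monotone hi₀.1 hi h2
      have hab' : (0 : ℝ) < a' + b' := by exact_mod_cast hab
      obtain ⟨t, ht⟩ : ∃ t : ℝ, t = ((i - i₀ : ℤ) : ℝ) / (a' + b') := ⟨_, rfl⟩
      have htm : t * (a' + b') = ((i - i₀ : ℤ) : ℝ) := by rw [ht]; field_simp
      have ha'R : (a' : ℝ) = W.2 - (C i₀).2 := by rw [ha']; push_cast; ring
      have hb'R : (b' : ℝ) = W.1 - (C i₀).1 := by rw [hb']; push_cast; ring
      have hX := convex_combo_mem hK (hst.mem i₀ hi₀.1 hi₀.2) hW (t := t)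
        (X := ((C i₀).1 + t * (W.1 - (C i₀).1), (C i₀).2 + t * (W.2 - (C i₀).2)))
        (ht ▸ div_nonneg (by exact_mod_cast (by omega)) hab'.le)
        (ht ▸ (div_le_one hab').2 (by
          have : i - i₀ ≤ a' + b' := by omega
          exact_mod_cast this)) rfl rfl
      have f3' : ((C i).1 : ℝ) + (C i).2 = (C i₀).1 + (C i₀).2 + ((i - i₀ : ℤ) : ℝ) := by
        exact_mod_cast f3
      have hlt := hst.lt_of_mem hK h1 h2 hX (by
        simp only
        rw [← ha'R, ← hb'R]; linarith)
      simp only at hlt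
      rw [← ha'R] at hlt
      have hconR : (a' : ℝ) * W.1 - b' * W.2 + (a' + b') ≤ a' * (C i).1 - b' * (C i).2 := by
        exact_mod_cast hcon
      have h3 : (a' + b') * ((C i₀).2 + t * a' : ℝ) < (a' + b') * ((C i).2 + 1) :=
        mul_lt_mul_of_pos_left hlt hab'
      have h4 : (a' + b') * ((C i₀).2 + t * a' : ℝ)
          = (a' + b') * (C i₀).2 + a' * ((i - i₀ : ℤ) : ℝ) := by rw [← htm]; ring
      have h5 : (a' : ℝ) * W.1 - b' * W.2 = a' * (C i₀).1 - b' * (C i₀).2 := by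
        rw [ha'R, hb'R]; ring
      have h6 : ((i - i₀ : ℤ) : ℝ) = (C i).1 + (C i).2 - (C i₀).1 - (C i₀).2 := by linarith
      rw [h4, h6] at h3
      linarith
  refine ⟨a', b', a' * W.1 - b' * W.2, fun i h1 h2 => ⟨hlow' i h1 h2, ?_⟩, le_rfl, ?_⟩
  · rw [abs_of_nonneg ha0, abs_of_nonneg hb0]; linarith [hup' i h1 h2]
  · rw [abs_of_nonneg ha0, abs_of_nonneg hb0]; linarith

/-- The point of a segment `U T` on a given antidiagonal. -/
theorem exists_mem_antidiagonal {K : Set (ℝ × ℝ)} (hK : Convex ℝ K) {U T : ℝ × ℝ} (hU : U ∈ K)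
    (hT : T ∈ K) {s : ℝ} (h1 : U.1 + U.2 < s) (h2 : s ≤ T.1 + T.2) {a b μ : ℝ}
    (hUl : a * U.1 - b * U.2 ≤ μ) (hTl : a * T.1 - b * T.2 ≤ μ) :
    ∃ X ∈ K, X.1 + X.2 = s ∧ a * X.1 - b * X.2 ≤ μ := by
  have hd : 0 < T.1 + T.2 - (U.1 + U.2) := by linarith
  obtain ⟨t, ht⟩ : ∃ t, t = (s - (U.1 + U.2)) / (T.1 + T.2 - (U.1 + U.2)) := ⟨_, rfl⟩
  have htm : t * (T.1 + T.2 - (U.1 + U.2)) = s - (U.1 + U.2) := by rw [ht]; field_simp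
  have ht0 : 0 ≤ t := ht ▸ div_nonneg (by linarith) hd.le
  have ht1 : t ≤ 1 := ht ▸ (div_le_one hd).2 (by linarith)
  refine ⟨(U.1 + t * (T.1 - U.1), U.2 + t * (T.2 - U.2)),
    convex_combo_mem hK hU hT ht0 ht1 rfl rfl, by linear_combination htm, ?_⟩
  simp only
  have e1 := mul_le_mul_of_nonneg_left hUl (sub_nonneg.2 ht1)
  have e2 := mul_le_mul_of_nonneg_left hTl ht0
  linarith

/-- A point `P` of a round body whose neighbours to the right and above are both outside is near the
end of the body in the direction `(1, 1)`: there is no point `(3 - κ, κ)` from `P`. -/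
theorem RoundBody.false_of_corner {K : Set (ℝ × ℝ)} {ρ ϱ : ℝ} (hK : RoundBody K ρ ϱ)
    (hρ : 200 ≤ ρ) {P : ℝ × ℝ} (hP : P ∈ K) (h1 : P + (1, 0) ∉ K) (h2 : P + (0, 1) ∉ K)
    (h3 : P + (-1, 1) ∉ K) {κ : ℝ} (hκ0 : 0 ≤ κ) (hκ8 : κ ≤ 8) (hT : P + (3 - κ, κ) ∈ K) :
    False := by
  obtain ⟨u, hu, hball⟩ := hK.ball P hP
  have g : ∀ v : ℝ × ℝ, P + v ∉ K → 0 < v.1 ^ 2 + v.2 ^ 2 - 2 * (v.1 * u.1 + v.2 * u.2) := by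
    intro v hv
    by_contra hcon
    exact hv (hball v (by linarith))
  have g1 := g _ h1
  have g2 := g _ h2
  have g3 := g _ h3
  simp only at g1 g2 g3
  by_cases hqp : 4 ≤ u.1 - u.2
  · have hv := hball (κ / 2, -(κ / 2)) (by
      have : κ * (κ / 2) ≤ κ * (u.1 - u.2) := mul_le_mul_of_nonneg_left (by linarith) hκ0
      simp only
      linarith)
    refine h1 (convex_combo_mem hK.convex hv hT (t := 1 / 3) (by norm_num) (by norm_num) ?_ ?_) <;>
      simp <;> ring
  · have hρu : (ρ - 1) ^ 2 < u.1 ^ 2 + u.2 ^ 2 := by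
      by_contra hcon
      push Not at hcon
      refine h1 (hball _ ?_)
      have h0 : -(ρ - 1) ≤ u.1 := by
        have := abs_le_of_sq_le_sq' (a := u.1) (b := ρ - 1) (by nlinarith [sq_nonneg u.2])
          (by linarith)
        exact this.1
      simp only
      nlinarith
    have hp : u.1 < -100 := by
      by_contra hcon
      push Not at hcon
      have e1 : u.1 ^ 2 ≤ 100 ^ 2 := by nlinarith
      have e2 : u.2 ^ 2 ≤ 104 ^ 2 := by nlinarith
      nlinarith
    have hv := hball (κ - 1, -κ) (by
      simp only
      have e1 : κ * (u.1 - u.2) ≥ κ * (-1) := mul_le_mul_of_nonneg_left (by linarith) hκ0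
      have e2 : κ * κ ≤ 8 * κ := mul_le_mul_of_nonneg_right hκ8 hκ0
      nlinarith)
    refine h1 (convex_combo_mem hK.convex hv hT (t := 1 / 2) (by norm_num) (by norm_num) ?_ ?_) <;>
      simp <;> ring

/-- If the path leaves the strip of a digital straight stair downwards at the front, or turns back
there, then the support point `T` of the body in the direction of the strip is not further than
the front, up to a constant. -/
theorem IsStair.support_lt_front {K : Set (ℝ × ℝ)} {C : ℤ → ℤ × ℤ} {m n : ℤ} {ρ ϱ : ℝ}
    (hst : IsStair K C m n) (hK : RoundBody K ρ ϱ) (hρ : 200 ≤ ρ) (hmn : m < n) {a b μ i₀ : ℤ}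
    (ha : 0 ≤ a) (hb : 0 ≤ b) (hab : 0 < a + b)
    (hlow : μ ≤ a * (C n).1 - b * (C n).2)
    (hi₀ : m ≤ i₀) (hi₀n : i₀ ≤ n) (hU : a * (C i₀).1 - b * (C i₀).2 = μ)
    (hexit : (pt (C n + (1, 0)) ∈ K ∧ pt (C n + (0, 1)) ∉ K ∧ μ + b ≤ a * (C n).1 - b * (C n).2) ∨
      (pt (C n + (1, 0)) ∉ K ∧ pt (C n + (0, 1)) ∉ K))
    {T : ℝ × ℝ} (hT : T ∈ K) (hTmin : ∀ X ∈ K, (a : ℝ) * T.1 - b * T.2 ≤ a * X.1 - b * X.2) :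
    T.1 + T.2 < (C n).1 + (C n).2 + 3 := by
  by_contra hcon
  push Not at hcon
  have haR : (0 : ℝ) ≤ a := by exact_mod_cast ha
  have hbR : (0 : ℝ) ≤ b := by exact_mod_cast hb
  have hA : (0 : ℝ) < a + b := by exact_mod_cast hab
  have hUK := hst.mem i₀ hi₀ hi₀n
  have hUR : (a : ℝ) * (C i₀).1 - b * (C i₀).2 = μ := by exact_mod_cast hU
  have hTl := hTmin _ hUK
  simp only [pt_fst, pt_snd] at hTl
  rw [hUR] at hTl
  have hsU : ((C i₀).1 : ℝ) + (C i₀).2 ≤ (C n).1 + (C n).2 := by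
    have := (hst.monotone hi₀ hi₀n le_rfl).2.2
    have : (C i₀).1 + (C i₀).2 ≤ (C n).1 + (C n).2 := by omega
    exact_mod_cast this
  rcases hexit with ⟨h1, h2, h3⟩ | ⟨h1, h2⟩
  -- the chord from the lowest point to `T` passes above `C n + (0, 1)`
  · obtain ⟨X, hX, hXs, hXl⟩ := exists_mem_antidiagonal hK.convex hUK hT
      (s := (C n).1 + (C n).2 + 1) (by simp only [pt_fst, pt_snd]; linarith) (by linarith)
      (a := a) (b := b) (μ := μ) (by simp only [pt_fst, pt_snd]; exact hUR.le) hTl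
    have h3R : (μ : ℝ) + b ≤ a * (C n).1 - b * (C n).2 := by exact_mod_cast h3
    refine h2 (mem_of_antidiagonal hK.convex h1 hX ?_ ?_ ?_ ?_)
    · simp; ring
    · simp; linarith
    · simp
    · simp only [pt_snd, Prod.snd_add]
      push_cast
      have e : (X.1 : ℝ) = (C n).1 + (C n).2 + 1 - X.2 := by linarith
      rw [e] at hXl
      have : (a + b : ℝ) * ((C n).2 + 1) ≤ (a + b) * X.2 := by linarith
      exact le_of_mul_le_mul_left this hA
  -- the same chord has a point beyond the corner `C n`, at a bounded distance
  · obtain ⟨X, hX, hXs, hXl⟩ := exists_mem_antidiagonal hK.convex hUK hT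
      (s := (C n).1 + (C n).2 + 3) (by simp only [pt_fst, pt_snd]; linarith) hcon
      (a := a) (b := b) (μ := μ) (by simp only [pt_fst, pt_snd]; exact hUR.le) hTl
    have hlR : (μ : ℝ) ≤ a * (C n).1 - b * (C n).2 := by exact_mod_cast hlow
    obtain ⟨κ, hκ⟩ : ∃ κ, κ = X.2 - (C n).2 := ⟨_, rfl⟩
    have hX1 : X.1 = (C n).1 + (3 - κ) := by rw [hκ]; linarith
    have hX2 : X.2 = (C n).2 + κ := by rw [hκ]; ring
    have hκ0 : 0 ≤ κ := by
      rw [hX1, hX2] at hXl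
      have : 0 ≤ (a + b : ℝ) * κ := by linarith
      exact nonneg_of_mul_nonneg_right this hA
    have hκ8 : κ ≤ 8 := by
      obtain ⟨e1, e2, e3⟩ := hst.monotone (i := n - 1) (by omega) (by omega) le_rfl
      have e4 : (C n).2 - 1 ≤ (C (n - 1)).2 := by omega
      have e3R : ((C n).1 : ℝ) + (C n).2 = (C (n - 1)).1 + (C (n - 1)).2 + 1 := by
        have : (C n).1 + (C n).2 = (C (n - 1)).1 + (C (n - 1)).2 + 1 := by omega
        exact_mod_cast this
      have e4R : ((C n).2 : ℝ) - 1 ≤ (C (n - 1)).2 := by exact_mod_cast e4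
      have hY := convex_combo_mem hK.convex (hst.mem (n - 1) (by omega) (by omega)) hX
        (t := 1 / 4) (X := ((pt (C (n - 1))).1 + 1 / 4 * (X.1 - (pt (C (n - 1))).1),
          (pt (C (n - 1))).2 + 1 / 4 * (X.2 - (pt (C (n - 1))).2)))
        (by norm_num) (by norm_num) rfl rfl
      have := hst.lt_of_mem hK.convex hmn.le le_rfl hY
        (by simp only [pt_fst, pt_snd]; linarith)
      simp only [pt_snd] at this
      linarith
    have hc : ∀ v : ℤ × ℤ, pt (C n + v) = pt (C n) + pt v := by
      intro v; ext <;> simp [pt]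
    have h3 := hst.out n hmn.le le_rfl
    rw [hc] at h1 h2 h3
    refine hK.false_of_corner hρ (hst.mem n hmn.le le_rfl) (by simpa [pt] using h1)
      (by simpa [pt] using h2) (by simpa [pt] using h3) hκ0 hκ8 ?_
    have : pt (C n) + (3 - κ, κ) = X := Prod.ext (by simp [hX1]) (by simp [hX2])
    rwa [this]

/-! ### Symmetries -/

/-- Roundness is invariant under linear isometries. -/
theorem RoundBody.preimage_orthogonal {K : Set (ℝ × ℝ)} {ρ ϱ : ℝ} (hK : RoundBody K ρ ϱ)
    {p q r t : ℝ} (h1 : p ^ 2 + r ^ 2 = 1) (h2 : q ^ 2 + t ^ 2 = 1) (h3 : p * q + r * t = 0)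
    (h4 : p ^ 2 + q ^ 2 = 1) (h5 : r ^ 2 + t ^ 2 = 1) (h6 : p * r + q * t = 0) :
    RoundBody {x : ℝ × ℝ | (p * x.1 + q * x.2, r * x.1 + t * x.2) ∈ K} ρ ϱ := by
  have hn : ∀ x y : ℝ, (p * x + q * y) ^ 2 + (r * x + t * y) ^ 2 = x ^ 2 + y ^ 2 := by
    intro x y
    linear_combination x ^ 2 * h1 + y ^ 2 * h2 + 2 * x * y * h3
  refine ⟨?_, ?_, ?_⟩
  · intro x hx y hy c d hc hd hcd
    have := hK.convex hx hy hc hd hcd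
    simp only [Prod.smul_mk, Prod.mk_add_mk, smul_eq_mul] at this
    simp only [mem_ofPred_eq, Prod.fst_add, Prod.snd_add, Prod.smul_fst, Prod.smul_snd, smul_eq_mul]
    convert this using 2 <;> ring
  · intro P hP
    obtain ⟨u, hu, hb⟩ := hK.ball _ hP
    refine ⟨(p * u.1 + r * u.2, q * u.1 + t * u.2), ?_, ?_⟩
    · refine le_trans (le_of_eq ?_) hu
      linear_combination u.1 ^ 2 * h4 + u.2 ^ 2 * h5 + 2 * u.1 * u.2 * h6
    · intro v hv
      have := hb (p * v.1 + q * v.2, r * v.1 + t * v.2) (by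
        refine le_trans (le_of_eq ?_) hv
        have h7 : p * q = - (r * t) := by linarith
        linear_combination v.1 ^ 2 * h1 + v.2 ^ 2 * h2 + 2 * v.1 * v.2 * h3
          - u.1 ^ 2 * h4 - u.2 ^ 2 * h5 - 2 * u.1 * u.2 * h6)
      simp only [mem_ofPred_eq, Prod.fst_add, Prod.snd_add]
      convert this using 1
      ext <;> simp <;> ring
  · intro P hP Q hQ v hv
    have := hK.round _ hP _ hQ (p * v.1 + q * v.2, r * v.1 + t * v.2) (by
      simp only
      rw [hn]
      refine hv.trans (le_of_eq ?_)
      rw [← hn (P.1 - Q.1) (P.2 - Q.2)]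
      ring)
    simp only [mem_ofPred_eq]
    convert this using 1
    ext <;> simp <;> ring

/-- The stair traversed backwards and reflected at the line `x + y = 0`. -/
theorem IsStair.reflect {K : Set (ℝ × ℝ)} {C : ℤ → ℤ × ℤ} {m n : ℤ} (hst : IsStair K C m n) :
    IsStair {x | (-x.2, -x.1) ∈ K} (fun i => (-(C (-i)).2, -(C (-i)).1)) (-n) (-m) := by
  refine ⟨?_, ?_, ?_⟩
  · intro i h1 h2
    have := hst.mem (-i) (by omega) (by omega)
    simpa [pt] using this
  · intro i h1 h2
    have := hst.step (-(i + 1)) (by omega) (by omega)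
    rw [show -(i + 1) + 1 = -i by ring] at this
    rcases this with e | e
    · right
      rw [e]; ext <;> simp
    · left
      rw [e]; ext <;> simp
  · intro i h1 h2 h3
    refine hst.out (-i) (by omega) (by omega) ?_
    simp only [pt, mem_ofPred_eq, Prod.fst_add, Prod.snd_add] at h3
    convert h3 using 1
    ext <;> simp <;> ring

theorem RoundBody.reflect {K : Set (ℝ × ℝ)} {ρ ϱ : ℝ} (hK : RoundBody K ρ ϱ) :
    RoundBody {x : ℝ × ℝ | (-x.2, -x.1) ∈ K} ρ ϱ := by
  have := hK.preimage_orthogonal (p := 0) (q := -1) (r := -1) (t := 0) (by norm_num)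
    (by norm_num) (by norm_num) (by norm_num) (by norm_num) (by norm_num)
  simpa using this

/-- The analogue of `IsStair.support_lt_front` at the back. -/
theorem IsStair.back_lt_support {K : Set (ℝ × ℝ)} {C : ℤ → ℤ × ℤ} {m n : ℤ} {ρ ϱ : ℝ}
    (hst : IsStair K C m n) (hK : RoundBody K ρ ϱ) (hρ : 200 ≤ ρ) (hmn : m < n) {a b μ i₀ : ℤ}
    (ha : 0 ≤ a) (hb : 0 ≤ b) (hab : 0 < a + b)
    (hlow : μ ≤ a * (C m).1 - b * (C m).2)
    (hi₀ : m ≤ i₀) (hi₀n : i₀ ≤ n) (hU : a * (C i₀).1 - b * (C i₀).2 = μ)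
    (hexit : (pt (C m - (0, 1)) ∈ K ∧ pt (C m - (1, 0)) ∉ K ∧ μ + a ≤ a * (C m).1 - b * (C m).2) ∨
      (pt (C m - (0, 1)) ∉ K ∧ pt (C m - (1, 0)) ∉ K))
    {T : ℝ × ℝ} (hT : T ∈ K) (hTmin : ∀ X ∈ K, (a : ℝ) * T.1 - b * T.2 ≤ a * X.1 - b * X.2) :
    (C m).1 + (C m).2 - 3 < T.1 + T.2 := by
  have := hst.reflect.support_lt_front hK.reflect hρ (by omega) (a := b) (b := a) (μ := μ)
    (i₀ := -i₀) hb ha (by omega) (by simp only [neg_neg]; linarith) (by omega) (by omega)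
    (by simp only [neg_neg]; linarith) (by
      simp only [pt, mem_ofPred_eq, neg_neg, Prod.fst_add, Prod.snd_add, Prod.fst_sub,
        Prod.snd_sub] at hexit ⊢
      push_cast at hexit ⊢
      simpa [sub_eq_add_neg, add_comm] using hexit)
    (T := (-T.2, -T.1)) (by simpa using hT) (by
      intro X hX
      have := hTmin _ hX
      simp only at this
      linarith)
  simp only [neg_neg] at this
  push_cast at this
  linarith

/-- The extension property at the back: the analogue of `IsStair.exists_standardLine_up`. -/
theorem IsStair.exists_standardLine_back {K : Set (ℝ × ℝ)} {C : ℤ → ℤ × ℤ} {m n : ℤ}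
    (hst : IsStair K C m n) (hK : Convex ℝ K) (hmn : m ≤ n) {a b μ : ℤ}
    (ha : 0 ≤ a) (hb : 0 ≤ b)
    (hlow : ∀ i, m ≤ i → i ≤ n → μ ≤ a * (C i).1 - b * (C i).2)
    (hup : ∀ i, m ≤ i → i ≤ n → a * (C i).1 - b * (C i).2 < μ + (a + b))
    (hW : pt (C m - (1, 0)) ∈ K) :
    ∃ a' b' μ' : ℤ, (∀ i, m ≤ i → i ≤ n → C i ∈ standardLine a' b' μ') ∧
      C m - (1, 0) ∈ standardLine a' b' μ' := by
  have hK' : Convex ℝ {x : ℝ × ℝ | (-x.2, -x.1) ∈ K} := by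
    intro x hx y hy c d hc hd hcd
    have := hK hx hy hc hd hcd
    simp only [Prod.smul_mk, Prod.mk_add_mk, smul_eq_mul] at this
    simp only [mem_ofPred_eq, Prod.fst_add, Prod.snd_add, Prod.smul_fst, Prod.smul_snd, smul_eq_mul]
    convert this using 2 <;> ring
  obtain ⟨a', b', μ', h1, h2⟩ := hst.reflect.exists_standardLine_up hK' (by omega) (a := b) (b := a)
    (μ := μ) hb ha
    (fun i h1 h2 => by simp only; linarith [hlow (-i) (by omega) (by omega)])
    (fun i h1 h2 => by simp only; linarith [hup (-i) (by omega) (by omega)])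
    (by
      simp only [pt, mem_ofPred_eq, neg_neg, Prod.fst_add, Prod.snd_add, Prod.fst_sub,
        Prod.snd_sub] at hW ⊢
      push_cast at hW ⊢
      simpa [sub_eq_add_neg, add_comm] using hW)
  refine ⟨b', a', μ', ?_, ?_⟩
  · intro i hi1 hi2
    have := h1 (-i) (by omega) (by omega)
    simp only [standardLine, mem_ofPred_eq, neg_neg] at this ⊢
    constructor <;> linarith
  · simp only [standardLine, mem_ofPred_eq, neg_neg, Prod.fst_add, Prod.snd_add, Prod.fst_sub,
        Prod.snd_sub] at h2 ⊢
    constructor <;> linarith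

/-- The position of the support point `T` of a digital straight stair: its position along the stair
determines it up to the length of the stair, as convexity and the points outside `K` next to the
stair bound it from above, and the strip bounds it from below. -/
theorem IsStair.abs_support_sub_le {K : Set (ℝ × ℝ)} {C : ℤ → ℤ × ℤ} {m n : ℤ}
    (hst : IsStair K C m n) (hK : Convex ℝ K) (hmn : m + 2 ≤ n) {a b i₀ : ℤ}
    (ha : 0 ≤ a) (hb : 0 ≤ b) (hab : 0 < a + b) (hi₀ : m ≤ i₀) (hi₀n : i₀ ≤ n)
    {T : ℝ × ℝ} (hT : T ∈ K)
    (hTl : (a : ℝ) * T.1 - b * T.2 ≤ a * (C i₀).1 - b * (C i₀).2)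
    (hT1 : (C m).1 + (C m).2 - 3 < T.1 + T.2) (hT2 : T.1 + T.2 < (C n).1 + (C n).2 + 3) :
    |T.1 - (C m).1| ≤ 3 * (n - m) + 10 ∧ |T.2 - (C m).2| ≤ 3 * (n - m) + 10 := by
  have haR : (0 : ℝ) ≤ a := by exact_mod_cast ha
  have hbR : (0 : ℝ) ≤ b := by exact_mod_cast hb
  have hA : (0 : ℝ) < a + b := by exact_mod_cast hab
  have hN : (2 : ℝ) ≤ n - m := by
    have : 2 ≤ n - m := by omega
    exact_mod_cast this
  obtain ⟨p1, p2, p3⟩ := hst.monotone (i := m) (j := m + 1) le_rfl (by omega) (by omega)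
  obtain ⟨q1, q2, q3⟩ := hst.monotone (i := m) (j := m + 2) le_rfl (by omega) (by omega)
  obtain ⟨r1, r2, r3⟩ := hst.monotone (i := m + 1) (j := m + 2) (by omega) (by omega) (by omega)
  obtain ⟨w1, w2, w3⟩ := hst.monotone (i := m) (j := n) le_rfl (by omega) le_rfl
  obtain ⟨z1, z2, z3⟩ := hst.monotone (i := m) (j := i₀) le_rfl hi₀ hi₀n
  have p3R : ((C (m + 1)).1 : ℝ) + (C (m + 1)).2 = (C m).1 + (C m).2 + 1 := by
    have : (C (m + 1)).1 + (C (m + 1)).2 = (C m).1 + (C m).2 + 1 := by omega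
    exact_mod_cast this
  have q3R : ((C (m + 2)).1 : ℝ) + (C (m + 2)).2 = (C m).1 + (C m).2 + 2 := by
    have : (C (m + 2)).1 + (C (m + 2)).2 = (C m).1 + (C m).2 + 2 := by omega
    exact_mod_cast this
  have p2R : ((C (m + 1)).2 : ℝ) ≤ (C m).2 + 1 := by
    have : (C (m + 1)).2 ≤ (C m).2 + 1 := by omega
    exact_mod_cast this
  have q2R : ((C (m + 2)).2 : ℝ) ≤ (C m).2 + 2 := by
    have : (C (m + 2)).2 ≤ (C m).2 + 2 := by omega
    exact_mod_cast this
  have r2R : ((C (m + 1)).2 : ℝ) ≤ (C (m + 2)).2 := by exact_mod_cast r2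
  have w3R : ((C n).1 : ℝ) + (C n).2 = (C m).1 + (C m).2 + (n - m) := by exact_mod_cast w3
  have z3R : ((C i₀).1 : ℝ) + (C i₀).2 = (C m).1 + (C m).2 + (i₀ - m) := by exact_mod_cast z3
  have z2R : ((C m).2 : ℝ) ≤ (C i₀).2 := by exact_mod_cast z2
  have hi₀R : (i₀ : ℝ) ≤ n := by exact_mod_cast hi₀n
  have hupper : T.2 - (C m).2 ≤ 2 * (n - m) + 7 := by
    rcases le_total ((C m).1 + (C m).2 + 1 : ℝ) (T.1 + T.2) with hs | hs
    · have hd : 0 < T.1 + T.2 - ((C m).1 + (C m).2) := by linarith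
      obtain ⟨t, ht⟩ : ∃ t, t = 1 / (T.1 + T.2 - ((C m).1 + (C m).2)) := ⟨_, rfl⟩
      have htm : t * (T.1 + T.2 - ((C m).1 + (C m).2)) = 1 := by rw [ht]; field_simp
      have hX := convex_combo_mem hK (hst.mem m le_rfl (by omega)) hT (t := t)
        (X := ((C m).1 + t * (T.1 - (C m).1), (C m).2 + t * (T.2 - (C m).2)))
        (ht ▸ by positivity) (ht ▸ (div_le_one hd).2 (by linarith)) rfl rfl
      have := hst.lt_of_mem hK (i := m + 1) (by omega) (by omega) hX
        (by simp only; linarith)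
      simp only at this
      have h5 : t * (T.2 - (C m).2) ≤ t * (2 * (T.1 + T.2 - ((C m).1 + (C m).2))) := by linarith
      have := le_of_mul_le_mul_left h5 (ht ▸ by positivity)
      linarith
    · have hd : 0 < (C m).1 + (C m).2 + 2 - (T.1 + T.2) := by linarith
      obtain ⟨t, ht⟩ : ∃ t, t = 1 / ((C m).1 + (C m).2 + 2 - (T.1 + T.2)) := ⟨_, rfl⟩
      have htm : t * ((C m).1 + (C m).2 + 2 - (T.1 + T.2)) = 1 := by rw [ht]; field_simp
      have hX := convex_combo_mem hK (hst.mem (m + 2) (by omega) (by omega)) hT (t := t)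
        (X := ((C (m + 2)).1 + t * (T.1 - (C (m + 2)).1),
          (C (m + 2)).2 + t * (T.2 - (C (m + 2)).2)))
        (ht ▸ by positivity) (ht ▸ (div_le_one hd).2 (by linarith)) rfl rfl
      have := hst.lt_of_mem hK (i := m + 1) (by omega) (by omega) hX (by
        simp only
        have : t * (T.1 - (C (m + 2)).1) + t * (T.2 - (C (m + 2)).2) = -1 := by
          linear_combination (-1) * htm - t * q3R
        linarith)
      simp only at this
      have h5 : t * (T.2 - (C (m + 2)).2) ≤ t * ((C m).1 + (C m).2 + 2 - (T.1 + T.2)) := by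
        linarith
      have := le_of_mul_le_mul_left h5 (ht ▸ by positivity)
      linarith
  have hlower : -((n - m : ℝ) + 3) ≤ T.2 - (C m).2 := by
    have e1 : a * (T.1 + T.2 - ((C i₀).1 + (C i₀).2)) ≤ (a + b) * (T.2 - (C i₀).2) := by
      linarith
    have e2 : (-((n - m : ℝ) + 3)) ≤ T.1 + T.2 - ((C i₀).1 + (C i₀).2) := by linarith
    have e3 : (a : ℝ) * (-((n - m : ℝ) + 3)) ≤ a * (T.1 + T.2 - ((C i₀).1 + (C i₀).2)) :=
      mul_le_mul_of_nonneg_left e2 haR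
    have e4 : 0 ≤ (b : ℝ) * ((n - m : ℝ) + 3) := mul_nonneg hbR (by linarith)
    have e5 : (a + b) * (-((n - m : ℝ) + 3)) ≤ (a + b) * (T.2 - (C i₀).2) := by linarith
    have := le_of_mul_le_mul_left e5 hA
    linarith
  constructor <;> rw [abs_le] <;> constructor <;> linarith

/-! ### Digital contours -/

theorem turnLeft_turnLeft (P : ℤ × ℤ) : turnLeft (turnLeft P) = -P := rfl

@[simp] theorem turnLeft_fst (P : ℤ × ℤ) : (turnLeft P).1 = -P.2 := rfl
@[simp] theorem turnLeft_snd (P : ℤ × ℤ) : (turnLeft P).2 = P.1 := rfl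

theorem turnLeft_neg_turnLeft (P : ℤ × ℤ) : turnLeft (-turnLeft P) = P := by
  ext <;> simp

theorem turnLeft_add (P Q : ℤ × ℤ) : turnLeft (P + Q) = turnLeft P + turnLeft Q := by
  ext <;> simp; ring

theorem turnLeft_neg (P : ℤ × ℤ) : turnLeft (-P) = -turnLeft P := by
  ext <;> simp

theorem turnLeft_sub (P Q : ℤ × ℤ) : turnLeft (P - Q) = turnLeft P - turnLeft Q := by
  ext <;> simp; ring

theorem eq_of_unit {d : ℤ × ℤ} (h : |d.1| + |d.2| = 1) :
    d = (1, 0) ∨ d = (0, 1) ∨ d = (-1, 0) ∨ d = (0, -1) := by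
  obtain ⟨x, y⟩ := d
  simp only [Prod.mk.injEq] at h ⊢
  rcases abs_cases x with ⟨e1, _⟩ | ⟨e1, _⟩ <;> rcases abs_cases y with ⟨e2, _⟩ | ⟨e2, _⟩ <;> omega

/-- A quarter turn of a contour is a contour. -/
theorem IsContour.turn {Γ : Set (ℤ × ℤ)} {C : ℤ → ℤ × ℤ} (hC : IsContour Γ C) :
    IsContour {P | turnLeft P ∈ Γ} (fun i => -turnLeft (C i)) := by
  refine ⟨?_, ?_, ?_, ?_⟩
  · intro i
    simp only [mem_ofPred_eq, turnLeft_neg_turnLeft]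
    exact hC.mem i
  · intro i
    have := hC.unit_step i
    simp only [Prod.fst_sub, Prod.snd_sub, Prod.fst_neg, Prod.snd_neg, turnLeft_fst,
      turnLeft_snd] at this ⊢
    refine Eq.trans ?_ this
    rw [add_comm, ← abs_neg]
    congr 2 <;> ring
  · intro i
    have := hC.outside_left i
    simp only [mem_ofPred_eq, turnLeft_neg_turnLeft, turnLeft_add, turnLeft_sub] at this ⊢
    exact this
  · intro i P e e' hP he he'
    have hP' : turnLeft P = C (i + 1) := by rw [hP, turnLeft_neg_turnLeft]
    have he2 : turnLeft e = C (i + 1) - C i := by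
      rw [he, turnLeft_sub, turnLeft_neg_turnLeft, turnLeft_neg_turnLeft]
    have he2' : turnLeft e' = C (i + 1 + 1) - C (i + 1) := by
      rw [he', turnLeft_sub, turnLeft_neg_turnLeft, turnLeft_neg_turnLeft]
    have hinj : ∀ A B : ℤ × ℤ, turnLeft A = turnLeft B → A = B := by
      intro A B h
      have := congrArg (fun x => -turnLeft x) h
      simpa [turnLeft_turnLeft] using this
    have := hC.next_step i _ _ _ hP' he2 he2'
    simp only [mem_ofPred_eq, turnLeft_add, turnLeft_sub]
    rcases this with h | h | h | h
    · exact Or.inl ⟨h.1, hinj _ _ h.2⟩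
    · exact Or.inr (Or.inl ⟨h.1, h.2.1, hinj _ _ h.2.2⟩)
    · exact Or.inr (Or.inr (Or.inl ⟨h.1, h.2.1, h.2.2.1,
        hinj _ _ (by rw [h.2.2.2, turnLeft_neg])⟩))
    · exact Or.inr (Or.inr (Or.inr ⟨h.1, h.2.1, h.2.2.1,
        hinj _ _ (by rw [h.2.2.2, turnLeft_neg])⟩))

theorem mem_standardLine_turn {P : ℤ × ℤ} {a b μ : ℤ} :
    -turnLeft P ∈ standardLine (-b) a μ ↔ P ∈ standardLine a b μ := by
  have e : -b * P.2 - a * -P.1 = a * P.1 - b * P.2 := by ring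
  simp only [standardLine, mem_ofPred_eq, Prod.fst_neg, Prod.snd_neg, turnLeft_fst, turnLeft_snd,
    neg_neg, e, abs_neg]
  rw [add_assoc, add_assoc, add_comm |b|]

theorem isDSS_iff {C : ℤ → ℤ × ℤ} {m n : ℤ} : IsDSS C m n ↔
    m ≤ n ∧ ∃ a b μ : ℤ, ∀ i, m ≤ i → i ≤ n → C i ∈ standardLine a b μ := by
  simp only [IsDSS, image_subset_iff]
  constructor
  · rintro ⟨h, a, b, μ, h'⟩
    exact ⟨h, a, b, μ, fun i h1 h2 => h' ⟨h1, h2⟩⟩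
  · rintro ⟨h, a, b, μ, h'⟩
    exact ⟨h, a, b, μ, fun i hi => h' i hi.1 hi.2⟩

theorem isDSS_turn {C : ℤ → ℤ × ℤ} {m n : ℤ} :
    IsDSS (fun i => -turnLeft (C i)) m n ↔ IsDSS C m n := by
  rw [isDSS_iff, isDSS_iff]
  refine and_congr_right fun _ => ⟨?_, ?_⟩
  · rintro ⟨a, b, μ, h⟩
    refine ⟨b, -a, μ, fun i h1 h2 => ?_⟩
    rw [← mem_standardLine_turn, neg_neg]
    exact h i h1 h2
  · rintro ⟨a, b, μ, h⟩
    exact ⟨-b, a, μ, fun i h1 h2 => mem_standardLine_turn.2 (h i h1 h2)⟩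

theorem IsMaximalSegment.turn {C : ℤ → ℤ × ℤ} {m n : ℤ} (h : IsMaximalSegment C m n) :
    IsMaximalSegment (fun i => -turnLeft (C i)) m n :=
  ⟨isDSS_turn.2 h.1, fun h' => h.2.1 (isDSS_turn.1 h'), fun h' => h.2.2 (isDSS_turn.1 h')⟩

/-- A row of digital points together with a point beside one end of it is a digital straight
segment. -/
theorem exists_standardLine_corner {d : ℤ × ℤ} (hd : |d.1| + |d.2| = 1) {N : ℤ} (hN : 0 ≤ N)
    {ε : ℤ} (hε : ε = 1 ∨ ε = -1) (P : ℤ × ℤ) :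
    ∃ a b μ : ℤ, (∀ t, 0 ≤ t → t ≤ N → (P.1 + t * d.1, P.2 + t * d.2) ∈ standardLine a b μ) ∧
      (P.1 - ε * d.2, P.2 + ε * d.1) ∈ standardLine a b μ := by
  refine ⟨d.1 - ε * N * d.2, -(d.2 + ε * N * d.1),
    (d.1 - ε * N * d.2) * P.1 + (d.2 + ε * N * d.1) * P.2, ?_⟩
  rcases eq_of_unit hd with rfl | rfl | rfl | rfl <;> rcases hε with rfl | rfl <;>
    simp [standardLine, abs_of_nonneg hN] <;>
    refine ⟨fun t h0 h1 => ⟨?_, ?_⟩, ?_, ?_⟩ <;> nlinarith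

theorem exists_standardLine_row {d : ℤ × ℤ} (hd : |d.1| + |d.2| = 1) {N : ℤ} (hN : 0 ≤ N)
    (P : ℤ × ℤ) :
    ∃ a b μ : ℤ, ∀ t, 0 ≤ t → t ≤ N → (P.1 + t * d.1, P.2 + t * d.2) ∈ standardLine a b μ := by
  obtain ⟨a, b, μ, h, -⟩ := exists_standardLine_corner hd hN (Or.inl rfl) P
  exact ⟨a, b, μ, h⟩

namespace IsContour

variable {Γ : Set (ℤ × ℤ)} {C : ℤ → ℤ × ℤ}

theorem eq_add_mul_of_forall_step {m n : ℤ} {d : ℤ × ℤ}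
    (h : ∀ i, m ≤ i → i < n → C (i + 1) = C i + d) {i : ℤ} (hi : m ≤ i) (hin : i ≤ n) :
    C i = ((C m).1 + (i - m) * d.1, (C m).2 + (i - m) * d.2) := by
  induction i, hi using Int.leInduction with
  | base => simp
  | succ k hk ih =>
    rw [h k hk (by omega), ih (by omega)]
    ext <;> simp only [Prod.fst_add, Prod.snd_add] <;> ring

/-- A maximal segment does not run straight on all the way. -/
theorem exists_corner (hC : IsContour Γ C) {m n : ℤ} (hmax : IsMaximalSegment C m n) (d : ℤ × ℤ) :
    ∃ i, m ≤ i ∧ i < n ∧ C (i + 1) ≠ C i + d := by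
  by_contra hcon
  push Not at hcon
  have hmn : m ≤ n := hmax.1.1
  -- for a single point, the direction is irrelevant
  obtain ⟨d, hd, hstep⟩ : ∃ d : ℤ × ℤ, |d.1| + |d.2| = 1 ∧
      ∀ i, m ≤ i → i < n → C (i + 1) = C i + d := by
    rcases hmn.eq_or_lt with rfl | h
    · exact ⟨(1, 0), by simp, fun i h1 h2 => by omega⟩
    · refine ⟨d, ?_, hcon⟩
      have h1 := hcon m le_rfl h
      have h2 := hC.unit_step m
      rw [h1] at h2
      simpa using h2
  have hrow := fun i h1 h2 => eq_add_mul_of_forall_step hstep (i := i) h1 h2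
  refine hmax.2.1 (isDSS_iff.2 ⟨by omega, ?_⟩)
  have hprev : ∀ i, m - 1 ≤ i → i ≤ n → i = m - 1 ∨ m ≤ i := fun i h1 h2 => by omega
  obtain ⟨g, hg⟩ : ∃ g, g = C m - C (m - 1) := ⟨_, rfl⟩
  have hgu : |g.1| + |g.2| = 1 := by
    have := hC.unit_step (m - 1)
    rwa [sub_add_cancel, ← hg] at this
  have hCm : C (m - 1) = C m - g := by rw [hg]; abel
  -- the previous step is straight on, a turn back or a turn to the side; in each case the segment
  -- extended by it is a digital straight segment
  have hcases : g = d ∨ g = -d ∨ ∃ ε : ℤ, (ε = 1 ∨ ε = -1) ∧ -g = (-(ε * d.2), ε * d.1) := by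
    rcases eq_of_unit hgu with e1 | e1 | e1 | e1 <;> rcases eq_of_unit hd with e2 | e2 | e2 | e2 <;>
      rw [e1, e2] <;> simp
  rcases hcases with h | h | ⟨ε, hε, h⟩
  · obtain ⟨a, b, μ, hl⟩ := exists_standardLine_row hd (N := n - m + 1) (by omega) (C (m - 1))
    refine ⟨a, b, μ, fun i h1 h2 => ?_⟩
    have := hl (i - (m - 1)) (by omega) (by omega)
    rcases hprev i h1 h2 with rfl | h3
    · simpa using this
    · rw [hrow i h3 h2]
      rw [hCm, h] at this
      simp only [Prod.fst_sub, Prod.snd_sub] at this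
      convert this using 2 <;> ring
  · obtain ⟨a, b, μ, hl⟩ := exists_standardLine_row hd (N := n - m + 1) (by omega) (C m)
    refine ⟨a, b, μ, fun i h1 h2 => ?_⟩
    rcases hprev i h1 h2 with rfl | h3
    · have := hl 1 (by omega) (by omega)
      rw [hCm, h]
      convert this using 1
      ext <;> simp
    · rw [hrow i h3 h2]
      exact hl (i - m) (by omega) (by omega)
  · obtain ⟨a, b, μ, hl, hl2⟩ := exists_standardLine_corner hd (N := n - m) (by omega) hε (C m)
    refine ⟨a, b, μ, fun i h1 h2 => ?_⟩
    rcases hprev i h1 h2 with rfl | h3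
    · rw [hCm, sub_eq_add_neg, h]
      convert hl2 using 1
      ext <;> simp [sub_eq_add_neg]
    · rw [hrow i h3 h2]
      exact hl (i - m) (by omega) (by omega)

/-- At a corner of a digital straight segment, the two steps change the level with respect to a
standard line in opposite directions. -/
theorem mul_level_neg_of_corner {P d g : ℤ × ℤ} {a b μ : ℤ} (hd : |d.1| + |d.2| = 1)
    (hg : |g.1| + |g.2| = 1) (h1 : g ≠ d) (h2 : g ≠ -d) (hP : P ∈ standardLine a b μ)
    (hQ : P + d + g ∈ standardLine a b μ) :
    (a * d.1 - b * d.2) * (a * g.1 - b * g.2) < 0 := by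
  have hsum : |a * d.1 - b * d.2| + |a * g.1 - b * g.2| = |a| + |b| := by
    rcases eq_of_unit hd with rfl | rfl | rfl | rfl <;>
      rcases eq_of_unit hg with rfl | rfl | rfl | rfl <;> simp at h1 h2 ⊢ <;> rw [add_comm]
  simp only [standardLine, mem_ofPred_eq, Prod.fst_add, Prod.snd_add] at hP hQ
  obtain ⟨x, hx⟩ : ∃ x, x = a * d.1 - b * d.2 := ⟨_, rfl⟩
  obtain ⟨y, hy⟩ : ∃ y, y = a * g.1 - b * g.2 := ⟨_, rfl⟩
  have e : a * (P.1 + d.1 + g.1) - b * (P.2 + d.2 + g.2) = a * P.1 - b * P.2 + (x + y) := by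
    rw [hx, hy]; ring
  rw [e] at hQ
  rw [← hx, ← hy] at hsum ⊢
  by_contra hcon
  push Not at hcon
  have := abs_add_eq_add_abs_iff x y
  have h3 : |x + y| = |x| + |y| := by
    rw [this]
    rcases mul_nonneg_iff.1 hcon with h | h
    · exact Or.inl h
    · exact Or.inr h
  rcases abs_cases (x + y) with h4 | h4 <;> omega

/-- The steps of a digital straight segment without U-turn are in two directions only. -/
theorem exists_direction (hC : IsContour Γ C) {m n : ℤ} {a b μ : ℤ}
    (hline : ∀ i, m ≤ i → i ≤ n → C i ∈ standardLine a b μ)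
    (hturn : ∀ i, m < i → i < n → C (i + 1) ≠ C (i - 1))
    (hbend : ∀ d : ℤ × ℤ, ∃ i, m ≤ i ∧ i < n ∧ C (i + 1) ≠ C i + d) :
    ∃ e : ℤ × ℤ, |e.1| + |e.2| = 1 ∧
      ∀ i, m ≤ i → i < n → C (i + 1) = C i + e ∨ C (i + 1) = C i + turnLeft e := by
  obtain ⟨S, hS⟩ : ∃ S : ℤ → ℤ × ℤ, ∀ i, S i = C (i + 1) - C i := ⟨_, fun _ => rfl⟩
  have hSC : ∀ i v, S i = v → C (i + 1) = C i + v := by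
    intro i v h; rw [← h, hS]; abel
  have hunit : ∀ i, |(S i).1| + |(S i).2| = 1 := fun i => by rw [hS]; exact hC.unit_step i
  have hno : ∀ i, m ≤ i → i + 1 < n → S (i + 1) ≠ -S i := by
    intro i h1 h2 h
    refine hturn (i + 1) (by omega) h2 ?_
    have e : i + 1 - 1 = i := by ring
    rw [hS, hS] at h
    rw [e]
    have := congrArg (fun x => x + C (i + 1)) h
    simpa using this
  have hneg : ∀ i, m ≤ i → i + 1 < n → S (i + 1) ≠ S i →
      (a * (S i).1 - b * (S i).2) * (a * (S (i + 1)).1 - b * (S (i + 1)).2) < 0 := by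
    intro i h1 h2 h
    refine mul_level_neg_of_corner (hunit i) (hunit _) h (hno i h1 h2)
      (hline i h1 (by omega)) (μ := μ) ?_
    rw [← hSC i _ rfl, ← hSC (i + 1) _ rfl]
    exact hline _ (by omega) (by omega)
  -- some corner exists, hence both parameters are nonzero
  have hab : a * b ≠ 0 := by
    intro h0
    have hconst : ∀ i, m ≤ i → i < n → S i = S m := by
      intro i hi
      induction i, hi using Int.leInduction with
      | base => intro; rfl
      | succ k hk ih =>
        intro hkn
        by_contra hcon
        have h1 := hneg k hk hkn (by rw [ih (by omega)]; exact hcon)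
        have : (a * (S k).1 - b * (S k).2) * (a * (S (k + 1)).1 - b * (S (k + 1)).2) = 0 ∨
            S (k + 1) = S k ∨ S (k + 1) = -S k := by
          rcases mul_eq_zero.1 h0 with h | h <;> rw [h] <;>
          rcases eq_of_unit (hunit k) with e1 | e1 | e1 | e1 <;>
          rcases eq_of_unit (hunit (k + 1)) with e2 | e2 | e2 | e2 <;>
          rw [e1, e2] <;> simp
        rcases this with h | h | h
        · omega
        · rw [ih (by omega)] at h; exact hcon h
        · exact hno k hk hkn h
    obtain ⟨i, h1, h2, h3⟩ := hbend (S m)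
    exact h3 (hSC i _ (hconst i h1 h2))
  have hgood : ∃ e : ℤ × ℤ, |e.1| + |e.2| = 1 ∧ (S m = e ∨ S m = turnLeft e) ∧
      (a * e.1 - b * e.2) * (a * (turnLeft e).1 - b * (turnLeft e).2) < 0 := by
    by_cases h : (a * (S m).1 - b * (S m).2) *
        (a * (turnLeft (S m)).1 - b * (turnLeft (S m)).2) < 0
    · exact ⟨S m, hunit m, Or.inl rfl, h⟩
    · refine ⟨-turnLeft (S m), ?_, Or.inr (turnLeft_neg_turnLeft _).symm, ?_⟩
      · have := hunit m
        simp only [Prod.fst_neg, Prod.snd_neg, turnLeft_fst, turnLeft_snd, neg_neg, abs_neg]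
        omega
      · rw [turnLeft_neg_turnLeft]
        push Not at h
        have h' : (a * (S m).1 - b * (S m).2) *
          (a * (turnLeft (S m)).1 - b * (turnLeft (S m)).2) ≠ 0 := by
          rcases eq_of_unit (hunit m) with e1 | e1 | e1 | e1 <;> rw [e1] <;>
            simp <;> exact ⟨by rintro rfl; simp at hab, by rintro rfl; simp at hab⟩
        have h'' := lt_of_le_of_ne h h'.symm
        simp only [Prod.fst_neg, Prod.snd_neg]
        linarith
  obtain ⟨e, he, hem, heg⟩ := hgood
  refine ⟨e, he, fun i hi hin => ?_⟩
  suffices h : S i = e ∨ S i = turnLeft e from h.imp (hSC i _) (hSC i _)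
  induction i, hi using Int.leInduction with
  | base => exact hem
  | succ k hk ih =>
    have ih := ih (by omega)
    by_cases heq : S (k + 1) = S k
    · rwa [heq]
    have h1 := hneg k hk hin heq
    have h2 := hno k hk hin
    have h3 : S (k + 1) = turnLeft (S k) ∨ S (k + 1) = -turnLeft (S k) := by
      rcases eq_of_unit (hunit k) with e1 | e1 | e1 | e1 <;>
      rcases eq_of_unit (hunit (k + 1)) with e2 | e2 | e2 | e2 <;>
      rw [e1, e2] at heq h2 ⊢ <;> simp [turnLeft] at heq h2 ⊢
    rcases ih with h | h <;> rw [h] at h1 h3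
    · rcases h3 with h3 | h3
      · exact Or.inr h3
      · rw [h3] at h1
        simp only [Prod.fst_neg, Prod.snd_neg] at h1
        exfalso; linarith
    · rcases h3 with h3 | h3
      · rw [h3, turnLeft_turnLeft] at h1
        simp only [Prod.fst_neg, Prod.snd_neg] at h1
        exfalso; linarith
      · rw [h3, turnLeft_turnLeft, neg_neg]; exact Or.inl rfl

end IsContour

/-! ### Contours of digitizations of round bodies -/

/-- The digital points of a plane set. -/
def digital (K : Set (ℝ × ℝ)) : Set (ℤ × ℤ) := {P | pt P ∈ K}

theorem mem_of_row {K : Set (ℝ × ℝ)} (hK : Convex ℝ K) {x₁ x₂ x₃ y : ℝ} (h1 : (x₁, y) ∈ K)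
    (h3 : (x₃, y) ∈ K) (h12 : x₁ ≤ x₂) (h23 : x₂ ≤ x₃) : (x₂, y) ∈ K := by
  rcases h12.lt_or_eq with h | h
  · have hd : 0 < x₃ - x₁ := by linarith
    refine convex_combo_mem hK h1 h3 (t := (x₂ - x₁) / (x₃ - x₁))
      (div_nonneg (by linarith) hd.le) ((div_le_one hd).2 (by linarith)) ?_ (by simp)
    simp only
    rw [div_mul_cancel₀ _ hd.ne']; ring
  · rwa [← h]

theorem mem_of_column {K : Set (ℝ × ℝ)} (hK : Convex ℝ K) {x y₁ y₂ y₃ : ℝ} (h1 : (x, y₁) ∈ K)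
    (h3 : (x, y₃) ∈ K) (h12 : y₁ ≤ y₂) (h23 : y₂ ≤ y₃) : (x, y₂) ∈ K := by
  rcases h12.lt_or_eq with h | h
  · have hd : 0 < y₃ - y₁ := by linarith
    refine convex_combo_mem hK h1 h3 (t := (y₂ - y₁) / (y₃ - y₁))
      (div_nonneg (by linarith) hd.le) ((div_le_one hd).2 (by linarith)) (by simp) ?_
    simp only
    rw [div_mul_cancel₀ _ hd.ne']; ring
  · rwa [← h]

/-- Of the two corners between diagonal neighbours in a round body, one belongs to the body. -/
theorem RoundBody.mem_of_diagonal {K : Set (ℝ × ℝ)} {ρ ϱ : ℝ} (hK : RoundBody K ρ ϱ)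
    (hρ : 3 ≤ ρ) {P : ℝ × ℝ} (hP : P ∈ K) (hQ : P + (-1, 1) ∈ K) :
    P + (-1, 0) ∈ K ∨ P + (0, 1) ∈ K := by
  by_contra hcon
  push Not at hcon
  obtain ⟨h1, h2⟩ := hcon
  obtain ⟨u, hu, hbu⟩ := hK.ball P hP
  obtain ⟨w, hw, hbw⟩ := hK.ball _ hQ
  have gu : ∀ v : ℝ × ℝ, P + v ∉ K → 0 < v.1 ^ 2 + v.2 ^ 2 - 2 * (v.1 * u.1 + v.2 * u.2) := by
    intro v hv
    by_contra hcon
    exact hv (hbu v (by linarith))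
  have gw : ∀ v : ℝ × ℝ, P + (-1, 1) + v ∉ K →
      0 < v.1 ^ 2 + v.2 ^ 2 - 2 * (v.1 * w.1 + v.2 * w.2) := by
    intro v hv
    by_contra hcon
    exact hv (hbw v (by linarith))
  have g1 := gu _ h1
  have g2 := gu _ h2
  have g3 := gw (0, -1) (by
    convert h1 using 2
    ext <;> simp [add_assoc])
  have g4 := gw (1, 0) (by
    convert h2 using 2
    ext <;> simp [add_assoc])
  simp only at g1 g2 g3 g4
  -- the average of the two balls
  have gm : ∀ v : ℝ × ℝ, P + v ∉ K →
      ρ ^ 2 < (v.1 + 1 / 2 - (u.1 + w.1) / 2) ^ 2 + (v.2 - 1 / 2 - (u.2 + w.2) / 2) ^ 2 := by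
    intro v hv
    by_contra hcon
    push Not at hcon
    have e1 := hbu (v.1 + 1 / 2 - (u.1 + w.1) / 2 + u.1, v.2 - 1 / 2 - (u.2 + w.2) / 2 + u.2)
      (by simpa using hcon)
    have e2 := hbw (v.1 + 1 / 2 - (u.1 + w.1) / 2 + w.1, v.2 - 1 / 2 - (u.2 + w.2) / 2 + w.2)
      (by simpa using hcon)
    exact hv (convex_combo_mem hK.convex e1 e2 (t := 1 / 2) (by norm_num) (by norm_num)
      (by simp; ring) (by simp; ring))
  have m1 := gm _ h1
  have m2 := gm _ h2
  simp only at m1 m2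
  have hd : (u.1 - w.1) ^ 2 + (u.2 - w.2) ^ 2 < 2 := by linarith
  have d1 := abs_lt_of_sq_lt_sq' (a := u.1 - w.1) (b := 3 / 2)
    (by linarith [sq_nonneg (u.2 - w.2)]) (by norm_num)
  have d2 := abs_lt_of_sq_lt_sq' (a := u.2 - w.2) (b := 3 / 2)
    (by linarith [sq_nonneg (u.1 - w.1)]) (by norm_num)
  have z1 : ((u.1 + w.1) / 2) ^ 2 ≤ (5 / 4) ^ 2 := by
    refine sq_le_sq' ?_ ?_ <;> linarith [d1.1, d1.2]
  have z2 : ((u.2 + w.2) / 2) ^ 2 ≤ (5 / 4) ^ 2 := by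
    refine sq_le_sq' ?_ ?_ <;> linarith [d2.1, d2.2]
  have z3 : (3 : ℝ) * 3 ≤ ρ * ρ := mul_self_le_mul_self (by norm_num) hρ
  linarith

namespace IsContour

/-- The four alternatives for the step after `C i`. -/
theorem next_cases {Γ : Set (ℤ × ℤ)} {C : ℤ → ℤ × ℤ} (hC : IsContour Γ C) (i : ℤ) {d d' : ℤ × ℤ}
    (hd : C i = C (i - 1) + d) (hd' : C (i + 1) = C i + d') :
    (C i + turnLeft d ∈ Γ ∧ d' = turnLeft d) ∨
      (C i + turnLeft d ∉ Γ ∧ C i + d ∈ Γ ∧ d' = d) ∨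
      (C i + turnLeft d ∉ Γ ∧ C i + d ∉ Γ ∧ C i - turnLeft d ∈ Γ ∧ d' = -turnLeft d) ∨
      (C i + turnLeft d ∉ Γ ∧ C i + d ∉ Γ ∧ C i - turnLeft d ∉ Γ ∧ d' = -d) := by
  refine hC.next_step (i - 1) (C i) d d' ?_ ?_ ?_
  · rw [sub_add_cancel]
  · rw [sub_add_cancel, hd]; abel
  · rw [sub_add_cancel, hd']; abel

variable {K : Set (ℝ × ℝ)} {C : ℤ → ℤ × ℤ} {m n : ℤ} {ρ ϱ : ℝ}

/-- A portion of the contour with steps to the right and upwards, both of which occur, is a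
stair. -/
theorem isStair (hC : IsContour (digital K) C) (hK : RoundBody K ρ ϱ) (hρ : 3 ≤ ρ)
    (hmn : m + 2 ≤ n)
    (hstep : ∀ i, m ≤ i → i < n → C (i + 1) = C i + (1, 0) ∨ C (i + 1) = C i + (0, 1))
    (hright : ∃ i, m ≤ i ∧ i < n ∧ C (i + 1) = C i + (1, 0))
    (hup : ∃ i, m ≤ i ∧ i < n ∧ C (i + 1) = C i + (0, 1)) : IsStair K C m n := by
  have hstep' : ∀ i, m < i → i ≤ n → C i = C (i - 1) + (1, 0) ∨ C i = C (i - 1) + (0, 1) := by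
    intro i h1 h2
    have := hstep (i - 1) (by omega) (by omega)
    rwa [sub_add_cancel] at this
  have hne : ∀ i, C (i + 1) = C i + (1, 0) → C (i + 1) ≠ C i + (0, 1) := by
    intro i h1 h2
    rw [h1] at h2
    simp at h2
  -- after a step, what is to the left of the continuation is outside
  have r1 : ∀ i, m < i → i < n → C (i + 1) = C i + (1, 0) → C i + (0, 1) ∉ digital K := by
    intro i h1 h2 h
    rcases hstep' i h1 h2.le with hd | hd <;> have := hC.next_cases i hd h <;>
      simp [turnLeft] at this <;> tauto
  have r2 : ∀ i, m < i → i < n → C i = C (i - 1) + (0, 1) → C i + (-1, 0) ∉ digital K := by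
    intro i h1 h2 h
    rcases hstep i h1.le h2 with hd | hd <;> have := hC.next_cases i h hd <;>
      simp [turnLeft] at this <;> tauto
  have r3 : ∀ i, C i = C (i - 1) + (1, 0) → C (i + 1) = C i + (0, 1) →
      C i + (-1, 1) ∉ digital K := by
    intro i h1 h2 h3
    have := hC.outside_left (i - 1)
    rw [sub_add_cancel, show C i - C (i - 1) = (1, 0) by rw [h1]; abel,
      show turnLeft (1, 0) = (0, 1) from rfl] at this
    rcases this with h | h
    · refine h ?_
      rw [h1] at h3
      convert h3 using 1
      ext <;> simp [add_assoc]
    · exact h (h2 ▸ hC.mem (i + 1))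
  -- this extends along a row that ends at a corner, and along a column that starts at one
  have hrow : ∀ i j, m ≤ i → i ≤ j → C j = C (j - 1) + (1, 0) → C (j + 1) = C j + (0, 1) →
      (∀ l, i ≤ l → l < j → C (l + 1) = C l + (1, 0)) → C i + (-1, 1) ∉ digital K := by
    intro i j hi hij h1 h2 hl h3
    refine r3 j h1 h2 ?_
    have e1 := eq_add_mul_of_forall_step hl hij le_rfl
    have e2 := h2 ▸ hC.mem (j + 1)
    have hji : (0 : ℝ) ≤ j - i := by
      have : 0 ≤ j - i := by omega
      exact_mod_cast this
    simp only [digital, pt, mem_ofPred_eq, Prod.fst_add, Prod.snd_add, e1] at e2 h3 ⊢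
    push_cast at e2 h3 ⊢
    refine mem_of_row hK.convex (x₁ := (C i).1 + -1) (x₃ := (C i).1 + (j - i) * 1 + 0)
      ?_ ?_ ?_ ?_
    · simpa using h3
    · simpa using e2
    · linarith
    · linarith
  have hcol : ∀ i j, j ≤ i → C j = C (j - 1) + (1, 0) → C (j + 1) = C j + (0, 1) →
      (∀ l, j ≤ l → l < i → C (l + 1) = C l + (0, 1)) → C i + (-1, 1) ∉ digital K := by
    intro i j hij h1 h2 hl h3
    refine r3 j h1 h2 ?_
    have e1 := eq_add_mul_of_forall_step hl hij le_rfl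
    have e2 := hC.mem (j - 1)
    have e3 : C (j - 1) = C j - (1, 0) := by rw [h1]; abel
    have hji : (0 : ℝ) ≤ i - j := by
      have : 0 ≤ i - j := by omega
      exact_mod_cast this
    rw [e3] at e2
    simp only [digital, pt, mem_ofPred_eq, Prod.fst_add, Prod.snd_add, Prod.fst_sub, Prod.snd_sub,
      e1] at e2 h3 ⊢
    push_cast at e2 h3 ⊢
    refine mem_of_column hK.convex (y₁ := (C j).2) (y₃ := (C j).2 + (i - j) * 1 + 1)
      ?_ ?_ ?_ ?_
    · simpa [sub_eq_add_neg] using e2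
    · simpa using h3
    · linarith
    · linarith
  refine ⟨fun i _ _ => hC.mem i, hstep, fun i hi hin => ?_⟩
  change C i + (-1, 1) ∉ digital K
  by_cases c1 : m + 2 ≤ i ∧ C i = C (i - 1) + (1, 0)
  · have := r1 (i - 1) (by omega) (by omega) (by rw [sub_add_cancel]; exact c1.2)
    intro h
    refine this ?_
    rw [c1.2] at h
    convert h using 1
    ext <;> simp [add_assoc]
  by_cases c2 : i + 2 ≤ n ∧ C (i + 1) = C i + (0, 1)
  · have := r2 (i + 1) (by omega) (by omega) (by rw [add_sub_cancel_right]; exact c2.2)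
    intro h
    refine this ?_
    rw [c2.2]
    convert h using 1
    ext <;> simp [add_assoc]
  by_cases c3 : m < i ∧ C i = C (i - 1) + (0, 1)
  · by_cases c4 : i < n ∧ C (i + 1) = C i + (1, 0)
    · intro h
      rcases hK.mem_of_diagonal hρ (P := pt (C i)) (hC.mem i) (by
        simpa [digital, pt] using h) with h' | h'
      · exact r2 i c3.1 c4.1 c3.2 (by simpa [digital, pt] using h')
      · exact r1 i c3.1 c4.1 c4.2 (by simpa [digital, pt] using h')
    · -- at the end, the path climbs a column, which starts at a corner
      have hup' : ∀ l, i - 1 ≤ l → l < n → C (l + 1) = C l + (0, 1) := by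
        intro l h1 h2
        have hi2 : n ≤ i + 1 := by
          by_contra hlt
          rcases hstep i hi (by omega) with h | h
          · exact c4 ⟨by omega, h⟩
          · exact c2 ⟨by omega, h⟩
        rcases (show l = i - 1 ∨ l = i by omega) with rfl | rfl
        · rw [sub_add_cancel]; exact c3.2
        · rcases hstep l hi h2 with h | h
          · exact absurd ⟨h2, h⟩ c4
          · exact h
      obtain ⟨j, ⟨hj1, hj2, hj3⟩, hjmax⟩ := Int.exists_greatest_of_bdd
        (P := fun j => m ≤ j ∧ j < n ∧ C (j + 1) = C j + (1, 0)) ⟨n, fun z hz => hz.2.1.le⟩ hright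
      have hji : j < i - 1 := by
        by_contra hlt
        exact hne j hj3 (hup' j (by omega) hj2)
      have hcl : ∀ l, j + 1 ≤ l → l < n → C (l + 1) = C l + (0, 1) := by
        intro l h1 h2
        rcases hstep l (by omega) h2 with h | h
        · have := hjmax l ⟨by omega, h2, h⟩
          omega
        · exact h
      exact hcol i (j + 1) (by omega) (by rw [add_sub_cancel_right]; exact hj3)
        (hcl (j + 1) le_rfl (by omega)) (fun l h1 h2 => hcl l h1 (by omega))
  · -- at the start, the path follows a row, which ends at a corner
    have hrt : ∀ l, m ≤ l → l < i → C (l + 1) = C l + (1, 0) := by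
      intro l h1 h2
      rcases hstep l h1 (by omega) with h | h
      · exact h
      · exfalso
        have e1 : i ≤ m + 1 := by
          by_contra hlt
          rcases hstep' i (by omega) hin with h' | h'
          · exact c1 ⟨by omega, h'⟩
          · exact c3 ⟨by omega, h'⟩
        obtain rfl : l = i - 1 := by omega
        exact c3 ⟨by omega, by rw [sub_add_cancel] at h; exact h⟩
    have him : i ≤ m + 1 := by
      by_contra hlt
      rcases hstep' i (by omega) hin with h' | h'
      · exact c1 ⟨by omega, h'⟩
      · exact c3 ⟨by omega, h'⟩
    obtain ⟨j, ⟨hj1, hj2, hj3⟩, hjmin⟩ := Int.exists_least_of_bdd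
      (P := fun j => m ≤ j ∧ j < n ∧ C (j + 1) = C j + (0, 1)) ⟨m, fun z hz => hz.1⟩ hup
    have hij : i ≤ j := by
      by_contra hlt
      exact hne j (hrt j hj1 (by omega)) hj3
    have hcl : ∀ l, m ≤ l → l < j → C (l + 1) = C l + (1, 0) := by
      intro l h1 h2
      rcases hstep l h1 (by omega) with h | h
      · exact h
      · have := hjmin l ⟨h1, by omega, h⟩
        omega
    have hmj : m < j := by
      rcases hj1.eq_or_lt with rfl | h
      · exact absurd ⟨by omega, by rw [show i = m by omega]; exact hj3⟩ c2
      · exact h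
    refine hrow i j hi hij ?_ hj3 (fun l h1 h2 => hcl l (by omega) h2)
    have := hcl (j - 1) (by omega) (by omega)
    rwa [sub_add_cancel] at this

end IsContour

/-! ### The direction of maximal segments -/

/-- What a maximal segment from `P` to `Q` contained in a standard line of slope `a / b` knows of
the body `K`, up to absolute constants: at the scale `ℓ`, the segment is close to the points of `K`
that are extremal in the outward direction `u`, and the direction `(b, a)` is almost
perpendicular to `u`. As `K` is round, the length `ℓ` can only be large if `u` is almost
perpendicular to some short integer vector `w`. -/
structure SegmentWitness (K : Set (ℝ × ℝ)) (P Q : ℤ × ℤ) (a b : ℤ) (ρ ϱ ℓ : ℝ) (u : ℝ × ℝ)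
    (w : ℤ × ℤ) : Prop where
  one_le : 1 ≤ ℓ
  unit : u.1 ^ 2 + u.2 ^ 2 = 1
  ne_zero : w ≠ 0
  size : (|(w.1 : ℝ)| + |(w.2 : ℝ)|) * ℓ ^ 2 ≤ 2400 * ϱ
  along : |w.1 * u.1 + w.2 * u.2| * ℓ ≤ 2400
  support : ∀ T ∈ K, (∀ X ∈ K, u.1 * X.1 + u.2 * X.2 ≤ u.1 * T.1 + u.2 * T.2) →
    |T.1 - P.1| ≤ 2400 * ℓ ∧ |T.2 - P.2| ≤ 2400 * ℓ
  length : |(Q.1 : ℝ) - P.1| ≤ 2400 * ℓ ∧ |(Q.2 : ℝ) - P.2| ≤ 2400 * ℓ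
  direction : |b * u.1 + a * u.2| * ρ ≤ 2400 * ℓ * (|(a : ℝ)| + |(b : ℝ)|)
  outward : ∀ c : ℤ × ℤ, |c.1| + |c.2| = 1 → digitalAbscissa c P < digitalAbscissa c Q →
    0 ≤ -u.1 * c.2 + u.2 * c.1

/-- Witnesses can be turned. -/
theorem SegmentWitness.turn {K : Set (ℝ × ℝ)} {P Q : ℤ × ℤ} {a b : ℤ} {ρ ϱ ℓ : ℝ} {u : ℝ × ℝ}
    {w : ℤ × ℤ}
    (h : SegmentWitness {x | (-x.2, x.1) ∈ K} (-turnLeft P) (-turnLeft Q) (-b) a ρ ϱ ℓ u w) :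
    SegmentWitness K P Q a b ρ ϱ ℓ (-u.2, u.1) (turnLeft w) := by
  refine ⟨h.one_le, ?_, ?_, ?_, ?_, ?_, ?_, ?_, ?_⟩
  · have := h.unit
    simp only
    linarith
  · intro h0
    refine h.ne_zero ?_
    rw [Prod.ext_iff] at h0 ⊢
    simp only [turnLeft_fst, turnLeft_snd, Prod.fst_zero, Prod.snd_zero] at h0 ⊢
    omega
  · have := h.size
    simp only [turnLeft_fst, turnLeft_snd]
    push_cast
    rw [abs_neg, add_comm]
    exact this
  · have := h.along
    simp only [turnLeft_fst, turnLeft_snd]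
    push_cast
    rwa [show -(w.2 : ℝ) * -u.2 + w.1 * u.1 = w.1 * u.1 + w.2 * u.2 by ring]
  · intro T hT hmax
    have := h.support (T.2, -T.1) (by simpa using hT) (by
      intro X hX
      have := hmax _ hX
      simp only at this ⊢
      linarith)
    simp only [Prod.fst_neg, Prod.snd_neg, turnLeft_fst, turnLeft_snd, neg_neg] at this
    push_cast at this
    refine ⟨?_, this.1⟩
    have h2 := this.2
    rwa [show -T.1 - -(P.1 : ℝ) = -(T.1 - P.1) by ring, abs_neg] at h2
  · have := h.length
    simp only [Prod.fst_neg, Prod.snd_neg, turnLeft_fst, turnLeft_snd, neg_neg] at this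
    push_cast at this
    refine ⟨?_, this.1⟩
    have h2 := this.2
    rwa [show -(Q.1 : ℝ) - -(P.1 : ℝ) = -(Q.1 - P.1) by ring, abs_neg] at h2
  · have := h.direction
    push_cast at this
    rw [abs_neg] at this
    simp only
    rwa [show (b : ℝ) * -u.2 + a * u.1 = a * u.1 + -b * u.2 by ring, add_comm |(a : ℝ)|]
  · intro c hc hcPQ
    have := h.outward (-turnLeft c) (by simpa [add_comm] using hc) (by
      simp only [digitalAbscissa, Prod.fst_neg, Prod.snd_neg, turnLeft_fst, turnLeft_snd,
        neg_neg] at hcPQ ⊢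
      linarith)
    simp only [Prod.fst_neg, Prod.snd_neg, turnLeft_fst, turnLeft_snd, neg_neg] at this
    push_cast at this
    simp only
    linarith

theorem IsMaximalSegment.not_next {C : ℤ → ℤ × ℤ} {m n : ℤ} (h : IsMaximalSegment C m n)
    {a b μ : ℤ} (hl : ∀ i, m ≤ i → i ≤ n → C i ∈ standardLine a b μ) :
    C (n + 1) ∉ standardLine a b μ := by
  intro h1
  refine h.2.2 (isDSS_iff.2 ⟨by linarith [h.1.1], a, b, μ, fun i h2 h3 => ?_⟩)
  rcases (show i ≤ n ∨ i = n + 1 by omega) with h4 | rfl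
  · exact hl i h2 h4
  · exact h1

theorem IsMaximalSegment.not_prev {C : ℤ → ℤ × ℤ} {m n : ℤ} (h : IsMaximalSegment C m n)
    {a b μ : ℤ} (hl : ∀ i, m ≤ i → i ≤ n → C i ∈ standardLine a b μ) :
    C (m - 1) ∉ standardLine a b μ := by
  intro h1
  refine h.2.1 (isDSS_iff.2 ⟨by linarith [h.1.1], a, b, μ, fun i h2 h3 => ?_⟩)
  rcases (show m ≤ i ∨ i = m - 1 by omega) with h4 | rfl
  · exact hl i h4 h3
  · exact h1

theorem sub_eq_of_unit_step {Γ : Set (ℤ × ℤ)} {C : ℤ → ℤ × ℤ} (hC : IsContour Γ C) (i : ℤ) :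
    C (i + 1) = C i + (1, 0) ∨ C (i + 1) = C i + (0, 1) ∨ C (i + 1) = C i + (-1, 0) ∨
      C (i + 1) = C i + (0, -1) := by
  have e : C (i + 1) = C i + (C (i + 1) - C i) := by abel
  rcases eq_of_unit (hC.unit_step i) with h | h | h | h <;> rw [h] at e <;> simp [e]

/-- How the contour leaves a maximal segment that is a stair, at the front. -/
theorem IsStair.front_exit {K : Set (ℝ × ℝ)} {C : ℤ → ℤ × ℤ} {m n : ℤ}
    (hst : IsStair K C m n) (hC : IsContour (digital K) C) (hK : Convex ℝ K)
    (hmax : IsMaximalSegment C m n) (hmn : m + 2 ≤ n) {a b μ : ℤ} (ha : 0 ≤ a) (hb : 0 ≤ b)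
    (hlow : ∀ i, m ≤ i → i ≤ n → μ ≤ a * (C i).1 - b * (C i).2)
    (hup : ∀ i, m ≤ i → i ≤ n → a * (C i).1 - b * (C i).2 < μ + (a + b)) :
    (pt (C n + (1, 0)) ∈ K ∧ pt (C n + (0, 1)) ∉ K ∧ μ + b ≤ a * (C n).1 - b * (C n).2) ∨
      (pt (C n + (1, 0)) ∉ K ∧ pt (C n + (0, 1)) ∉ K) := by
  have hline : ∀ i, m ≤ i → i ≤ n → C i ∈ standardLine a b μ := by
    intro i h1 h2
    refine ⟨hlow i h1 h2, ?_⟩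
    rw [abs_of_nonneg ha, abs_of_nonneg hb]; linarith [hup i h1 h2]
  have hupw : C (n + 1) ≠ C n + (0, 1) := by
    intro h
    obtain ⟨a', b', μ', h1, h2⟩ := hst.exists_standardLine_up hK (by omega) ha hb hlow hup
      (h ▸ hC.mem (n + 1))
    exact hmax.not_next h1 (h ▸ h2)
  have hlev : C (n + 1) = C n + (1, 0) → μ + b ≤ a * (C n).1 - b * (C n).2 := by
    intro h
    by_contra hcon
    refine hmax.not_next hline ?_
    rw [h]
    have := hlow n (by omega) le_rfl
    simp only [standardLine, mem_ofPred_eq, Prod.fst_add, Prod.snd_add]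
    rw [abs_of_nonneg ha, abs_of_nonneg hb]
    constructor <;> linarith
  have hleft : C n = C (n - 1) + (0, 1) → C n + (-1, 0) ∉ digital K := by
    intro h h2
    refine hst.out (n - 1) (by omega) (by omega) ?_
    rw [h] at h2
    simpa [digital, add_assoc] using h2
  have hg : ∀ v, pt (C n + v) ∈ K ↔ C n + v ∈ digital K := fun v => Iff.rfl
  rw [hg, hg]
  have harr := hst.step (n - 1) (by omega) (by omega)
  rw [sub_add_cancel] at harr
  rcases harr with hd | hd <;> rcases sub_eq_of_unit_step hC n with hd' | hd' | hd' | hd' <;>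
    have h4 := hC.next_cases n hd hd' <;> simp [turnLeft] at h4 <;> tauto

/-- How the contour enters a maximal segment that is a stair, at the back. -/
theorem IsStair.back_exit {K : Set (ℝ × ℝ)} {C : ℤ → ℤ × ℤ} {m n : ℤ}
    (hst : IsStair K C m n) (hC : IsContour (digital K) C) (hK : Convex ℝ K)
    (hmax : IsMaximalSegment C m n) (hmn : m + 2 ≤ n) {a b μ : ℤ} (ha : 0 ≤ a) (hb : 0 ≤ b)
    (hlow : ∀ i, m ≤ i → i ≤ n → μ ≤ a * (C i).1 - b * (C i).2)
    (hup : ∀ i, m ≤ i → i ≤ n → a * (C i).1 - b * (C i).2 < μ + (a + b)) :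
    (pt (C m - (0, 1)) ∈ K ∧ pt (C m - (1, 0)) ∉ K ∧ μ + a ≤ a * (C m).1 - b * (C m).2) ∨
      (pt (C m - (0, 1)) ∉ K ∧ pt (C m - (1, 0)) ∉ K) := by
  have hline : ∀ i, m ≤ i → i ≤ n → C i ∈ standardLine a b μ := by
    intro i h1 h2
    refine ⟨hlow i h1 h2, ?_⟩
    rw [abs_of_nonneg ha, abs_of_nonneg hb]; linarith [hup i h1 h2]
  have hbackw : C (m - 1) ≠ C m - (1, 0) := by
    intro h
    obtain ⟨a', b', μ', h1, h2⟩ := hst.exists_standardLine_back hK (by omega) ha hb hlow hup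
      (h ▸ hC.mem (m - 1))
    exact hmax.not_prev h1 (h ▸ h2)
  have hlev : C (m - 1) = C m - (0, 1) → μ + a ≤ a * (C m).1 - b * (C m).2 := by
    intro h
    by_contra hcon
    refine hmax.not_prev hline ?_
    rw [h]
    have := hlow m le_rfl (by omega)
    simp only [standardLine, mem_ofPred_eq, Prod.fst_sub, Prod.snd_sub]
    rw [abs_of_nonneg ha, abs_of_nonneg hb]
    constructor <;> linarith
  have hdown : C (m + 1) = C m + (1, 0) → C m + (0, 1) ∉ digital K := by
    intro h h2
    refine hst.out (m + 1) (by omega) (by omega) ?_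
    rw [h]
    simpa [digital, add_assoc] using h2
  have hg : ∀ v, pt (C m - v) ∈ K ↔ C m - v ∈ digital K := fun v => Iff.rfl
  rw [hg, hg]
  have hprev := sub_eq_of_unit_step hC (m - 1)
  rw [sub_add_cancel] at hprev
  have hmem := hC.mem (m - 1)
  rcases hst.step m le_rfl (by omega) with hd' | hd' <;> rcases hprev with hd | hd | hd | hd <;>
    have h4 := hC.next_cases m hd hd' <;>
    have h5 : C (m - 1) = C m - _ := eq_sub_of_add_eq hd.symm <;>
    rw [h5] at hmem hlev hbackw <;> simp [turnLeft, sub_eq_add_neg] at * <;> tauto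

theorem abs_add_le_two_mul_sqrt (a b : ℝ) : |a| + |b| ≤ 2 * √(a ^ 2 + b ^ 2) := by
  have h1 : |a| ≤ √(a ^ 2 + b ^ 2) := Real.abs_le_sqrt (by linarith [sq_nonneg b])
  have h2 : |b| ≤ √(a ^ 2 + b ^ 2) := Real.abs_le_sqrt (by linarith [sq_nonneg a])
  linarith

/-- The witness for a maximal segment that is a stair. -/
theorem IsStair.exists_witness {K : Set (ℝ × ℝ)} {C : ℤ → ℤ × ℤ} {m n : ℤ} {ρ ϱ : ℝ}
    (hst : IsStair K C m n) (hC : IsContour (digital K) C) (hK : RoundBody K ρ ϱ) (hρ : 200 ≤ ρ)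
    (hρϱ : ρ ≤ ϱ)
    (hmax : IsMaximalSegment C m n) (hmn : m + 2 ≤ n) {a b μ : ℤ} (ha : 0 < a) (hb : 0 < b)
    (hlow : ∀ i, m ≤ i → i ≤ n → μ ≤ a * (C i).1 - b * (C i).2)
    (hup : ∀ i, m ≤ i → i ≤ n → a * (C i).1 - b * (C i).2 < μ + (a + b)) :
    ∃ ℓ u w, SegmentWitness K (C m) (C n) a b ρ ϱ ℓ u w := by
  obtain ⟨i₀, hi₀, hmin⟩ := Finset.exists_min_image (Finset.Icc m n)
    (fun i => a * (C i).1 - b * (C i).2) ⟨m, by simp; omega⟩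
  rw [Finset.mem_Icc] at hi₀
  have hlow' : ∀ i, m ≤ i → i ≤ n →
      a * (C i₀).1 - b * (C i₀).2 ≤ a * (C i).1 - b * (C i).2 :=
    fun i h1 h2 => hmin i (by simp [h1, h2])
  have hμ := hlow i₀ hi₀.1 hi₀.2
  have hup' : ∀ i, m ≤ i → i ≤ n →
      a * (C i).1 - b * (C i).2 < a * (C i₀).1 - b * (C i₀).2 + (a + b) :=
    fun i h1 h2 => (hup i h1 h2).trans_le (by linarith)
  have hfront := hst.front_exit hC hK.convex hmax hmn ha.le hb.le hlow' hup'
  have hback := hst.back_exit hC hK.convex hmax hmn ha.le hb.le hlow' hup'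
  have haR : (0 : ℝ) < a := by exact_mod_cast ha
  have hbR : (0 : ℝ) < b := by exact_mod_cast hb
  have hN : (2 : ℝ) ≤ n - m := by
    have : 2 ≤ n - m := by omega
    exact_mod_cast this
  obtain ⟨D, hD⟩ : ∃ D : ℝ, D = √((a : ℝ) ^ 2 + b ^ 2) := ⟨_, rfl⟩
  have hD0 : 0 < D := by rw [hD]; positivity
  have hD2 : D ^ 2 = (a : ℝ) ^ 2 + b ^ 2 := by rw [hD, Real.sq_sqrt (by positivity)]
  have hDab : (a : ℝ) + b ≤ 2 * D := by
    have := abs_add_le_two_mul_sqrt a b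
    rwa [abs_of_pos haR, abs_of_pos hbR, ← hD] at this
  -- the Diophantine approximation of the slope; for short segments any short vector will do
  obtain ⟨w, hw0, hw1, hw2⟩ : ∃ w : ℤ × ℤ, w ≠ 0 ∧
      (|(w.1 : ℝ)| + |(w.2 : ℝ)|) * (n - m) ^ 2 ≤ 2400 * ϱ ∧
      |w.1 * (-a / D) + w.2 * (b / D)| * (n - m) ≤ 2400 := by
    by_cases h8 : m + 8 ≤ n
    · obtain ⟨k, j, hk, hj0, hjk, hsize, hal⟩ := hst.exists_flat hK (by linarith) h8 ha.le hb.le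
        (by omega) hlow hup
      refine ⟨(k - j, j), ?_, ?_, ?_⟩
      · intro h
        rw [Prod.ext_iff] at h
        simp only [Prod.fst_zero, Prod.snd_zero] at h
        omega
      · have h1 : (0 : ℝ) ≤ k - j := by
          have : 0 ≤ k - j := by omega
          exact_mod_cast this
        have h2 : (0 : ℝ) ≤ j := by exact_mod_cast hj0
        push_cast
        rw [abs_of_nonneg h1, abs_of_nonneg h2, sub_add_cancel]
        linarith
      · push_cast
        have e : ((k : ℝ) - j) * (-a / D) + j * (b / D) = -((k : ℝ) * a - j * (a + b)) / D := by
          field_simp; ring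
        rw [e, abs_div, abs_neg, abs_of_pos hD0, div_mul_eq_mul_div, div_le_iff₀ hD0]
        linarith
    · refine ⟨(1, 0), by simp, ?_, ?_⟩
      · have h7 : (n - m : ℝ) ≤ 7 := by
          have : n - m ≤ 7 := by omega
          exact_mod_cast this
        have : (n - m : ℝ) ^ 2 ≤ 7 ^ 2 := by gcongr
        push_cast
        rw [abs_one, abs_zero]
        linarith
      · have h7 : (n - m : ℝ) ≤ 7 := by
          have : n - m ≤ 7 := by omega
          exact_mod_cast this
        push_cast
        rw [one_mul, zero_mul, add_zero, abs_div, abs_neg, abs_of_pos haR, abs_of_pos hD0,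
          div_mul_eq_mul_div, div_le_iff₀ hD0]
        have h8 : (a : ℝ) * (n - m) ≤ a * 7 := by gcongr
        have h9 : (a : ℝ) ≤ 2 * D := by linarith
        linarith
  refine ⟨n - m, (-a / D, b / D), w, ⟨by linarith, ?_, hw0, hw1, hw2, ?_, ?_, ?_, ?_⟩⟩
  · simp only
    rw [div_pow, div_pow, ← add_div, neg_sq, ← hD2, div_self (by positivity)]
  · intro T hT hTmax
    have hTmin : ∀ X ∈ K, (a : ℝ) * T.1 - b * T.2 ≤ a * X.1 - b * X.2 := by
      intro X hX
      have := hTmax X hX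
      simp only at this
      have h2 := mul_le_mul_of_nonneg_left this hD0.le
      have e : ∀ x y : ℝ, D * (-a / D * x + b / D * y) = -(a * x) + b * y := by
        intro x y; field_simp
      rw [e, e] at h2
      linarith
    have h1 := hst.support_lt_front hK hρ (by omega) ha.le hb.le (by omega)
      (hlow' n (by omega) le_rfl) hi₀.1 hi₀.2 rfl hfront hT hTmin
    have h2 := hst.back_lt_support hK hρ (by omega) ha.le hb.le (by omega)
      (hlow' m le_rfl (by omega)) hi₀.1 hi₀.2 rfl hback hT hTmin
    have := hst.abs_support_sub_le hK.convex hmn ha.le hb.le (by omega) hi₀.1 hi₀.2 hT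
      (hTmin _ (hst.mem i₀ hi₀.1 hi₀.2)) h2 h1
    exact ⟨this.1.trans (by linarith), this.2.trans (by linarith)⟩
  · obtain ⟨h1, h2, h3⟩ := hst.monotone (i := m) (j := n) le_rfl (by omega) le_rfl
    have h1R : ((C m).1 : ℝ) ≤ (C n).1 := by exact_mod_cast h1
    have h2R : ((C m).2 : ℝ) ≤ (C n).2 := by exact_mod_cast h2
    have h3R : ((C n).1 : ℝ) + (C n).2 = (C m).1 + (C m).2 + (n - m) := by exact_mod_cast h3
    rw [abs_of_nonneg (by linarith), abs_of_nonneg (by linarith)]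
    constructor <;> linarith
  · have e : (b : ℝ) * (-a / D) + a * (b / D) = 0 := by ring
    simp only
    rw [e, abs_zero, zero_mul]
    have : (0 : ℝ) ≤ n - m := by linarith
    positivity
  · intro c hc hcPQ
    obtain ⟨h1, h2, h3⟩ := hst.monotone (i := m) (j := n) le_rfl (by omega) le_rfl
    simp only [digitalAbscissa] at hcPQ
    rcases eq_of_unit hc with rfl | rfl | rfl | rfl
    · simp; positivity
    · simp
      rw [neg_div]
      have : (0 : ℝ) ≤ a / D := by positivity
      linarith
    · simp at hcPQ; omega
    · simp at hcPQ; omega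

theorem unit_induction {Φ : ℤ × ℤ → Prop} {e₀ : ℤ × ℤ} (h₀ : |e₀.1| + |e₀.2| = 1) (hb : Φ e₀)
    (hs : ∀ e, Φ e → Φ (turnLeft e)) : ∀ e : ℤ × ℤ, |e.1| + |e.2| = 1 → Φ e := by
  intro e he
  have h1 := hs _ hb
  have h2 := hs _ h1
  have h3 := hs _ h2
  rcases eq_of_unit h₀ with rfl | rfl | rfl | rfl <;>
    rcases eq_of_unit he with rfl | rfl | rfl | rfl <;> simp [turnLeft] at h1 h2 h3 <;> assumption

theorem RoundBody.turn {K : Set (ℝ × ℝ)} {ρ ϱ : ℝ} (hK : RoundBody K ρ ϱ) :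
    RoundBody {x : ℝ × ℝ | (-x.2, x.1) ∈ K} ρ ϱ := by
  have := hK.preimage_orthogonal (p := 0) (q := -1) (r := 1) (t := 0) (by norm_num)
    (by norm_num) (by norm_num) (by norm_num) (by norm_num) (by norm_num)
  simpa using this

theorem IsContour.turn_digital {K : Set (ℝ × ℝ)} {C : ℤ → ℤ × ℤ} (hC : IsContour (digital K) C) :
    IsContour (digital {x : ℝ × ℝ | (-x.2, x.1) ∈ K}) (fun i => -turnLeft (C i)) := by
  have e : digital {x : ℝ × ℝ | (-x.2, x.1) ∈ K} = {P | turnLeft P ∈ digital K} := by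
    ext P
    simp [digital, pt]
  rw [e]
  exact hC.turn

theorem neg_turnLeft_eq_add_iff {P Q e : ℤ × ℤ} :
    -turnLeft P = -turnLeft Q + e ↔ P = Q + turnLeft e := by
  rw [Prod.ext_iff, Prod.ext_iff]
  simp only [Prod.fst_neg, Prod.snd_neg, Prod.fst_add, Prod.snd_add, turnLeft_fst, turnLeft_snd]
  constructor <;> rintro ⟨h1, h2⟩ <;> constructor <;> omega

/-- A path with steps to the right and upwards, both of which occur, can only be contained in
standard lines of positive slope. -/
theorem exists_pos_strip {C : ℤ → ℤ × ℤ} {m n : ℤ} {a b μ : ℤ}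
    (hstep : ∀ i, m ≤ i → i < n → C (i + 1) = C i + (1, 0) ∨ C (i + 1) = C i + (0, 1))
    (hbend : ∀ d : ℤ × ℤ, ∃ i, m ≤ i ∧ i < n ∧ C (i + 1) ≠ C i + d)
    (hline : ∀ i, m ≤ i → i ≤ n → C i ∈ standardLine a b μ) :
    ∃ a' b' μ' : ℤ, 0 < a' ∧ 0 < b' ∧ (a' = a ∧ b' = b ∨ a' = -a ∧ b' = -b) ∧
      (∀ i, m ≤ i → i ≤ n → μ' ≤ a' * (C i).1 - b' * (C i).2) ∧
      ∀ i, m ≤ i → i ≤ n → a' * (C i).1 - b' * (C i).2 < μ' + (a' + b') := by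
  have hab : 0 < a * b := by
    by_contra hcon
    have hsame : ∀ i d, m ≤ i → i + 1 < n → C (i + 1) = C i + d →
        C (i + 1 + 1) = C (i + 1) + d := by
      intro i d h1 h2 h3
      have hd : d = (1, 0) ∨ d = (0, 1) := by
        rcases hstep i h1 (by omega) with h | h <;> rw [h3] at h
        · exact Or.inl (add_left_cancel h)
        · exact Or.inr (add_left_cancel h)
      obtain ⟨g, hg, hg'⟩ : ∃ g : ℤ × ℤ, C (i + 1 + 1) = C (i + 1) + g ∧
          (g = (1, 0) ∨ g = (0, 1)) := by
        rcases hstep (i + 1) (by omega) h2 with h | h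
        · exact ⟨_, h, Or.inl rfl⟩
        · exact ⟨_, h, Or.inr rfl⟩
      by_cases hgd : g = d
      · rw [hg, hgd]
      · exfalso
        have hP := hline i h1 (by omega)
        have hQ := hline (i + 1 + 1) (by omega) (by omega)
        rw [hg, h3] at hQ
        rcases hd with rfl | rfl <;> rcases hg' with rfl | rfl
        · exact hgd rfl
        · have := IsContour.mul_level_neg_of_corner (by simp) (by simp) hgd (by simp) hP hQ
          simp at this
          exact hcon this
        · have := IsContour.mul_level_neg_of_corner (by simp) (by simp) hgd (by simp) hP hQ
          simp at this
          rw [mul_comm] at this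
          exact hcon this
        · exact hgd rfl
    obtain ⟨i, h1, h2, h3⟩ := hbend (C (m + 1) - C m)
    refine h3 ?_
    clear h3
    induction i, h1 using Int.leInduction with
    | base => abel
    | succ k hk ih => exact hsame k _ hk h2 (ih (by omega))
  rcases mul_pos_iff.1 hab with ⟨ha, hb⟩ | ⟨ha, hb⟩
  · refine ⟨a, b, μ, ha, hb, Or.inl ⟨rfl, rfl⟩, fun i h1 h2 => (hline i h1 h2).1, fun i h1 h2 => ?_⟩
    have := (hline i h1 h2).2
    rw [abs_of_pos ha, abs_of_pos hb] at this
    linarith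
  · refine ⟨-a, -b, 1 - μ + a + b, by omega, by omega, Or.inr ⟨rfl, rfl⟩, fun i h1 h2 => ?_,
      fun i h1 h2 => ?_⟩
    · have := (hline i h1 h2).2
      rw [abs_of_neg ha, abs_of_neg hb] at this
      linarith
    · have := (hline i h1 h2).1
      linarith

theorem SegmentWitness.neg {K : Set (ℝ × ℝ)} {P Q : ℤ × ℤ} {a b : ℤ} {ρ ϱ ℓ : ℝ} {u : ℝ × ℝ}
    {w : ℤ × ℤ} (h : SegmentWitness K P Q (-a) (-b) ρ ϱ ℓ u w) :
    SegmentWitness K P Q a b ρ ϱ ℓ u w := by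
  refine ⟨h.one_le, h.unit, h.ne_zero, h.size, h.along, h.support, h.length, ?_, h.outward⟩
  have := h.direction
  push_cast at this
  rwa [show -(b : ℝ) * u.1 + -a * u.2 = -(b * u.1 + a * u.2) by ring, abs_neg, abs_neg,
    abs_neg] at this

namespace IsContour

theorem exists_right_up {C : ℤ → ℤ × ℤ} {m n : ℤ}
    (hstep : ∀ i, m ≤ i → i < n → C (i + 1) = C i + (1, 0) ∨ C (i + 1) = C i + (0, 1))
    (hbend : ∀ d : ℤ × ℤ, ∃ i, m ≤ i ∧ i < n ∧ C (i + 1) ≠ C i + d) :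
    (∃ i, m ≤ i ∧ i < n ∧ C (i + 1) = C i + (1, 0)) ∧
      ∃ i, m ≤ i ∧ i < n ∧ C (i + 1) = C i + (0, 1) := by
  obtain ⟨i, h1, h2, h3⟩ := hbend (0, 1)
  obtain ⟨j, g1, g2, g3⟩ := hbend (1, 0)
  exact ⟨⟨i, h1, h2, (hstep i h1 h2).resolve_right h3⟩,
    ⟨j, g1, g2, (hstep j g1 g2).resolve_left g3⟩⟩

/-- Digital straight segments of the contour have length `O(√ϱ)`. -/
theorem sq_length_le {ρ ϱ : ℝ} (hρ : 200 ≤ ρ) (hρϱ : ρ ≤ ϱ) {m n : ℤ} (hmn : m + 2 ≤ n) :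
    ∀ e : ℤ × ℤ, |e.1| + |e.2| = 1 → ∀ (K : Set (ℝ × ℝ)) (C : ℤ → ℤ × ℤ) (a b μ : ℤ),
      IsContour (digital K) C → RoundBody K ρ ϱ →
      (∀ i, m ≤ i → i < n → C (i + 1) = C i + e ∨ C (i + 1) = C i + turnLeft e) →
      (∀ d : ℤ × ℤ, ∃ i, m ≤ i ∧ i < n ∧ C (i + 1) ≠ C i + d) →
      (∀ i, m ≤ i → i ≤ n → C i ∈ standardLine a b μ) → (n - m : ℝ) ^ 2 ≤ 2400 * ϱ := by
  refine unit_induction (e₀ := (1, 0)) (by simp) ?_ ?_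
  · intro K C a b μ hC hK hstep hbend hline
    obtain ⟨hr, hu⟩ := exists_right_up hstep hbend
    obtain ⟨a', b', μ', ha, hb, -, hlow, hup⟩ := exists_pos_strip hstep hbend hline
    by_cases h8 : m + 8 ≤ n
    · obtain ⟨k, j, hk, hj0, hjk, hsize, -⟩ :=
        (hC.isStair hK (by linarith) hmn hstep hr hu).exists_flat hK (by linarith) h8 ha.le hb.le
        (by omega) hlow hup
      have hk1 : (1 : ℝ) ≤ k := by exact_mod_cast hk
      have := mul_le_mul_of_nonneg_right hk1 (sq_nonneg (n - m : ℝ))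
      linarith
    · have h7 : (n - m : ℝ) ≤ 7 := by
        have : n - m ≤ 7 := by omega
        exact_mod_cast this
      have h2 : (0 : ℝ) ≤ n - m := by
        have : 0 ≤ n - m := by omega
        exact_mod_cast this
      have : (n - m : ℝ) ^ 2 ≤ 7 ^ 2 := by gcongr
      linarith
  · intro e ih K C a b μ hC hK hstep hbend hline
    refine ih _ _ (-b) a μ hC.turn_digital hK.turn (fun i h1 h2 => ?_) (fun d => ?_)
      (fun i h1 h2 => mem_standardLine_turn.2 (hline i h1 h2))
    · simpa only [neg_turnLeft_eq_add_iff] using hstep i h1 h2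
    · simpa only [ne_eq, neg_turnLeft_eq_add_iff] using hbend (turnLeft d)

/-- Witnesses for maximal segments with steps in two adjacent directions. -/
theorem exists_witness_of_direction {ρ ϱ : ℝ} (hρ : 200 ≤ ρ) (hρϱ : ρ ≤ ϱ) {m n : ℤ}
    (hmn : m + 2 ≤ n) :
    ∀ e : ℤ × ℤ, |e.1| + |e.2| = 1 → ∀ (K : Set (ℝ × ℝ)) (C : ℤ → ℤ × ℤ) (a b μ : ℤ),
      IsContour (digital K) C → RoundBody K ρ ϱ →
      IsMaximalSegment C m n →
      (∀ i, m ≤ i → i < n → C (i + 1) = C i + e ∨ C (i + 1) = C i + turnLeft e) →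
      (∀ i, m ≤ i → i ≤ n → C i ∈ standardLine a b μ) →
      ∃ ℓ u w, SegmentWitness K (C m) (C n) a b ρ ϱ ℓ u w := by
  refine unit_induction (e₀ := (1, 0)) (by simp) ?_ ?_
  · intro K C a b μ hC hK hmax hstep hline
    have hbend := fun d => hC.exists_corner hmax d
    obtain ⟨hr, hu⟩ := exists_right_up hstep hbend
    obtain ⟨a', b', μ', ha, hb, hor, hlow, hup⟩ := exists_pos_strip hstep hbend hline
    obtain ⟨ℓ, u, w, h⟩ := (hC.isStair hK (by linarith) hmn hstep hr hu).exists_witness hC hK hρ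
      hρϱ hmax hmn ha hb hlow hup
    rcases hor with ⟨rfl, rfl⟩ | ⟨rfl, rfl⟩
    · exact ⟨ℓ, u, w, h⟩
    · exact ⟨ℓ, u, w, h.neg⟩
  · intro e ih K C a b μ hC hK hmax hstep hline
    obtain ⟨ℓ, u, w, h⟩ := ih _ _ (-b) a μ hC.turn_digital hK.turn hmax.turn (fun i h1 h2 => by
      simpa only [neg_turnLeft_eq_add_iff] using hstep i h1 h2)
      (fun i h1 h2 => mem_standardLine_turn.2 (hline i h1 h2))
    exact ⟨ℓ, _, _, h.turn⟩

end IsContour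

/-! ### Spikes: points at which the contour turns back -/

/-- The ball of a round body at the tip `P` of a vertical spike. -/
theorem RoundBody.tip_ball {K : Set (ℝ × ℝ)} {ρ ϱ : ℝ} (hK : RoundBody K ρ ϱ) (hρ : 200 ≤ ρ)
    {P : ℝ × ℝ} (hP : P ∈ K) (h1 : P + (1, 0) ∉ K) (h2 : P + (-1, 0) ∉ K) (h3 : P + (0, 1) ∉ K)
    {x y : ℝ} (hy : 0 ≤ y) (hxy : x ^ 2 + y ^ 2 + |x| ≤ 2 * (ρ - 2) * y) : P + (x, -y) ∈ K := by
  obtain ⟨u, hu, hb⟩ := hK.ball P hP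
  have g : ∀ v : ℝ × ℝ, P + v ∉ K → ρ ^ 2 < (v.1 - u.1) ^ 2 + (v.2 - u.2) ^ 2 := by
    intro v hv
    by_contra hcon
    push Not at hcon
    exact hv (hb v hcon)
  have g1 := g _ h1
  have g2 := g _ h2
  have g3 := g _ h3
  simp only at g1 g2 g3
  have e1 : u.1 ≤ 1 / 2 := by linarith
  have e2 : -(1 / 2) ≤ u.1 := by linarith
  have e3 : u.2 ≤ 1 / 2 := by linarith
  have e4 : u.1 ^ 2 ≤ (1 / 2) ^ 2 := sq_le_sq' e2 e1
  have e5 : u.2 ≤ -(ρ - 2) := by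
    by_contra hcon
    push Not at hcon
    have : u.2 ^ 2 ≤ (ρ - 2) ^ 2 := sq_le_sq' hcon.le (by linarith)
    linarith
  refine hb _ ?_
  have e6 : y * u.2 ≤ y * (-(ρ - 2)) := mul_le_mul_of_nonneg_left e5 hy
  have e7 : -(x * u.1) ≤ |x| * (1 / 2) := by
    have := neg_abs_le (x * u.1)
    rw [abs_mul] at this
    have h8 : |u.1| ≤ 1 / 2 := abs_le.2 ⟨e2, e1⟩
    have := mul_le_mul_of_nonneg_left h8 (abs_nonneg x)
    linarith
  simp only
  linarith

/-- The extremal points in the direction of a vertical spike are close to its tip. -/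
theorem RoundBody.tip_support {K : Set (ℝ × ℝ)} {ρ ϱ : ℝ} (hK : RoundBody K ρ ϱ) (hρ : 200 ≤ ρ)
    {P : ℝ × ℝ} (hP : P ∈ K) (h1 : P + (1, 0) ∉ K) (h2 : P + (-1, 0) ∉ K) (h3 : P + (0, 1) ∉ K)
    {T : ℝ × ℝ} (hT : T ∈ K) (hPT : P.2 ≤ T.2) : |T.1 - P.1| ≤ 3 ∧ |T.2 - P.2| ≤ 3 := by
  have hball := fun (x y : ℝ) => hK.tip_ball hρ hP h1 h2 h3 (x := x) (y := y)
  have hside : ∀ ε : ℝ, (ε = 1 ∨ ε = -1) → ε * (T.1 - P.1) < 1 := by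
    intro ε hε
    by_contra hcon
    push Not at hcon
    have hε2 : ε ^ 2 = 1 := by rcases hε with rfl | rfl <;> norm_num
    have hεa : |ε| = 1 := by rcases hε with rfl | rfl <;> norm_num
    have hd := hball ε 1 (by norm_num) (by rw [hε2, hεa]; linarith)
    have hpos : 0 < ε * (T.1 - P.1) := by linarith
    obtain ⟨t, ht⟩ : ∃ t, t = 1 / (ε * (T.1 - P.1)) := ⟨_, rfl⟩
    have htm : t * (ε * (T.1 - P.1)) = 1 := by rw [ht]; exact one_div_mul_cancel hpos.ne'
    have ht0 : 0 ≤ t := ht ▸ by positivity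
    have htx : t * (T.1 - P.1) = ε := by linear_combination ε * htm - t * (T.1 - P.1) * hε2
    have hX := convex_combo_mem hK.convex hP hT (t := t)
      (X := (P.1 + ε, P.2 + t * (T.2 - P.2))) ht0 (ht ▸ (div_le_one hpos).2 hcon)
      (by simp only; linarith) rfl
    have hY : (P.1 + ε, P.2) ∈ K := by
      refine mem_of_column hK.convex (y₁ := P.2 + -1) (y₃ := P.2 + t * (T.2 - P.2)) hd hX
        (by linarith) ?_
      have := mul_nonneg ht0 (sub_nonneg.2 hPT)
      linarith
    rcases hε with rfl | rfl
    · exact h1 (by convert hY using 1; ext <;> simp)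
    · exact h2 (by convert hY using 1; ext <;> simp)
  have hs1 := hside 1 (Or.inl rfl)
  have hs2 := hside (-1) (Or.inr rfl)
  refine ⟨abs_le.2 ⟨by linarith, by linarith⟩, abs_le.2 ⟨by linarith, ?_⟩⟩
  by_contra hcon
  push Not at hcon
  obtain ⟨z, hz⟩ : ∃ z, z = T.2 - P.2 := ⟨_, rfl⟩
  have hz3 : 3 < z := by linarith
  obtain ⟨t, ht⟩ : ∃ t, t = 2 / (z + 1) := ⟨_, rfl⟩
  have htm : t * (z + 1) = 2 := by rw [ht]; field_simp
  have ht0 : 0 < t := ht ▸ by positivity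
  have ht1 : t ≤ 1 / 2 := by
    rw [ht, div_le_div_iff₀ (by linarith) (by norm_num)]; linarith
  obtain ⟨y, hy⟩ : ∃ y, y = t * (T.1 - P.1) / (1 - t) := ⟨_, rfl⟩
  have hym : (1 - t) * y = t * (T.1 - P.1) := by
    rw [hy]; field_simp [show (1 - t) ≠ 0 by linarith]
  have hxa : |T.1 - P.1| ≤ 1 := abs_le.2 ⟨by linarith, by linarith⟩
  have hya : |y| ≤ 1 := by
    have h5 : (1 - t) * |y| = t * |T.1 - P.1| := by
      rw [← abs_of_pos ht0, ← abs_mul, ← hym, abs_mul, abs_of_pos ht0,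
        abs_of_pos (show 0 < 1 - t by linarith)]
    have h6 : t * |T.1 - P.1| ≤ t * 1 := by gcongr
    have h7 : (1 - t) * |y| ≤ (1 - t) * 1 := by linarith
    exact le_of_mul_le_mul_left h7 (by linarith)
  have hd := hball (-y) 1 (by norm_num) (by
    rw [abs_neg, neg_sq]
    have : y ^ 2 ≤ 1 := by rw [← sq_abs]; exact pow_le_one₀ (abs_nonneg y) hya
    linarith)
  refine h3 (convex_combo_mem hK.convex hd hT (t := t) ht0.le (by linarith) ?_ ?_)
  · simp only [Prod.fst_add]
    linarith
  · simp only [Prod.snd_add]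
    have : T.2 = P.2 + z := by rw [hz]; ring
    rw [this]
    linarith

namespace IsContour

/-- The tip of a spike and the rows beside its foot. -/
theorem spike_tip {K : Set (ℝ × ℝ)} {C : ℤ → ℤ × ℤ} {i : ℤ} (hC : IsContour (digital K) C)
    (h1 : C i = C (i - 1) + (0, 1)) (h2 : C (i + 1) = C (i - 1)) :
    pt (C i) + (1, 0) ∉ K ∧ pt (C i) + (-1, 0) ∉ K ∧ pt (C i) + (0, 1) ∉ K := by
  have h3 : C (i + 1) = C i + (0, -1) := by rw [h2, h1]; ext <;> simp
  have := hC.next_cases i h1 h3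
  simp [turnLeft, digital, pt] at this
  refine ⟨?_, ?_, ?_⟩
  · have := this.2.2
    simpa [pt] using this
  · have := this.1
    simpa [pt] using this
  · have := this.2.1
    simpa [pt] using this

/-- Before and after a spike, the contour follows the row at the foot of the spike. -/
theorem spike_rows {ρ ϱ : ℝ} (hρ : 200 ≤ ρ) {i J : ℤ} (hJ : (J : ℝ) ^ 2 + J + 5 ≤ 2 * ρ) :
    ∀ e : ℤ × ℤ, |e.1| + |e.2| = 1 → ∀ (K : Set (ℝ × ℝ)) (C : ℤ → ℤ × ℤ),
      IsContour (digital K) C → RoundBody K ρ ϱ → C i = C (i - 1) + e → C (i + 1) = C (i - 1) →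
      ∀ j, 0 ≤ j → j ≤ J →
        C (i + 1 + j) = ((C (i + 1)).1 + j * e.2, (C (i + 1)).2 - j * e.1) ∧
        C (i - 1 - j) = ((C (i + 1)).1 - j * e.2, (C (i + 1)).2 + j * e.1) := by
  refine unit_induction (e₀ := (0, 1)) (by simp) ?_ ?_
  · intro K C hC hK h1 h2
    obtain ⟨t1, t2, t3⟩ := hC.spike_tip h1 h2
    have hrowmem : ∀ j : ℤ, |j| ≤ J → C (i + 1) + (j, 0) ∈ digital K := by
      intro j hj
      have hjR : |(j : ℝ)| ≤ J := by exact_mod_cast hj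
      have hj2 : (j : ℝ) ^ 2 ≤ (J : ℝ) ^ 2 := by
        rw [← sq_abs]
        have := abs_nonneg (j : ℝ)
        gcongr
      have := hK.tip_ball hρ (hC.mem i) t1 t2 t3 (x := j) (y := 1) (by norm_num) (by linarith)
      rw [h1, ← h2] at this
      simpa [digital, pt] using this
    have hrowtop : ∀ j : ℤ, j ≠ 0 → C (i + 1) + (j, 1) ∉ digital K := by
      intro j hj hmem
      have e : C i = C (i + 1) + (0, 1) := by rw [h1, h2]
      have hP := hC.mem i
      rw [e] at t1 t2 hP
      simp only [digital, pt, mem_ofPred_eq, Prod.fst_add, Prod.snd_add, Prod.mk_add_mk] at *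
      push_cast at *
      rcases lt_or_gt_of_ne hj with h | h
      · have : (j : ℝ) ≤ -1 := by
          have : j ≤ -1 := by omega
          exact_mod_cast this
        refine t2 (mem_of_row hK.convex (x₁ := (C (i + 1)).1 + j) (x₃ := (C (i + 1)).1 + 0)
          (by simpa using hmem) (by simpa using hP) ?_ ?_) <;> linarith
      · have : (1 : ℝ) ≤ j := by exact_mod_cast h
        refine t1 (mem_of_row hK.convex (x₃ := (C (i + 1)).1 + j) (x₁ := (C (i + 1)).1 + 0)
          (by simpa using hP) (by simpa using hmem) ?_ ?_) <;> linarith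
    have hforward : ∀ j, 0 ≤ j → j ≤ J → ∀ k, 0 ≤ k → k ≤ j →
        C (i + 1 + k) = C (i + 1) + (k, 0) := by
      intro j hj
      induction j, hj using Int.leInduction with
      | base =>
        intro _ k hk hk'
        obtain rfl : k = 0 := by omega
        simp
      | succ j hj ih =>
        intro hjJ k hk hkj
        rcases (show k ≤ j ∨ k = j + 1 by omega) with h | rfl
        · exact ih (by omega) k hk h
        have hnext := hrowmem (j + 1) (by rw [abs_of_nonneg (by omega)]; exact hjJ)
        have ihj := ih (by omega) j hj le_rfl
        have hX : C (i + 1 + j) + (1, 0) ∈ digital K := by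
          rw [ihj]
          simpa [add_assoc] using hnext
        have hgo : C (i + 1 + j + 1) = C (i + 1 + j) + (1, 0) := by
          rcases hj.eq_or_lt with rfl | hj0
          · have e1 : C (i + 1 + 0) = C (i + 1 + 0 - 1) + (0, -1) := by
              rw [add_zero, add_sub_cancel_right, h2, h1]; ext <;> simp
            rcases sub_eq_of_unit_step hC (i + 1 + 0) with h | h | h | h <;>
              have h4 := hC.next_cases (i + 1 + 0) e1 h <;> simp [turnLeft] at h4 hX h ⊢ <;> tauto
          · have e1 : C (i + 1 + j) = C (i + 1 + j - 1) + (1, 0) := by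
              rw [ihj, show i + 1 + j - 1 = i + 1 + (j - 1) by ring,
                ih (by omega) (j - 1) (by omega) (by omega)]
              ext <;> simp [add_assoc]
            have htop : C (i + 1 + j) + (0, 1) ∉ digital K := by
              rw [ihj]
              simpa [add_assoc] using hrowtop j hj0.ne'
            rcases sub_eq_of_unit_step hC (i + 1 + j) with h | h | h | h <;>
              have h4 := hC.next_cases (i + 1 + j) e1 h <;> simp [turnLeft] at h4 hX ⊢ <;> tauto
        rw [← add_assoc, hgo, ihj]
        ext <;> simp [add_assoc]
    have hbackward : ∀ j, 0 ≤ j → j ≤ J → ∀ k, 0 ≤ k → k ≤ j →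
        C (i - 1 - k) = C (i + 1) + (-k, 0) := by
      intro j hj
      induction j, hj using Int.leInduction with
      | base =>
        intro _ k hk hk'
        obtain rfl : k = 0 := by omega
        simp [h2]
      | succ j hj ih =>
        intro hjJ k hk hkj
        rcases (show k ≤ j ∨ k = j + 1 by omega) with h | rfl
        · exact ih (by omega) k hk h
        have hnext := hrowmem (-(j + 1)) (by rw [abs_neg, abs_of_nonneg (by omega)]; exact hjJ)
        have ihj := ih (by omega) j hj le_rfl
        have hX : C (i - 1 - j) + (-1, 0) ∈ digital K := by
          rw [ihj]
          simpa [add_assoc, add_comm] using hnext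
        have hgo : C (i - 1 - j) = C (i - 1 - j - 1) + (1, 0) := by
          have hprev := sub_eq_of_unit_step hC (i - 1 - j - 1)
          rw [sub_add_cancel] at hprev
          rcases hj.eq_or_lt with rfl | hj0
          · have e1 : C (i - 1 - 0 + 1) = C (i - 1 - 0) + (0, 1) := by
              rw [sub_zero, sub_add_cancel]; exact h1
            have hX' : C (i - 1 - 0) + (1, 0) ∈ digital K := by
              rw [ihj, show C (i + 1) + (-0, 0) + (1, 0) = C (i + 1) + (1, 0) by ext <;> simp]
              exact hrowmem 1 (by rw [abs_one]; omega)
            rcases hprev with h | h | h | h <;>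
              have h4 := hC.next_cases (i - 1 - 0) h e1 <;> simp [turnLeft] at h4 hX hX' h ⊢ <;>
              tauto
          · have e1 : C (i - 1 - j + 1) = C (i - 1 - j) + (1, 0) := by
              rw [ihj, show i - 1 - j + 1 = i - 1 - (j - 1) by ring,
                ih (by omega) (j - 1) (by omega) (by omega)]
              ext <;> simp [add_assoc]; ring
            have htop : C (i - 1 - j) + (0, 1) ∉ digital K := by
              rw [ihj]
              simpa [add_assoc] using hrowtop (-j) (by omega)
            have hmem := hC.mem (i - 1 - j - 1)
            rcases hprev with h | h | h | h <;>
              have h4 := hC.next_cases (i - 1 - j) h e1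
            · exact h
            · simp [turnLeft] at h4 hX; tauto
            · simp [turnLeft] at h4 hX; tauto
            · rw [show C (i - 1 - j - 1) = C (i - 1 - j) + (0, 1) by
                rw [h]; ext <;> simp [add_assoc]] at hmem
              exact absurd hmem htop
        rw [show i - 1 - (j + 1) = i - 1 - j - 1 by ring]
        rw [ihj] at hgo
        rw [eq_sub_of_add_eq hgo.symm]
        ext <;> simp; ring
    intro j hj hjJ
    rw [hforward j hj hjJ j hj le_rfl, hbackward j hj hjJ j hj le_rfl]
    constructor <;> ext <;> simp [sub_eq_add_neg]
  · intro e ih K C hC hK h1 h2 j hj hjJ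
    have := ih _ _ hC.turn_digital hK.turn (neg_turnLeft_eq_add_iff.2 h1) (by rw [h2]) j hj hjJ
    simp only [Prod.ext_iff, Prod.fst_neg, Prod.snd_neg, turnLeft_fst, turnLeft_snd,
      neg_neg] at this ⊢
    obtain ⟨⟨a1, a2⟩, a3, a4⟩ := this
    refine ⟨⟨?_, ?_⟩, ?_, ?_⟩ <;> linarith

end IsContour

namespace IsContour

theorem abs_sub_le {Γ : Set (ℤ × ℤ)} {C : ℤ → ℤ × ℤ} (hC : IsContour Γ C) {i j : ℤ} (hij : i ≤ j) :
    |(C j).1 - (C i).1| ≤ j - i ∧ |(C j).2 - (C i).2| ≤ j - i := by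
  induction j, hij using Int.leInduction with
  | base => simp
  | succ k hk ih =>
    rw [abs_le, abs_le] at ih ⊢
    rcases sub_eq_of_unit_step hC k with h | h | h | h <;> rw [h] <;>
      simp only [Prod.fst_add, Prod.snd_add] <;> omega

variable {K : Set (ℝ × ℝ)} {C : ℤ → ℤ × ℤ} {m n i : ℤ} {ρ ϱ : ℝ}

/-- A digital straight segment does not contain two points on each side of the tip of a spike. -/
theorem not_spike_of_dss (hC : IsContour (digital K) C) (hK : RoundBody K ρ ϱ) (hρ : 200 ≤ ρ)
    {a b μ : ℤ} (hline : ∀ i, m ≤ i → i ≤ n → C i ∈ standardLine a b μ) (hm : m + 2 ≤ i)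
    (hn : i + 2 ≤ n) : C (i + 1) ≠ C (i - 1) := by
  intro h
  obtain ⟨e, he⟩ : ∃ e, e = C i - C (i - 1) := ⟨_, rfl⟩
  have he1 : |e.1| + |e.2| = 1 := by
    have := hC.unit_step (i - 1)
    rwa [sub_add_cancel, ← he] at this
  have hi : C i = C (i - 1) + e := by rw [he]; abel
  obtain ⟨r1, r2⟩ := spike_rows hρ (i := i) (J := 1) (by norm_num; linarith) e he1 K C hC hK hi h 1
    (by norm_num) le_rfl
  have l1 := hline (i + 1 + 1) (by omega) (by omega)
  have l2 := hline (i - 1 - 1) (by omega) (by omega)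
  have l3 := hline i (by omega) (by omega)
  rw [r1] at l1
  rw [r2] at l2
  rw [hi, ← h] at l3
  simp only [standardLine, mem_ofPred_eq, Prod.fst_add, Prod.snd_add] at l1 l2 l3
  have hA := abs_cases a
  have hB := abs_cases b
  rcases eq_of_unit he1 with rfl | rfl | rfl | rfl <;> simp only [mul_add, mul_sub, mul_one,
    mul_zero, mul_neg] at l1 l2 l3 <;>
    rcases hA with ⟨hA, _⟩ | ⟨hA, _⟩ <;> rcases hB with ⟨hB, _⟩ | ⟨hB, _⟩ <;>
    rw [hA, hB] at l1 l2 l3 <;> linarith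

theorem fst_le_of_forall_step {C : ℤ → ℤ × ℤ} {m n : ℤ} {e : ℤ × ℤ} (h1 : 0 ≤ e.1)
    (h2 : e.2 ≤ 0)
    (h : ∀ i, m ≤ i → i < n → C (i + 1) = C i + e ∨ C (i + 1) = C i + turnLeft e) {i j : ℤ}
    (hi : m ≤ i) (hij : i ≤ j) (hj : j ≤ n) : (C i).1 ≤ (C j).1 := by
  induction j, hij using Int.leInduction with
  | base => rfl
  | succ k hk ih =>
    have := ih (by omega)
    rcases h k (by omega) (by omega) with e | e <;> rw [e] <;> simp <;> omega

/-- Around a vertical spike, the part of a maximal segment beside it is a stair; hence it is not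
longer than `O(√ϱ)`, and it runs to the right. -/
theorem spike_part (hC : IsContour (digital K) C) (hK : RoundBody K ρ ϱ) (hρ : 200 ≤ ρ)
    (hρϱ : ρ ≤ ϱ) {a b μ : ℤ} (hline : ∀ i, m ≤ i → i ≤ n → C i ∈ standardLine a b μ)
    {p q : ℤ} (hp : m + 1 ≤ p) (hq : q + 1 ≤ n) {j : ℤ} (hj : p ≤ j) (hj2 : j + 2 ≤ q)
    {e : ℤ × ℤ} (h1 : C (j + 1) = C j + e) (h2 : C (j + 2) = C (j + 1) + turnLeft e)
    (he : |e.1| + |e.2| = 1) (he1 : 0 ≤ e.1) (he2 : e.2 ≤ 0) :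
    (q - p : ℝ) ^ 2 ≤ 2400 * ϱ ∧ ∀ i i', p ≤ i → i ≤ i' → i' ≤ q → (C i).1 ≤ (C i').1 := by
  have hline' : ∀ i, p ≤ i → i ≤ q → C i ∈ standardLine a b μ :=
    fun i h1 h2 => hline i (by omega) (by omega)
  have hbend : ∀ d : ℤ × ℤ, ∃ i, p ≤ i ∧ i < q ∧ C (i + 1) ≠ C i + d := by
    intro d
    by_cases hd : d = e
    · refine ⟨j + 1, by omega, by omega, ?_⟩
      rw [show j + 1 + 1 = j + 2 by ring, h2, hd]
      intro h
      have := add_left_cancel h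
      rcases eq_of_unit he with rfl | rfl | rfl | rfl <;> simp [turnLeft] at this
    · refine ⟨j, hj, by omega, ?_⟩
      rw [h1]
      exact fun h => hd (add_left_cancel h).symm
  obtain ⟨g, hg, hsteps⟩ := hC.exists_direction hline'
    (fun i h1 h2 => hC.not_spike_of_dss hK hρ hline (by omega) (by omega)) hbend
  have hge : g = e := by
    have s1 := hsteps j hj (by omega)
    have s2 := hsteps (j + 1) (by omega) (by omega)
    rw [h1] at s1
    rw [show j + 1 + 1 = j + 2 by ring, h2] at s2
    have s1' := s1.imp add_left_cancel add_left_cancel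
    have s2' := s2.imp add_left_cancel add_left_cancel
    rcases eq_of_unit he with rfl | rfl | rfl | rfl <;>
      rcases eq_of_unit hg with rfl | rfl | rfl | rfl <;> simp [turnLeft] at s1' s2' ⊢
  subst hge
  exact ⟨sq_length_le hρ hρϱ (by omega) g hg K C a b μ hC hK hsteps hbend hline',
    fun i i' h1 h2 h3 => fst_le_of_forall_step he1 he2 hsteps h1 h2 h3⟩

/-- Witnesses for maximal segments that contain the tip of a spike in their interior. -/
theorem exists_witness_of_spike (hρ : 200 ≤ ρ) (hρϱ : ρ ≤ ϱ) (hmi : m < i) (hin : i < n) :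
    ∀ e : ℤ × ℤ, |e.1| + |e.2| = 1 → ∀ (K : Set (ℝ × ℝ)) (C : ℤ → ℤ × ℤ) (a b μ : ℤ),
      IsContour (digital K) C → RoundBody K ρ ϱ → IsMaximalSegment C m n →
      (∀ i, m ≤ i → i ≤ n → C i ∈ standardLine a b μ) →
      C i = C (i - 1) + e → C (i + 1) = C (i - 1) →
      ∃ ℓ u w, SegmentWitness K (C m) (C n) a b ρ ϱ ℓ u w := by
  refine unit_induction (e₀ := (0, 1)) (by simp) ?_ ?_
  · intro K C a b μ hC hK hmax hline h1 h2
    obtain ⟨t1, t2, t3⟩ := hC.spike_tip h1 h2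
    -- by roundness, the row at the foot of the spike has about `√ρ` points on each side
    have hρ14 : 14 ≤ √ρ := Real.le_sqrt_of_sq_le (by linarith)
    have hρs : √ρ * √ρ = ρ := Real.mul_self_sqrt (by linarith)
    have hϱs : √ϱ * √ϱ = ϱ := Real.mul_self_sqrt (by linarith)
    have hle : √ρ ≤ √ϱ := Real.sqrt_le_sqrt hρϱ
    obtain ⟨J, hJ⟩ : ∃ J : ℤ, J = ⌊√ρ⌋ := ⟨_, rfl⟩
    have hJ1 : (J : ℝ) ≤ √ρ := by rw [hJ]; exact Int.floor_le _
    have hJ2 : √ρ < J + 1 := by rw [hJ]; exact Int.lt_floor_add_one _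
    have hJ14 : 14 ≤ J := by rw [hJ]; exact Int.le_floor.2 (by exact_mod_cast hρ14)
    have hJsq : (J : ℝ) ^ 2 + J + 5 ≤ 2 * ρ := by
      have e1 : (J : ℝ) ^ 2 ≤ √ρ ^ 2 := by
        have : (0 : ℝ) ≤ J := by exact_mod_cast (by omega : 0 ≤ J)
        gcongr
      have e2 : 14 * √ρ ≤ √ρ * √ρ := mul_le_mul_of_nonneg_right hρ14 (by positivity)
      rw [sq √ρ, hρs] at e1
      linarith
    have hrows := spike_rows hρ hJsq (0, 1) (by simp) K C hC hK h1 h2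
    simp only [mul_one, mul_zero, sub_zero, add_zero] at hrows
    have hi : C i = C (i + 1) + (0, 1) := by rw [h1, h2]
    -- the segment extends over one of the two rows
    have hside : m ≤ i - 2 → i + 2 ≤ n → False := fun hm hn =>
      hC.not_spike_of_dss hK hρ hline (by omega) hn h2
    have key : m = i - 1 ∧ i + 1 + J ≤ n ∨ n = i + 1 ∧ m ≤ i - 1 - J := by
      by_cases hm : m = i - 1
      · left
        refine ⟨hm, ?_⟩
        by_contra hcon
        obtain ⟨a', b', μ', hl1, hl2⟩ := exists_standardLine_corner (d := (1, 0)) (by simp)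
          (N := J) (by omega) (Or.inl rfl) (C (i + 1))
        have hall : ∀ l, m ≤ l → l ≤ n + 1 → C l ∈ standardLine a' b' μ' := by
          intro l hl hl'
          rcases (show l = i - 1 ∨ l = i ∨ i + 1 ≤ l by omega) with rfl | rfl | h
          · rw [← h2]; simpa using hl1 0 le_rfl (by omega)
          · rw [hi]
            convert hl2 using 1
            ext <;> simp
          · have := (hrows (l - (i + 1)) (by omega) (by omega)).1
            rw [show i + 1 + (l - (i + 1)) = l by ring] at this
            rw [this]
            simpa using hl1 (l - (i + 1)) (by omega) (by omega)
        exact hmax.not_next (fun l h1 h2 => hall l h1 (by omega)) (hall _ (by omega) le_rfl)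
      · right
        have hn : n = i + 1 := by
          by_contra h
          exact hside (by omega) (by omega)
        refine ⟨hn, ?_⟩
        by_contra hcon
        obtain ⟨a', b', μ', hl1, hl2⟩ := exists_standardLine_corner (d := (-1, 0)) (by simp)
          (N := J) (by omega) (Or.inr rfl) (C (i + 1))
        have hall : ∀ l, m - 1 ≤ l → l ≤ n → C l ∈ standardLine a' b' μ' := by
          intro l hl hl'
          rcases (show l = i + 1 ∨ l = i ∨ l ≤ i - 1 by omega) with rfl | rfl | h
          · simpa using hl1 0 le_rfl (by omega)
          · rw [hi]
            convert hl2 using 1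
            ext <;> simp
          · have := (hrows (i - 1 - l) (by omega) (by omega)).2
            rw [show i - 1 - (i - 1 - l) = l by ring] at this
            rw [this]
            have := hl1 (i - 1 - l) (by omega) (by omega)
            simpa [sub_eq_add_neg] using this
        exact hmax.not_prev (fun l h1 h2 => hall l (by omega) h2) (hall _ le_rfl (by omega))
    -- hence the slope is `O(1 / √ρ)`
    have hslope : |(a : ℝ)| * (J - 1) ≤ |(b : ℝ)| := by
      have hq := hline (i + 1) (by omega) (by omega)
      have hfar : |a * J| < |a| + |b| := by
        rcases key with ⟨_, h⟩ | ⟨_, h⟩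
        · have := hline (i + 1 + J) (by omega) h
          rw [(hrows J (by omega) le_rfl).1] at this
          simp only [standardLine, mem_ofPred_eq, mul_add] at this hq
          rw [abs_lt]
          constructor <;> linarith
        · have := hline (i - 1 - J) h (by omega)
          rw [(hrows J (by omega) le_rfl).2] at this
          simp only [standardLine, mem_ofPred_eq, mul_sub] at this hq
          rw [abs_lt]
          constructor <;> linarith
      rw [abs_mul, abs_of_nonneg (by omega : 0 ≤ J)] at hfar
      have : |a| * (J - 1) ≤ |b| := by linarith
      exact_mod_cast this
    obtain ⟨hlen, hfst⟩ : (n - m - 2 : ℝ) ^ 2 ≤ 2400 * ϱ ∧ (C m).1 ≤ (C n).1 := by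
      have hc0 : C i = C (i - 1) + (0, 1) := h1
      rcases key with ⟨hm, hn⟩ | ⟨hn, hm⟩
      · have g1 : C (i + 1) = C i + (0, -1) := by rw [hi]; ext <;> simp
        have g2 : C (i + 2) = C (i + 1) + turnLeft (0, -1) := by
          have := (hrows 1 (by omega) (by omega)).1
          rw [show i + 1 + 1 = i + 2 by ring] at this
          rw [this]; ext <;> simp [turnLeft]
        obtain ⟨s1, s2⟩ := hC.spike_part hK hρ hρϱ hline (p := i) (q := n - 1) (by omega)
          (by omega) (j := i) le_rfl (by omega) g1 g2 (by simp) (by simp) (by simp)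
        constructor
        · have e : (n : ℝ) - m - 2 = ((n - 1 : ℤ) : ℝ) - i := by rw [hm]; push_cast; ring
          rw [e]; exact s1
        · have s3 := s2 (i + 1 + (J - 1)) (n - 1) (by omega) (by omega) le_rfl
          rw [(hrows (J - 1) (by omega) (by omega)).1] at s3
          have s4 := (hC.abs_sub_le (i := n - 1) (j := n) (by omega)).1
          rw [abs_le] at s4
          rw [hm, ← h2]
          simp only at s3
          omega
      · have g1 : C (i - 2 + 1) = C (i - 2) + (1, 0) := by
          have := (hrows 1 (by omega) (by omega)).2
          rw [show i - 1 - 1 = i - 2 by ring] at this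
          rw [this, show i - 2 + 1 = i - 1 by ring, ← h2]; ext <;> simp
        have g2 : C (i - 2 + 2) = C (i - 2 + 1) + turnLeft (1, 0) := by
          rw [show i - 2 + 1 = i - 1 by ring, sub_add_cancel, h1]
          rfl
        obtain ⟨s1, s2⟩ := hC.spike_part hK hρ hρϱ hline (p := m + 1) (q := i) (by omega)
          (by omega) (j := i - 2) (by omega) (by omega) g1 g2 (by simp) (by simp) (by simp)
        constructor
        · have e : (n : ℝ) - m - 2 = i - ((m + 1 : ℤ) : ℝ) := by rw [hn]; push_cast; ring
          rw [e]; exact s1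
        · have s3 := s2 (m + 1) (i - 1 - (J - 1)) le_rfl (by omega) (by omega)
          rw [(hrows (J - 1) (by omega) (by omega)).2] at s3
          have s4 := (hC.abs_sub_le (i := m) (j := m + 1) (by omega)).1
          rw [abs_le] at s4
          rw [hn]
          simp only at s3
          omega
    have hlen' : (n - m : ℝ) ≤ 52 * √ϱ := by
      have e1 : (n - m - 2 : ℝ) ≤ 50 * √ϱ := by
        refine (abs_le_of_sq_le_sq' (b := 50 * √ϱ) ?_ (by positivity)).2
        rw [mul_pow, sq √ϱ, hϱs]; linarith
      linarith
    have hdist : ∀ l, m ≤ l → l ≤ n → |((C l).1 : ℝ) - (C m).1| ≤ 52 * √ϱ ∧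
        |((C l).2 : ℝ) - (C m).2| ≤ 52 * √ϱ := by
      intro l hl hln
      obtain ⟨d1, d2⟩ := hC.abs_sub_le hl
      have d1R : |((C l).1 : ℝ) - (C m).1| ≤ l - m := by exact_mod_cast d1
      have d2R : |((C l).2 : ℝ) - (C m).2| ≤ l - m := by exact_mod_cast d2
      have : (l : ℝ) ≤ n := by exact_mod_cast hln
      exact ⟨by linarith, by linarith⟩
    -- the outward direction is that of the spike, and the short vector is that of the row
    refine ⟨√ϱ, (0, 1), (1, 0), ⟨by linarith, by norm_num, by simp, ?_, ?_, ?_, ?_, ?_, ?_⟩⟩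
    · simp only [Int.cast_one, Int.cast_zero, abs_one, abs_zero]
      rw [sq, hϱs]; linarith
    · simp
    · intro T hT hTmax
      have hT2 := hTmax _ (hC.mem i)
      simp only [pt_fst, pt_snd, zero_mul, one_mul, zero_add] at hT2
      obtain ⟨p1, p2⟩ := hK.tip_support hρ (hC.mem i) t1 t2 t3 hT (by simpa using hT2)
      obtain ⟨q1, q2⟩ := hdist i hmi.le hin.le
      simp only [pt_fst, pt_snd] at p1 p2
      have r1 := _root_.abs_sub_le T.1 ((C i).1 : ℝ) ((C m).1 : ℝ)
      have r2 := _root_.abs_sub_le T.2 ((C i).2 : ℝ) ((C m).2 : ℝ)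
      constructor <;> linarith
    · obtain ⟨q1, q2⟩ := hdist n (by omega) le_rfl
      have : (0 : ℝ) ≤ √ϱ := Real.sqrt_nonneg _
      constructor <;> linarith
    · simp only [mul_zero, mul_one, zero_add]
      have e1 : |(a : ℝ)| * √ρ ≤ 2 * |(b : ℝ)| := by
        have : |(a : ℝ)| * √ρ ≤ |(a : ℝ)| * (2 * (J - 1)) := by
          gcongr; linarith
        linarith
      have e2 : |(a : ℝ)| * √ρ * √ρ ≤ 2 * |(b : ℝ)| * √ϱ := by gcongr
      rw [mul_assoc, hρs] at e2
      have e3 : 0 ≤ √ϱ * |(a : ℝ)| := by positivity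
      have e4 : 0 ≤ √ϱ * |(b : ℝ)| := by positivity
      linarith
    · intro c hc hcPQ
      simp only [digitalAbscissa] at hcPQ
      rcases eq_of_unit hc with rfl | rfl | rfl | rfl <;> simp at hcPQ ⊢
      omega
  · intro e ih K C a b μ hC hK hmax hline h1 h2
    obtain ⟨ℓ, u, w, h⟩ := ih _ _ (-b) a μ hC.turn_digital hK.turn hmax.turn
      (fun i h1 h2 => mem_standardLine_turn.2 (hline i h1 h2)) (neg_turnLeft_eq_add_iff.2 h1)
      (by rw [h2])
    exact ⟨ℓ, _, _, h.turn⟩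

/-- Every maximal segment has a witness. -/
theorem exists_witness (hC : IsContour (digital K) C) (hK : RoundBody K ρ ϱ) (hρ : 200 ≤ ρ)
    (hρϱ : ρ ≤ ϱ) (hmax : IsMaximalSegment C m n) {a b μ : ℤ}
    (hline : ∀ i, m ≤ i → i ≤ n → C i ∈ standardLine a b μ) :
    ∃ ℓ u w, SegmentWitness K (C m) (C n) a b ρ ϱ ℓ u w := by
  by_cases hturn : ∃ i, m < i ∧ i < n ∧ C (i + 1) = C (i - 1)
  · obtain ⟨i, h1, h2, h3⟩ := hturn
    have hu := hC.unit_step (i - 1)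
    rw [sub_add_cancel] at hu
    exact exists_witness_of_spike hρ hρϱ h1 h2 _ hu K C a b μ hC hK hmax hline (by abel) h3
  · push Not at hturn
    have hbend := fun d => hC.exists_corner hmax d
    obtain ⟨e, he, hsteps⟩ := hC.exists_direction hline hturn hbend
    have hmn : m + 2 ≤ n := by
      obtain ⟨i, h1, h2, h3⟩ := hbend (C (m + 1) - C m)
      by_contra hcon
      obtain rfl : i = m := by omega
      exact h3 (by abel)
    exact exists_witness_of_direction hρ hρϱ hmn e he K C a b μ hC hK hmax hsteps hline

end IsContour

/-! ### Pointwise error of the estimates -/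

/-- Two unit normals, given in an orthonormal frame as `(α, β)` and `(α', β')`, at boundary points
with difference `(x, y)`: if balls of radius `r` roll inside, they are close as soon as `x` is
small. -/
theorem normals_close {α β α' β' x y N r E : ℝ} (hr : 0 < r) (hn : α ^ 2 + β ^ 2 = 1)
    (hn' : α' ^ 2 + β' ^ 2 = 1) (hβ : 0 ≤ β) (hβ2 : 1 ≤ 2 * β ^ 2) (hβ' : 0 ≤ β') (hx : |x| ≤ N)
    (hN : 32 * N ≤ r) (hE : E = (α - α') ^ 2 + (β - β') ^ 2)
    (h1 : α' * x + β' * y ≤ -(r / 2) * E) (h2 : r / 2 * E ≤ α * x + β * y) :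
    E ≤ (4 * N / r) ^ 2 := by
  have hN0 : 0 ≤ N := (abs_nonneg x).trans hx
  have hE0 : 0 ≤ E := by rw [hE]; positivity
  have hβ7 : 7 / 10 ≤ β := by
    by_contra hcon
    push Not at hcon
    have : β * β ≤ 7 / 10 * (7 / 10) := mul_self_le_mul_self hβ hcon.le
    linarith
  have hα : |α| ≤ β := abs_le_of_sq_le_sq (by linarith) hβ
  have hα' : |α'| ≤ 1 := abs_le_of_sq_le_sq (by linarith [sq_nonneg β']) zero_le_one
  have hax : ∀ z w : ℝ, 0 ≤ w → |z| ≤ w → |z * x| ≤ w * N := by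
    intro z w hw hz
    rw [abs_mul]
    exact mul_le_mul hz hx (abs_nonneg x) hw
  have hrE : 0 ≤ r * E := by positivity
  have hylow : -N ≤ y := by
    have e1 := (abs_le.1 (hax α β hβ hα)).2
    have e2 : β * -N ≤ β * y := by linarith
    exact le_of_mul_le_mul_left e2 (by linarith)
  have hα'x := abs_le.1 (hax α' 1 zero_le_one hα')
  have hyup : y ≤ 3 * N := by
    by_contra hcon
    push Not at hcon
    have hy0 : 0 ≤ y := by linarith
    have e1 : 0 ≤ β' * y := mul_nonneg hβ' hy0
    have e2 : E ≤ (1 / 4) ^ 2 := by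
      have : r * E ≤ r * (1 / 4) ^ 2 := by linarith
      exact le_of_mul_le_mul_left this hr
    have e3 : (β - β') ^ 2 ≤ (1 / 4) ^ 2 := by linarith [sq_nonneg (α - α')]
    have e4 := (abs_le_of_sq_le_sq' e3 (by norm_num)).2
    have e5 : 4 / 10 * y ≤ β' * y := mul_le_mul_of_nonneg_right (by linarith) hy0
    linarith
  have hΔ : x ^ 2 + y ^ 2 ≤ (4 * N) ^ 2 := by
    have e1 : x ^ 2 ≤ N ^ 2 := by rw [← sq_abs]; gcongr
    have e2 : y ^ 2 ≤ (3 * N) ^ 2 := sq_le_sq' (by linarith) hyup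
    have e3 : 0 ≤ N ^ 2 := by positivity
    linarith
  have hCS : (r * E) ^ 2 ≤ E * (x ^ 2 + y ^ 2) := by
    have e1 : r * E ≤ (α - α') * x + (β - β') * y := by linarith
    have e2 : (r * E) ^ 2 ≤ ((α - α') * x + (β - β') * y) ^ 2 := by gcongr
    have e3 : ((α - α') * x + (β - β') * y) ^ 2 + ((α - α') * y - (β - β') * x) ^ 2
        = E * (x ^ 2 + y ^ 2) := by rw [hE]; ring
    linarith [sq_nonneg ((α - α') * y - (β - β') * x)]
  rcases hE0.eq_or_lt with h0 | h0
  · rw [← h0]; positivity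
  · have e1 : E * (r ^ 2 * E) ≤ E * (4 * N) ^ 2 := by
      have := mul_le_mul_of_nonneg_left hΔ hE0
      linarith
    have e2 := le_of_mul_le_mul_left e1 h0
    rw [div_pow, le_div_iff₀ (by positivity)]
    linarith

theorem angleError_le_sin (α β : ℝ) :
    angleError α β ≤ Real.pi / 2 * |Real.sin (α - β)| := by
  have hπ := Real.pi_pos
  unfold angleError
  obtain ⟨k, hk⟩ : ∃ k : ℤ, k = round ((α - β) / Real.pi) := ⟨_, rfl⟩
  rw [← hk]
  have h1 : |α - β - k * Real.pi| ≤ Real.pi / 2 := by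
    have := abs_sub_round ((α - β) / Real.pi)
    rw [← hk] at this
    have e : α - β - k * Real.pi = ((α - β) / Real.pi - k) * Real.pi := by field_simp
    rw [e, abs_mul, abs_of_pos hπ]
    have := mul_le_mul_of_nonneg_right this hπ.le
    linarith
  have h2 := Real.mul_abs_le_abs_sin h1
  rw [Real.sin_sub_int_mul_pi, abs_mul, abs_zpow, abs_neg, abs_one, one_zpow, one_mul] at h2
  calc |α - β - k * Real.pi| = Real.pi / 2 * (2 / Real.pi * |α - β - k * Real.pi|) := by
        field_simp
    _ ≤ _ := by gcongr

theorem IsBoundaryParam.cos_sin_tangentAngle {S : Set (ℝ × ℝ)} {γ : ℝ → ℝ × ℝ} {L : ℝ}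
    (h : IsBoundaryParam S γ L) (s : ℝ) :
    Real.cos (tangentAngle γ s) = (deriv γ s).1 ∧ Real.sin (tangentAngle γ s) = (deriv γ s).2 := by
  have hn : ‖(⟨(deriv γ s).1, (deriv γ s).2⟩ : ℂ)‖ = 1 := by
    rw [Complex.norm_def, Complex.normSq_mk, ← sq, ← sq, h.unit_speed, Real.sqrt_one]
  have hne : (⟨(deriv γ s).1, (deriv γ s).2⟩ : ℂ) ≠ 0 := by
    intro h0
    rw [h0] at hn
    simp at hn
  refine ⟨?_, ?_⟩
  · rw [tangentAngle, Complex.cos_arg hne, hn, div_one]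
  · rw [tangentAngle, Complex.sin_arg, hn, div_one]

theorem abs_mul_add_mul_le {a b x y N : ℝ} (hx : |x| ≤ N) (hy : |y| ≤ N) :
    |a * x + b * y| ≤ (|a| + |b|) * N := by
  have h1 := mul_le_mul_of_nonneg_left hx (abs_nonneg a)
  have h2 := mul_le_mul_of_nonneg_left hy (abs_nonneg b)
  have h3 := abs_add_le (a * x) (b * y)
  rw [abs_mul, abs_mul] at h3
  linarith

/-- Normals at points over almost the same abscissa. -/
theorem IsBoundaryParam.deriv_sub_le {S : Set (ℝ × ℝ)} {γ : ℝ → ℝ × ℝ} {L r R : ℝ}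
    (h : IsBoundaryParam S γ L) (hS : IsShape S) (hr : 0 < r) (hrol : IsRolling S γ r R)
    {s t : ℝ} {k₁ k₂ N : ℝ} (hk : k₁ ^ 2 + k₂ ^ 2 = 1)
    (hs : k₁ * (deriv γ s).1 + k₂ * (deriv γ s).2 ≤ 0)
    (hs2 : 1 ≤ 2 * (k₁ * (deriv γ s).1 + k₂ * (deriv γ s).2) ^ 2)
    (ht : k₁ * (deriv γ t).1 + k₂ * (deriv γ t).2 ≤ 0)
    (hN : |k₁ * ((γ s).1 - (γ t).1) + k₂ * ((γ s).2 - (γ t).2)| ≤ N) (hNr : 32 * N ≤ r) :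
    ((deriv γ s).1 - (deriv γ t).1) ^ 2 + ((deriv γ s).2 - (deriv γ t).2) ^ 2
      ≤ (4 * N / r) ^ 2 := by
  have hu := h.unit_speed s
  have hv := h.unit_speed t
  -- the balls touching the boundary from inside at one point are on the inner side of the tangent
  -- at the other point
  have key : ∀ s t : ℝ, (deriv γ t).2 * ((γ s).1 - (γ t).1) - (deriv γ t).1 * ((γ s).2 - (γ t).2)
      ≤ -(r / 2) * (((deriv γ s).1 - (deriv γ t).1) ^ 2
        + ((deriv γ s).2 - (deriv γ t).2) ^ 2) := by
    intro s t
    have hu := h.unit_speed s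
    have hv := h.unit_speed t
    have hmem := hrol.inner s (-(r * (deriv γ s).2) + r * (deriv γ t).2,
      r * (deriv γ s).1 - r * (deriv γ t).1) (by
        simp only [inward]
        refine le_of_eq ?_
        linear_combination r ^ 2 * hv - r ^ 2 * hu)
    have := h.inward_nonneg hS t hmem
    simp only [inward, Prod.fst_sub, Prod.snd_sub, Prod.fst_add, Prod.snd_add] at this
    have e : -(r / 2) * (((deriv γ s).1 - (deriv γ t).1) ^ 2
        + ((deriv γ s).2 - (deriv γ t).2) ^ 2)
        = r * ((deriv γ s).1 * (deriv γ t).1 + (deriv γ s).2 * (deriv γ t).2) - r := by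
      linear_combination (-(r / 2)) * hu - (r / 2) * hv
    have e2 : r * ((deriv γ t).1 ^ 2 + (deriv γ t).2 ^ 2) = r := by rw [hv, mul_one]
    rw [e]
    linarith
  have k1 := key s t
  have k2 := key t s
  refine normals_close hr (α := k₁ * (deriv γ s).2 - k₂ * (deriv γ s).1)
    (β := -(k₁ * (deriv γ s).1 + k₂ * (deriv γ s).2))
    (α' := k₁ * (deriv γ t).2 - k₂ * (deriv γ t).1)
    (β' := -(k₁ * (deriv γ t).1 + k₂ * (deriv γ t).2))
    (x := k₁ * ((γ s).1 - (γ t).1) + k₂ * ((γ s).2 - (γ t).2))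
    (y := -k₂ * ((γ s).1 - (γ t).1) + k₁ * ((γ s).2 - (γ t).2))
    ?_ ?_ ?_ ?_ ?_ hN hNr ?_ ?_ ?_
  · linear_combination ((deriv γ s).1 ^ 2 + (deriv γ s).2 ^ 2) * hk + hu
  · linear_combination ((deriv γ t).1 ^ 2 + (deriv γ t).2 ^ 2) * hk + hv
  · linarith
  · rw [neg_sq]; exact hs2
  · linarith
  · linear_combination -(((deriv γ s).1 - (deriv γ t).1) ^ 2
      + ((deriv γ s).2 - (deriv γ t).2) ^ 2) * hk
  · refine le_trans (le_of_eq ?_) k1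
    linear_combination ((deriv γ t).2 * ((γ s).1 - (γ t).1)
      - (deriv γ t).1 * ((γ s).2 - (γ t).2)) * hk
  · have e : (k₁ * (deriv γ s).2 - k₂ * (deriv γ s).1)
        * (k₁ * ((γ s).1 - (γ t).1) + k₂ * ((γ s).2 - (γ t).2))
        + -(k₁ * (deriv γ s).1 + k₂ * (deriv γ s).2)
        * (-k₂ * ((γ s).1 - (γ t).1) + k₁ * ((γ s).2 - (γ t).2))
        = (deriv γ s).2 * ((γ s).1 - (γ t).1) - (deriv γ s).1 * ((γ s).2 - (γ t).2) := by
      linear_combination ((deriv γ s).2 * ((γ s).1 - (γ t).1)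
        - (deriv γ s).1 * ((γ s).2 - (γ t).2)) * hk
    rw [e]
    linarith

/-- A unit vector makes an angle of at most `π / 4` with its octant axis. -/
theorem IsOctantAxis.bounds {v : ℝ × ℝ} {c : ℤ × ℤ} (hc : IsOctantAxis v c)
    (hv : v.1 ^ 2 + v.2 ^ 2 = 1) :
    0 ≤ c.1 * v.1 + c.2 * v.2 ∧ 1 ≤ 2 * (c.1 * v.1 + c.2 * v.2) ^ 2 := by
  have h1 := hc.2 (1, 0) (by simp)
  have h2 := hc.2 (-1, 0) (by simp)
  have h3 := hc.2 (0, 1) (by simp)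
  have h4 := hc.2 (0, -1) (by simp)
  simp only [Int.cast_one, Int.cast_zero, Int.cast_neg, one_mul, zero_mul, zero_add, add_zero,
    neg_mul] at h1 h2 h3 h4
  have h0 : 0 ≤ c.1 * v.1 + c.2 * v.2 := by linarith
  have e1 : v.1 ^ 2 ≤ (c.1 * v.1 + c.2 * v.2) ^ 2 := sq_le_sq' (by linarith) h1
  have e2 : v.2 ^ 2 ≤ (c.1 * v.1 + c.2 * v.2) ^ 2 := sq_le_sq' (by linarith) h3
  exact ⟨h0, by linarith⟩

theorem one_le_abs_add_abs {w : ℤ × ℤ} (hw : w ≠ 0) : 1 ≤ |(w.1 : ℝ)| + |(w.2 : ℝ)| := by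
  have : 1 ≤ |w.1| + |w.2| := by
    by_contra hcon
    have h1 := abs_nonneg w.1
    have h2 := abs_nonneg w.2
    exact hw (Prod.ext (abs_eq_zero.1 (by omega)) (abs_eq_zero.1 (by omega)))
  exact_mod_cast this

/-- **Pointwise estimate.** An estimate with a large error is only possible at points where the
tangent is almost parallel to a short integer vector `w`. -/
theorem IsShape.exists_pointwise_bound {S : Set (ℝ × ℝ)} (hS : IsShape S) :
    ∃ c h₀ : ℝ, 0 < c ∧ 0 < h₀ ∧ ∀ h, 0 < h → h < h₀ → ∀ (γ : ℝ → ℝ × ℝ) (L s : ℝ),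
      IsBoundaryParam S γ L → ∀ α ∈ estimates maximalSegmentEstimator S h γ s,
      ∃ (l : ℝ) (w : ℤ × ℤ), 0 < l ∧ w ≠ 0 ∧ angleError α (tangentAngle γ s) ≤ c * l ∧
        (|(w.1 : ℝ)| + |(w.2 : ℝ)|) * l ^ 2 ≤ c * h ∧
        |w.1 * (deriv γ s).2 - w.2 * (deriv γ s).1| * l ≤ c * h := by
  obtain ⟨r, R, hr, hrR, hroll⟩ := hS.exists_isRolling
  have hR : 0 < R := hr.trans_le hrR
  refine ⟨86400 / r + 2400 * R + (2400 + 19200 * 2400 * R / r),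
    min (r / 200) (r ^ 2 / (153600 ^ 2 * 2400 * R)), by positivity, by positivity, ?_⟩
  intro h hh hh₀ γ L s hγ α hα
  obtain ⟨ca, hoct, C, m, n, a, b, μ, hC, hmax, hlies, hchar, hαab⟩ := hα
  have hrol := hroll γ L hγ
  have hK := (hS.roundBody hγ hr hR hrol).scaled hh hR
  have hρ : 200 ≤ r / h := by
    rw [le_div_iff₀ hh]
    have := (lt_min_iff.1 hh₀).1
    linarith
  have hρϱ : r / h ≤ R / h := by gcongr
  have hline : ∀ i, m ≤ i → i ≤ n → C i ∈ standardLine a b μ :=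
    fun i h1 h2 => hchar.1 ⟨i, ⟨h1, h2⟩, rfl⟩
  obtain ⟨ℓ, u, w, W⟩ := IsContour.exists_witness (K := scaled h S) hC hK hρ hρϱ hmax hline
  have hℓ0 : 0 < ℓ := zero_lt_one.trans_le W.one_le
  -- the extremal point in the direction `u`
  obtain ⟨t, ht⟩ := hγ.exists_support hS (u := (-u.1, -u.2)) (by
    intro h0
    rw [Prod.mk_eq_zero] at h0
    have := W.unit
    rw [neg_eq_zero.1 h0.1, neg_eq_zero.1 h0.2] at this
    norm_num at this)
  obtain ⟨κ, hκ, hu1, hu2⟩ := hγ.support_direction hS ht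
  simp only at hu1 hu2 ht
  have hκ1 : κ = 1 := by
    have e : κ ^ 2 = 1 := by
      have e1 := W.unit
      have e2 := hγ.unit_speed t
      rw [show u.1 = κ * (deriv γ t).2 by linarith, show u.2 = -(κ * (deriv γ t).1) by linarith]
        at e1
      linear_combination e1 - κ ^ 2 * e2
    exact (pow_eq_one_iff_of_nonneg hκ two_ne_zero).1 e
  rw [hκ1] at hu1 hu2
  have hu1 : u.1 = (deriv γ t).2 := by linarith
  have hu2 : u.2 = -(deriv γ t).1 := by linarith
  obtain ⟨hT1, hT2⟩ := W.support ((γ t).1 / h, (γ t).2 / h) (by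
      have e1 : h * ((γ t).1 / h) = (γ t).1 := by field_simp
      have e2 : h * ((γ t).2 / h) = (γ t).2 := by field_simp
      simp only [scaled, mem_ofPred_eq, e1, e2]
      exact hγ.mem hS t) (by
      intro X hX
      have := ht _ hX
      simp only at this ⊢
      have e : u.1 * ((γ t).1 / h) + u.2 * ((γ t).2 / h)
          = (u.1 * (γ t).1 + u.2 * (γ t).2) / h := by ring
      rw [e, le_div_iff₀ hh]
      linarith)
  simp only at hT1 hT2
  -- the point is close to the extremal point
  obtain ⟨N, hN⟩ : ∃ N, N = 4800 * ℓ * h := ⟨_, rfl⟩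
  have hN0 : 0 ≤ N := by rw [hN]; positivity
  have hw1 := one_le_abs_add_abs W.ne_zero
  have hsize : (|(w.1 : ℝ)| + |(w.2 : ℝ)|) * (ℓ * h) ^ 2 ≤ 2400 * R * h := by
    have := mul_le_mul_of_nonneg_right W.size (sq_nonneg h)
    have e : 2400 * (R / h) * h ^ 2 = 2400 * R * h := by field_simp
    rw [e] at this
    linarith
  have hNr : 32 * N ≤ r := by
    refine (abs_le_of_sq_le_sq' ?_ hr.le).2
    have e1 : (ℓ * h) ^ 2 ≤ 2400 * R * h := by
      have := mul_le_mul_of_nonneg_right hw1 (sq_nonneg (ℓ * h))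
      linarith
    have e2 : h * (153600 ^ 2 * 2400 * R) ≤ r ^ 2 :=
      ((lt_div_iff₀ (by positivity)).1 (lt_min_iff.1 hh₀).2).le
    have e3 : (32 * N) ^ 2 = 153600 ^ 2 * (ℓ * h) ^ 2 := by rw [hN]; ring
    rw [e3]
    linarith
  have hcu : (ca.1 : ℝ) ^ 2 + (ca.2 : ℝ) ^ 2 = 1 := by
    rcases eq_of_unit hoct.1 with e | e | e | e <;> rw [e] <;> norm_num
  have hb := hoct.bounds (by
    have := hγ.unit_speed s
    simp only [Prod.fst_neg, Prod.snd_neg, neg_sq]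
    exact this)
  simp only [Prod.fst_neg, Prod.snd_neg] at hb
  have hca : |(ca.1 : ℝ)| + |(ca.2 : ℝ)| = 1 := by exact_mod_cast hoct.1
  have hout := W.outward ca hoct.1 hlies.1
  rw [hu1, hu2] at hout
  have hNab : |(ca.1 : ℝ) * ((γ s).1 - (γ t).1) + ca.2 * ((γ s).2 - (γ t).2)| ≤ N := by
    obtain ⟨hl1, hl2⟩ := W.length
    have d1 := abs_mul_add_mul_le (a := ca.1) (b := ca.2) hl1 hl2
    have d2 := abs_mul_add_mul_le (a := ca.1) (b := ca.2) hT1 hT2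
    rw [hca, one_mul] at d1 d2
    obtain ⟨g0, g1, g2⟩ := hlies
    simp only [abscissa, digitalAbscissa] at g1 g2
    push_cast at g1 g2
    have d1' := mul_le_mul_of_nonneg_left (abs_le.1 d1).2 hh.le
    have d2a := mul_le_mul_of_nonneg_left (abs_le.1 d2).1 hh.le
    have d2b := mul_le_mul_of_nonneg_left (abs_le.1 d2).2 hh.le
    have e : h * ((ca.1 : ℝ) * ((γ t).1 / h - (C m).1) + ca.2 * ((γ t).2 / h - (C m).2))
        = (ca.1 * (γ t).1 + ca.2 * (γ t).2) - h * (ca.1 * (C m).1 + ca.2 * (C m).2) := by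
      field_simp; ring
    rw [e] at d2a d2b
    rw [hN, abs_le]
    constructor <;> linarith
  have hE := hγ.deriv_sub_le hS hr hrol (s := s) (t := t) hcu (by linarith) (by linarith)
    (by linarith) hNab hNr
  have hNr0 : 0 ≤ 4 * N / r := by positivity
  have hp1 : |(deriv γ s).1 - (deriv γ t).1| ≤ 4 * N / r :=
    abs_le_of_sq_le_sq (by linarith [sq_nonneg ((deriv γ s).2 - (deriv γ t).2)]) hNr0
  have hp2 : |(deriv γ s).2 - (deriv γ t).2| ≤ 4 * N / r :=
    abs_le_of_sq_le_sq (by linarith [sq_nonneg ((deriv γ s).1 - (deriv γ t).1)]) hNr0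
  have hN4 : 4 * N / r = 19200 / r * (ℓ * h) := by rw [hN]; ring
  rw [hN4] at hp1 hp2
  refine ⟨ℓ * h, w, by positivity, W.ne_zero, ?_, ?_, ?_⟩
  -- `(b, a)` is the direction of the estimate, almost perpendicular to `u`, and `u` is the outer
  -- normal at `γ t`
  · have hsin : |Real.sin (α - tangentAngle γ s)| ≤ 43200 / r * (ℓ * h) := by
      obtain ⟨hcos, hsin⟩ := hγ.cos_sin_tangentAngle s
      rw [Real.sin_sub, hcos, hsin]
      obtain ⟨κ', hκ'⟩ : ∃ κ', κ' = b * Real.cos α + a * Real.sin α := ⟨_, rfl⟩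
      have hsc := Real.sin_sq_add_cos_sq α
      have e1 : κ' * Real.cos α = b := by
        rw [hκ']; linear_combination b * hsc - Real.sin α * hαab
      have e2 : κ' * Real.sin α = a := by
        rw [hκ']; linear_combination a * hsc + Real.cos α * hαab
      have e3 : κ' ^ 2 = (a : ℝ) ^ 2 + b ^ 2 := by
        rw [← e1, ← e2]; linear_combination -κ' ^ 2 * hsc
      have hab : 0 < |(a : ℝ)| + |(b : ℝ)| := by
        have := hline m le_rfl hmax.1.1
        have : 0 < |a| + |b| := by linarith [this.1, this.2]
        exact_mod_cast this
      have e4 : |(a : ℝ)| + |(b : ℝ)| ≤ 2 * |κ'| := by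
        have := abs_add_le_two_mul_sqrt a b
        rwa [← e3, Real.sqrt_sq_eq_abs] at this
      have e5 : κ' * (Real.sin α * (deriv γ s).1 - Real.cos α * (deriv γ s).2)
          = (a * ((deriv γ s).1 - (deriv γ t).1) + -b * ((deriv γ s).2 - (deriv γ t).2))
            - (b * u.1 + a * u.2) := by
        rw [hu1, hu2]
        linear_combination (deriv γ s).1 * e2 - (deriv γ s).2 * e1
      have e6 := abs_mul_add_mul_le (a := a) (b := -b) hp1 hp2
      rw [abs_neg] at e6
      have e7 : |b * u.1 + a * u.2| ≤ 2400 / r * (ℓ * h) * (|(a : ℝ)| + |(b : ℝ)|) := by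
        have := W.direction
        rw [mul_div_assoc', div_le_iff₀ hh] at this
        have e : 2400 / r * (ℓ * h) * (|(a : ℝ)| + |(b : ℝ)|)
          = 2400 * ℓ * (|(a : ℝ)| + |(b : ℝ)|) * h / r := by ring
        rw [e, le_div_iff₀ hr]
        exact this
      have e8 := norm_sub_le (a * ((deriv γ s).1 - (deriv γ t).1)
        + -b * ((deriv γ s).2 - (deriv γ t).2)) (b * u.1 + a * u.2)
      simp only [Real.norm_eq_abs] at e8
      rw [← e5, abs_mul] at e8
      have e9 : |κ'| * |Real.sin α * (deriv γ s).1 - Real.cos α * (deriv γ s).2|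
          ≤ |κ'| * (43200 / r * (ℓ * h)) := by
        have e10 : (|(a : ℝ)| + |(b : ℝ)|) * (21600 / r * (ℓ * h))
          ≤ 2 * |κ'| * (21600 / r * (ℓ * h)) := by gcongr
        have e11 : (|(a : ℝ)| + |(b : ℝ)|) * (19200 / r * (ℓ * h))
          + 2400 / r * (ℓ * h) * (|(a : ℝ)| + |(b : ℝ)|)
          = (|(a : ℝ)| + |(b : ℝ)|) * (21600 / r * (ℓ * h)) := by ring
        have e12 : 2 * |κ'| * (21600 / r * (ℓ * h)) = |κ'| * (43200 / r * (ℓ * h)) := by ring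
        linarith
      exact le_of_mul_le_mul_left e9 (by linarith)
    refine (angleError_le_sin _ _).trans ?_
    have hπ : Real.pi / 2 ≤ 2 := by linarith [Real.pi_le_four]
    have hlh : 0 ≤ ℓ * h := by positivity
    calc _ ≤ 2 * (43200 / r * (ℓ * h)) := by gcongr
      _ = 86400 / r * (ℓ * h) := by ring
      _ ≤ _ := by
        refine mul_le_mul_of_nonneg_right ?_ hlh
        have : 0 ≤ 2400 * R + (2400 + 19200 * 2400 * R / r) := by positivity
        linarith
  · refine hsize.trans ?_
    refine mul_le_mul_of_nonneg_right ?_ hh.le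
    have h1 : 0 ≤ 86400 / r := by positivity
    have h2 : 0 ≤ 19200 * 2400 * R / r := by positivity
    linarith
  · have e1 : |w.1 * (deriv γ s).2 - w.2 * (deriv γ s).1|
        ≤ |w.1 * u.1 + w.2 * u.2| + (|(w.1 : ℝ)| + |(w.2 : ℝ)|) * (19200 / r * (ℓ * h)) := by
      have e := abs_mul_add_mul_le (a := w.1) (b := -w.2) hp2 hp1
      rw [abs_neg] at e
      have e' := abs_add_le (w.1 * u.1 + w.2 * u.2)
        (w.1 * ((deriv γ s).2 - (deriv γ t).2) + -w.2 * ((deriv γ s).1 - (deriv γ t).1))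
      rw [hu1, hu2] at e' ⊢
      refine le_trans (le_of_eq ?_) (e'.trans (by linarith))
      congr 1; ring
    have e2 := mul_le_mul_of_nonneg_right e1 (by positivity : 0 ≤ ℓ * h)
    have e3 := mul_le_mul_of_nonneg_right W.along hh.le
    have e4 := mul_le_mul_of_nonneg_left hsize (by positivity : 0 ≤ 19200 / r)
    have e5 : 19200 / r * (2400 * R * h) = 19200 * 2400 * R / r * h := by ring
    have e6 : 0 ≤ (86400 / r + 2400 * R) * h := by positivity
    linarith

/-! ### Existence of contours -/

/-- A state of the contour tracking: the current point and the last step, with both ends in `Γ` and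
a point outside `Γ` on the left. -/
structure IsState (Γ : Set (ℤ × ℤ)) (x : (ℤ × ℤ) × (ℤ × ℤ)) : Prop where
  unit : |x.2.1| + |x.2.2| = 1
  mem : x.1 ∈ Γ
  mem_prev : x.1 - x.2 ∈ Γ
  outside : x.1 - x.2 + turnLeft x.2 ∉ Γ ∨ x.1 + turnLeft x.2 ∉ Γ

open Classical in
/-- The rule of the contour tracking: the leftmost possible step. -/
noncomputable def nextDirection (Γ : Set (ℤ × ℤ)) (x : (ℤ × ℤ) × (ℤ × ℤ)) : ℤ × ℤ :=
  if x.1 + turnLeft x.2 ∈ Γ then turnLeft x.2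
  else if x.1 + x.2 ∈ Γ then x.2
  else if x.1 - turnLeft x.2 ∈ Γ then -turnLeft x.2
  else -x.2

theorem nextDirection_cases (Γ : Set (ℤ × ℤ)) (x : (ℤ × ℤ) × (ℤ × ℤ)) :
    (x.1 + turnLeft x.2 ∈ Γ ∧ nextDirection Γ x = turnLeft x.2) ∨
      (x.1 + turnLeft x.2 ∉ Γ ∧ x.1 + x.2 ∈ Γ ∧ nextDirection Γ x = x.2) ∨
      (x.1 + turnLeft x.2 ∉ Γ ∧ x.1 + x.2 ∉ Γ ∧ x.1 - turnLeft x.2 ∈ Γ ∧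
        nextDirection Γ x = -turnLeft x.2) ∨
      (x.1 + turnLeft x.2 ∉ Γ ∧ x.1 + x.2 ∉ Γ ∧ x.1 - turnLeft x.2 ∉ Γ ∧
        nextDirection Γ x = -x.2) := by
  unfold nextDirection
  split_ifs <;> simp_all

/-- The state after the next step. -/
noncomputable def nextState (Γ : Set (ℤ × ℤ)) (x : (ℤ × ℤ) × (ℤ × ℤ)) : (ℤ × ℤ) × (ℤ × ℤ) :=
  (x.1 + nextDirection Γ x, nextDirection Γ x)

theorem abs_turnLeft {e : ℤ × ℤ} (he : |e.1| + |e.2| = 1) :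
    |(turnLeft e).1| + |(turnLeft e).2| = 1 := by
  simpa [add_comm] using he

theorem IsState.next {Γ : Set (ℤ × ℤ)} {x : (ℤ × ℤ) × (ℤ × ℤ)} (hx : IsState Γ x) :
    IsState Γ (nextState Γ x) := by
  have hu := abs_turnLeft hx.unit
  have ho := hx.outside
  have hp := hx.mem_prev
  rcases nextDirection_cases Γ x with ⟨h1, h⟩ | ⟨h1, h2, h⟩ | ⟨h1, h2, h3, h⟩ | ⟨h1, h2, h3, h⟩ <;>
    refine ⟨?_, ?_, ?_, ?_⟩ <;> simp only [nextState, h]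
  · exact hu
  · exact h1
  · simpa using hx.mem
  · right
    rw [turnLeft_turnLeft]
    have : x.1 + turnLeft x.2 + -x.2 = x.1 - x.2 + turnLeft x.2 := by abel
    rw [this]
    exact ho.resolve_right (not_not.2 h1)
  · exact hx.unit
  · exact h2
  · simpa using hx.mem
  · left; simpa using h1
  · simpa only [Prod.fst_neg, Prod.snd_neg, abs_neg] using hu
  · rwa [← sub_eq_add_neg]
  · simpa using hx.mem
  · left
    rw [turnLeft_neg, turnLeft_turnLeft]
    simpa using h2
  · simpa only [Prod.fst_neg, Prod.snd_neg, abs_neg] using hx.unit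
  · rwa [← sub_eq_add_neg]
  · simpa using hx.mem
  · left
    rw [turnLeft_neg]
    simpa [sub_eq_add_neg] using h3

/-- The last step is determined by the current point and the next step. -/
theorem IsState.prev_cases {Γ : Set (ℤ × ℤ)} {x : (ℤ × ℤ) × (ℤ × ℤ)} (hx : IsState Γ x)
    {v : ℤ × ℤ} (hv : nextDirection Γ x = v) :
    (x.1 + turnLeft v ∈ Γ ∧ x.2 = -turnLeft v) ∨
      (x.1 + turnLeft v ∉ Γ ∧ x.1 - v ∈ Γ ∧ x.2 = v) ∨
      (x.1 + turnLeft v ∉ Γ ∧ x.1 - v ∉ Γ ∧ x.1 - turnLeft v ∈ Γ ∧ x.2 = turnLeft v) ∨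
      (x.1 + turnLeft v ∉ Γ ∧ x.1 - v ∉ Γ ∧ x.1 - turnLeft v ∉ Γ ∧ x.2 = -v) := by
  have hp := hx.mem_prev
  rw [← hv]
  rcases nextDirection_cases Γ x with ⟨h1, h⟩ | ⟨h1, h2, h⟩ | ⟨h1, h2, h3, h⟩ | ⟨h1, h2, h3, h⟩ <;>
    rw [h] <;> simp only [turnLeft_neg, turnLeft_turnLeft, neg_neg, ← sub_eq_add_neg,
      sub_neg_eq_add]
  · exact Or.inl ⟨hp, trivial⟩
  · exact Or.inr (Or.inl ⟨h1, hp, trivial⟩)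
  · exact Or.inr (Or.inr (Or.inl ⟨h2, h1, hp, trivial⟩))
  · exact Or.inr (Or.inr (Or.inr ⟨h3, h2, h1, trivial⟩))

/-- The contour tracking can be reversed. -/
theorem IsState.eq_of_next_eq {Γ : Set (ℤ × ℤ)} {x y : (ℤ × ℤ) × (ℤ × ℤ)} (hx : IsState Γ x)
    (hy : IsState Γ y) (h : nextState Γ x = nextState Γ y) : x = y := by
  have hd : nextDirection Γ x = nextDirection Γ y := congrArg Prod.snd h
  have hP : x.1 = y.1 := by
    have := congrArg Prod.fst h
    simp only [nextState, hd] at this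
    exact add_right_cancel this
  have h1 := hx.prev_cases hd
  have h2 := hy.prev_cases rfl
  rw [hP] at h1
  refine Prod.ext hP ?_
  rcases h1 with h1 | h1 | h1 | h1 <;> rcases h2 with h2 | h2 | h2 | h2 <;>
    first
    | exact absurd h1.1 h2.1
    | exact absurd h2.1 h1.1
    | exact absurd h1.2.1 h2.2.1
    | exact absurd h2.2.1 h1.2.1
    | exact absurd h1.2.2.1 h2.2.2.1
    | exact absurd h2.2.2.1 h1.2.2.1
    | exact h1.2.trans h2.2.symm
    | exact h1.2.2.trans h2.2.2.symm
    | exact h1.2.2.2.trans h2.2.2.2.symm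

/-- From each possible first step there is a contour. -/
theorem exists_contour {Γ : Set (ℤ × ℤ)} (hΓ : Γ.Finite) {P c : ℤ × ℤ}
    (hs : IsState Γ (P + c, c)) : ∃ C, IsContour Γ C ∧ C 0 = P ∧ C 1 = P + c := by
  have hfin : Finite {x // IsState Γ x} := by
    have hunits : {e : ℤ × ℤ | |e.1| + |e.2| = 1}.Finite := by
      refine Finite.subset (Set.toFinite {(1, 0), (0, 1), (-1, 0), (0, -1)}) ?_
      intro e he
      simpa using eq_of_unit he
    exact ((hΓ.prod hunits).subset fun x hx => ⟨hx.mem, hx.unit⟩).to_subtype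
  obtain ⟨f, hf⟩ : ∃ f : {x // IsState Γ x} → {x // IsState Γ x},
      ∀ x, (f x).1 = nextState Γ x.1 := ⟨fun x => ⟨_, x.2.next⟩, fun _ => rfl⟩
  have hinj : Function.Injective f := by
    intro x y hxy
    refine Subtype.ext (x.2.eq_of_next_eq y.2 ?_)
    rw [← hf, ← hf, hxy]
  -- on the finite set of states the tracking is a permutation, so that it also runs backwards
  obtain ⟨σ, hσ⟩ : ∃ σ : Equiv.Perm {x // IsState Γ x}, ∀ x, σ x = f x :=
    ⟨Equiv.ofBijective f (Finite.injective_iff_bijective.1 hinj), fun _ => rfl⟩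
  obtain ⟨X, hX0, hX⟩ : ∃ X : ℤ → {x // IsState Γ x}, X 1 = ⟨_, hs⟩ ∧ ∀ i, X (i + 1) = f (X i) := by
    refine ⟨fun i => (σ ^ (i - 1)) ⟨_, hs⟩, by simp, fun i => ?_⟩
    have e : i + 1 - 1 = 1 + (i - 1) := by ring
    simp only [e]
    rw [zpow_one_add, Equiv.Perm.mul_apply, hσ]
  have hstep : ∀ i, (X (i + 1)).1.1 = (X i).1.1 + nextDirection Γ (X i).1 := by
    intro i; rw [hX, hf]; rfl
  have hdir : ∀ i, (X (i + 1)).1.2 = nextDirection Γ (X i).1 := by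
    intro i; rw [hX, hf]; rfl
  have hdiff : ∀ i, (X (i + 1)).1.1 - (X i).1.1 = (X (i + 1)).1.2 := by
    intro i; rw [hstep, hdir]; abel
  have hprev : ∀ i, (X i).1.1 = (X (i + 1)).1.1 - (X (i + 1)).1.2 := by
    intro i; rw [← hdiff]; abel
  refine ⟨fun i => (X i).1.1, ⟨fun i => (X i).2.mem, fun i => ?_, fun i => ?_, ?_⟩, ?_, ?_⟩
  · rw [hdiff]; exact (X (i + 1)).2.unit
  · rw [hdiff]
    have := (X (i + 1)).2.outside
    rwa [← hprev] at this
  · intro i Q e e' hQ he he'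
    rw [hdiff] at he he'
    rw [hdir] at he'
    rw [hQ, he, he']
    exact nextDirection_cases Γ (X (i + 1)).1
  · have := hprev 0
    simp only [zero_add] at this
    simp only [this, hX0]
    abel
  · simp only [hX0]

/-! ### Existence of maximal segments below a boundary point -/

namespace IsContour

variable {K : Set (ℝ × ℝ)} {C : ℤ → ℤ × ℤ} {m n : ℤ} {ρ ϱ : ℝ}

theorem exists_direction_of_lt {Γ : Set (ℤ × ℤ)} (hC : IsContour Γ C) (hmn : m < n) {a b μ : ℤ}
    (hline : ∀ i, m ≤ i → i ≤ n → C i ∈ standardLine a b μ)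
    (hturn : ∀ i, m < i → i < n → C (i + 1) ≠ C (i - 1)) :
    ∃ e : ℤ × ℤ, |e.1| + |e.2| = 1 ∧
      ∀ i, m ≤ i → i < n → C (i + 1) = C i + e ∨ C (i + 1) = C i + turnLeft e := by
  by_cases h : ∃ d : ℤ × ℤ, ∀ i, m ≤ i → i < n → C (i + 1) = C i + d
  · obtain ⟨d, hd⟩ := h
    refine ⟨d, ?_, fun i h1 h2 => Or.inl (hd i h1 h2)⟩
    have := hC.unit_step m
    rw [hd m le_rfl hmn] at this
    simpa using this
  · push Not at h
    exact hC.exists_direction hline hturn h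

/-- In a bounded body, the length of digital straight segments of the contour is bounded. -/
theorem length_le (hC : IsContour (digital K) C) (hK : RoundBody K ρ ϱ) (hρ : 200 ≤ ρ)
    (hρϱ : ρ ≤ ϱ) {D : ℝ} (hD : ∀ P ∈ K, ∀ Q ∈ K, |P.1 - Q.1| ≤ D ∧ |P.2 - Q.2| ≤ D)
    (hdss : IsDSS C m n) : (n - m : ℝ) ≤ 2 * D + 50 * √ϱ + 4 := by
  have hD0 : 0 ≤ D := (abs_nonneg _).trans (hD _ (hC.mem 0) _ (hC.mem 0)).1
  have hs0 := Real.sqrt_nonneg ϱ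
  have hϱs : √ϱ * √ϱ = ϱ := Real.mul_self_sqrt (by linarith)
  by_contra hcon
  push Not at hcon
  have h4 : m + 4 < n := by
    have : (m : ℝ) + 4 < n := by linarith
    exact_mod_cast this
  obtain ⟨-, a, b, μ, hline⟩ := isDSS_iff.1 hdss
  by_cases h : ∃ d : ℤ × ℤ, ∀ i, m + 1 ≤ i → i < n - 1 → C (i + 1) = C i + d
  · obtain ⟨d, hd⟩ := h
    have hu := hC.unit_step (m + 1)
    rw [hd (m + 1) le_rfl (by omega)] at hu
    simp only [add_sub_cancel_left] at hu
    have h1 := eq_add_mul_of_forall_step hd (i := n - 1) (by omega) le_rfl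
    have h2 := hD _ (hC.mem (n - 1)) _ (hC.mem (m + 1))
    simp only [pt_fst, pt_snd, h1] at h2
    push_cast at h2
    simp only [add_sub_cancel_left, abs_mul] at h2
    have hu' : |(d.1 : ℝ)| + |(d.2 : ℝ)| = 1 := by exact_mod_cast hu
    have h3 : (n - 1 - (m + 1) : ℝ) ≤ |(n - 1 - (m + 1) : ℝ)| := le_abs_self _
    have h5 : |(n - 1 - (m + 1) : ℝ)| * |(d.1 : ℝ)| + |(n - 1 - (m + 1) : ℝ)| * |(d.2 : ℝ)|
        = |(n - 1 - (m + 1) : ℝ)| := by rw [← mul_add, hu', mul_one]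
    linarith
  · push Not at h
    have hline' : ∀ i, m + 1 ≤ i → i ≤ n - 1 → C i ∈ standardLine a b μ :=
      fun i h1 h2 => hline i (by omega) (by omega)
    obtain ⟨e, he, hsteps⟩ := hC.exists_direction hline'
      (fun i h1 h2 => hC.not_spike_of_dss hK hρ hline (by omega) (by omega)) h
    have := sq_length_le hρ hρϱ (by omega) e he K C a b μ hC hK hsteps h hline'
    have e1 := (abs_le_of_sq_le_sq' (b := 50 * √ϱ) (this.trans (by
      rw [mul_pow, sq √ϱ, hϱs]; linarith)) (by positivity)).2
    push_cast at e1
    linarith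

/-- Every step of the contour belongs to a maximal segment. -/
theorem exists_maximalSegment (hC : IsContour (digital K) C) (hK : RoundBody K ρ ϱ) (hρ : 200 ≤ ρ)
    (hρϱ : ρ ≤ ϱ) {D : ℝ} (hD : ∀ P ∈ K, ∀ Q ∈ K, |P.1 - Q.1| ≤ D ∧ |P.2 - Q.2| ≤ D) :
    ∃ m n, m ≤ 0 ∧ 1 ≤ n ∧ IsMaximalSegment C m n := by
  have hstart : IsDSS C 0 1 := by
    obtain ⟨d, hd⟩ : ∃ d, d = C 1 - C 0 := ⟨_, rfl⟩
    have hu := hC.unit_step 0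
    rw [zero_add, ← hd] at hu
    obtain ⟨a, b, μ, h⟩ := exists_standardLine_row hu zero_le_one (C 0)
    refine isDSS_iff.2 ⟨zero_le_one, a, b, μ, fun i h0 h1 => ?_⟩
    rcases (show i = 0 ∨ i = 1 by omega) with rfl | rfl
    · simpa using h 0 le_rfl zero_le_one
    · have := h 1 zero_le_one le_rfl
      rw [hd] at this
      simpa using this
  obtain ⟨k, ⟨m, n, hm, hn, hdss, hk⟩, hmax⟩ := Int.exists_greatest_of_bdd
    (P := fun k => ∃ m n, m ≤ 0 ∧ 1 ≤ n ∧ IsDSS C m n ∧ n - m = k)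
    ⟨⌈2 * D + 50 * √ϱ + 4⌉, fun k ⟨m, n, _, _, h, hk⟩ => by
      have h1 := hC.length_le hK hρ hρϱ hD h
      have h2 := h1.trans (Int.le_ceil _)
      rw [← hk]
      exact_mod_cast h2⟩ ⟨1, 0, 1, le_rfl, le_rfl, hstart, rfl⟩
  refine ⟨m, n, hm, hn, hdss, fun h => ?_, fun h => ?_⟩
  · have := hmax _ ⟨m - 1, n, by omega, hn, h, rfl⟩
    omega
  · have := hmax _ ⟨m, n + 1, hm, by omega, h, rfl⟩
    omega

/-- A digital straight segment containing a step `c` that is not part of a spike advances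
in the direction `c`. -/
theorem digitalAbscissa_le (hC : IsContour (digital K) C) (hK : RoundBody K ρ ϱ) (hρ : 200 ≤ ρ)
    {c : ℤ × ℤ} (hc : |c.1| + |c.2| = 1) (h01 : C 1 = C 0 + c) (h0 : C 1 ≠ C (-1))
    (h2 : C 2 ≠ C 0) {a b μ : ℤ} (hm : m ≤ 0) (hn : 1 ≤ n)
    (hline : ∀ i, m ≤ i → i ≤ n → C i ∈ standardLine a b μ) :
    digitalAbscissa c (C m) ≤ digitalAbscissa c (C 0) ∧
      digitalAbscissa c (C 1) ≤ digitalAbscissa c (C n) := by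
  -- spikes are only possible next to the ends of the segment, and can be cut off
  obtain ⟨p, hpm, hp0, hCp, hp⟩ : ∃ p, m ≤ p ∧ p ≤ 0 ∧ C p = C m ∧
      ∀ i, p < i → i < n → i = m + 1 → C (i + 1) ≠ C (i - 1) := by
    by_cases h : m + 1 < n ∧ C (m + 2) = C m
    · have g0 : m + 1 ≠ 0 := by
        intro g
        have e1 : m + 2 = 1 := by omega
        have e2 : m = -1 := by omega
        rw [e1, e2] at h
        exact h0 h.2
      have g1 : m + 1 ≠ 1 := by
        intro g
        have e1 : m = 0 := by omega
        rw [e1] at h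
        exact h2 h.2
      exact ⟨m + 2, by omega, by omega, h.2, fun i _ _ _ => by omega⟩
    · refine ⟨m, le_rfl, hm, rfl, fun i g1 g2 g3 g4 => h ⟨by omega, ?_⟩⟩
      rwa [g3, add_sub_cancel_right, show m + 1 + 1 = m + 2 by ring] at g4
  obtain ⟨q, hqn, hq0, hCq, hq⟩ : ∃ q, q ≤ n ∧ 1 ≤ q ∧ C q = C n ∧
      ∀ i, i < q → m < i → i = n - 1 → C (i + 1) ≠ C (i - 1) := by
    by_cases h : m < n - 1 ∧ C n = C (n - 2)
    · have g0 : n - 1 ≠ 0 := by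
        intro g
        have e1 : n = 1 := by omega
        rw [e1] at h
        exact h0 h.2
      have g1 : n - 1 ≠ 1 := by
        intro g
        have e1 : n = 2 := by omega
        rw [e1] at h
        exact h2 h.2
      exact ⟨n - 2, by omega, by omega, h.2.symm, fun i _ _ _ => by omega⟩
    · refine ⟨n, le_rfl, hn, rfl, fun i g1 g2 g3 g4 => h ⟨by omega, ?_⟩⟩
      rwa [g3, sub_add_cancel, show n - 1 - 1 = n - 2 by ring] at g4
  obtain ⟨e, he, hsteps⟩ := hC.exists_direction_of_lt (m := p) (n := q) (by omega)
    (fun i g1 g2 => hline i (by omega) (by omega)) (fun i g1 g2 => by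
      by_cases g3 : m + 2 ≤ i ∧ i + 2 ≤ n
      · exact hC.not_spike_of_dss hK hρ hline g3.1 g3.2
      · by_cases g4 : i = m + 1
        · exact hp i g1 (by omega) g4
        · exact hq i g2 (by omega) (by omega))
  have hce : c = e ∨ c = turnLeft e := by
    have := hsteps 0 hp0 (by omega)
    rw [zero_add, h01] at this
    exact this.imp add_left_cancel add_left_cancel
  have hstep : ∀ i, p ≤ i → i < q → digitalAbscissa c (C i) ≤ digitalAbscissa c (C (i + 1)) := by
    intro i g1 g2
    have := hsteps i g1 g2
    rcases eq_of_unit he with rfl | rfl | rfl | rfl <;> rcases hce with rfl | rfl <;>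
      rcases this with g | g <;> rw [g] <;> simp [digitalAbscissa]
  have hmono : ∀ i j, p ≤ i → i ≤ j → j ≤ q →
      digitalAbscissa c (C i) ≤ digitalAbscissa c (C j) := by
    intro i j g1 g2
    induction j, g2 using Int.leInduction with
    | base => intro; rfl
    | succ k hk ih =>
      intro g3
      exact (ih (by omega)).trans (hstep k (by omega) (by omega))
  rw [← hCp, ← hCq]
  exact ⟨hmono p 0 le_rfl hp0 (by omega), hmono 1 q (by omega) hq0 le_rfl⟩

end IsContour

theorem exists_isOctantAxis (v : ℝ × ℝ) : ∃ c, IsOctantAxis v c := by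
  obtain ⟨c, hc, hmax⟩ := Finset.exists_max_image
    ({(1, 0), (0, 1), (-1, 0), (0, -1)} : Finset (ℤ × ℤ))
    (fun c => (c.1 : ℝ) * v.1 + (c.2 : ℝ) * v.2) ⟨(1, 0), by simp⟩
  refine ⟨c, ?_, fun c' hc' => hmax c' (by simpa using eq_of_unit hc')⟩
  simp only [Finset.mem_insert, Finset.mem_singleton] at hc
  rcases hc with rfl | rfl | rfl | rfl <;> simp

theorem exists_isCharacteristic {X : Set (ℤ × ℤ)} {a b μ : ℤ} (h : X ⊆ standardLine a b μ) :
    ∃ a' b' μ', IsCharacteristic X a' b' μ' := by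
  classical
  have hex : ∃ k : ℕ, ∃ a b μ : ℤ, X ⊆ standardLine a b μ ∧ |a| + |b| = k :=
    ⟨(|a| + |b|).toNat, a, b, μ, h, (Int.toNat_of_nonneg (by positivity)).symm⟩
  obtain ⟨k, hk⟩ : ∃ k, k = Nat.find hex := ⟨_, rfl⟩
  have hs := Nat.find_spec hex
  rw [← hk] at hs
  obtain ⟨a', b', μ', h', e'⟩ := hs
  refine ⟨a', b', μ', h', fun a₁ b₁ μ₁ h₁ => ?_⟩
  have e₁ := Int.toNat_of_nonneg (show 0 ≤ |a₁| + |b₁| by positivity)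
  have hle := Nat.find_min' hex ⟨a₁, b₁, μ₁, h₁, e₁.symm⟩
  rw [← hk] at hle
  omega

theorem exists_angle (a b : ℝ) : ∃ α : ℝ, b * Real.sin α = a * Real.cos α := by
  refine ⟨Complex.arg ⟨b, a⟩, ?_⟩
  have h1 := Complex.norm_mul_cos_arg ⟨b, a⟩
  have h2 := Complex.norm_mul_sin_arg ⟨b, a⟩
  simp only at h1 h2
  linear_combination Real.cos (Complex.arg ⟨b, a⟩) * h2 - Real.sin (Complex.arg ⟨b, a⟩) * h1

theorem digital_finite {K : Set (ℝ × ℝ)} {D : ℝ}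
    (hD : ∀ P ∈ K, ∀ Q ∈ K, |P.1 - Q.1| ≤ D ∧ |P.2 - Q.2| ≤ D) : (digital K).Finite := by
  rcases (digital K).eq_empty_or_nonempty with h | ⟨Q, hQ⟩
  · rw [h]; exact finite_empty
  · refine (finite_Icc (Q.1 - ⌈D⌉, Q.2 - ⌈D⌉) (Q.1 + ⌈D⌉, Q.2 + ⌈D⌉)).subset fun P hP => ?_
    obtain ⟨h1, h2⟩ := hD _ hP _ hQ
    simp only [pt_fst, pt_snd] at h1 h2
    have h3 : |P.1 - Q.1| ≤ ⌈D⌉ := by exact_mod_cast h1.trans (Int.le_ceil D)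
    have h4 : |P.2 - Q.2| ≤ ⌈D⌉ := by exact_mod_cast h2.trans (Int.le_ceil D)
    rw [abs_le] at h3 h4
    exact ⟨⟨by simp only; omega, by simp only; omega⟩, ⟨by simp only; omega, by simp only; omega⟩⟩

/-- The grid point with coordinates `(x, y)` in the frame `(c, turnLeft c)`. -/
def framePoint (c : ℤ × ℤ) (x y : ℤ) : ℤ × ℤ := (x * c.1 - y * c.2, x * c.2 + y * c.1)

theorem framePoint_add (c : ℤ × ℤ) (x y : ℤ) : framePoint c x y + c = framePoint c (x + 1) y := by
  ext <;> simp only [framePoint, Prod.fst_add, Prod.snd_add] <;> ring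

theorem framePoint_add_turnLeft (c : ℤ × ℤ) (x y : ℤ) :
    framePoint c x y + turnLeft c = framePoint c x (y + 1) := by
  ext <;> simp only [framePoint, turnLeft, Prod.fst_add, Prod.snd_add] <;> ring

theorem framePoint_sub_turnLeft (c : ℤ × ℤ) (x y : ℤ) :
    framePoint c x y - turnLeft c = framePoint c x (y - 1) := by
  ext <;> simp only [framePoint, turnLeft, Prod.fst_sub, Prod.snd_sub] <;> ring

theorem framePoint_mem_of_le {K : Set (ℝ × ℝ)} (hK : Convex ℝ K) {c : ℤ × ℤ}
    (hc : |c.1| + |c.2| = 1) {x y₁ y₂ y₃ : ℤ} (h1 : framePoint c x y₁ ∈ digital K)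
    (h3 : framePoint c x y₃ ∈ digital K) (h12 : y₁ ≤ y₂) (h23 : y₂ ≤ y₃) :
    framePoint c x y₂ ∈ digital K := by
  have h12' : (y₁ : ℝ) ≤ y₂ := by exact_mod_cast h12
  have h23' : (y₂ : ℝ) ≤ y₃ := by exact_mod_cast h23
  rcases eq_of_unit hc with rfl | rfl | rfl | rfl <;>
    simp only [framePoint, digital, pt, mem_ofPred_eq, mul_one, mul_zero, mul_neg, sub_zero, zero_sub,
      zero_add, add_zero, sub_neg_eq_add] at h1 h3 ⊢ <;> push_cast at h1 h3 ⊢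
  · exact mem_of_column hK h1 h3 h12' h23'
  · exact mem_of_row hK h3 h1 (by linarith) (by linarith)
  · exact mem_of_column hK h3 h1 (by linarith) (by linarith)
  · exact mem_of_row hK h1 h3 h12' h23'

/-- Grid points at a distance about `10 h` behind a boundary point, in a coordinate direction
close to its normal, belong to the digitization. -/
theorem IsBoundaryParam.framePoint_mem {S : Set (ℝ × ℝ)} {γ : ℝ → ℝ × ℝ} {L r R h : ℝ}
    (hγ : IsBoundaryParam S γ L) (hrol : IsRolling S γ r R) (hh : 0 < h) (hhr : 200 * h ≤ r)
    {s : ℝ} {c : ℤ × ℤ} (hc : IsOctantAxis (-deriv γ s) c) {x y : ℤ} {ξ η : ℝ}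
    (hξ : h * x = c.1 * (γ s).1 + c.2 * (γ s).2 + h * ξ)
    (hη : h * y = c.1 * (γ s).2 - c.2 * (γ s).1 - h * η)
    (hξ1 : |ξ| ≤ 1) (hη1 : 10 ≤ η) (hη2 : η ≤ 12) :
    framePoint c x y ∈ digital (scaled h S) := by
  have hu := hγ.unit_speed s
  have hb := hc.bounds (by simpa using hu)
  simp only [Prod.fst_neg, Prod.snd_neg] at hb
  have hc2 : (c.1 : ℝ) ^ 2 + (c.2 : ℝ) ^ 2 = 1 := by
    rcases eq_of_unit hc.1 with e | e | e | e <;> rw [e] <;> norm_num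
  obtain ⟨β, hβ⟩ : ∃ β, β = (c.1 : ℝ) * -(deriv γ s).1 + c.2 * -(deriv γ s).2 := ⟨_, rfl⟩
  obtain ⟨α, hα⟩ : ∃ α, α = (deriv γ s).1 * c.2 - (deriv γ s).2 * c.1 := ⟨_, rfl⟩
  rw [← hβ] at hb
  have hβ1 : 7 / 10 ≤ β := by
    by_contra hlt
    push Not at hlt
    have := mul_self_le_mul_self hb.1 hlt.le
    linarith [hb.2]
  have hα1 : |α| ≤ 1 := by
    have e : α ^ 2 + β ^ 2 = 1 := by
      rw [hα, hβ]
      linear_combination ((deriv γ s).1 ^ 2 + (deriv γ s).2 ^ 2) * hc2 + hu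
    exact abs_le_of_sq_le_sq (by linarith [sq_nonneg β]) zero_le_one
  have hv := hrol.inner s (h * (ξ * c.1 + η * c.2), h * (ξ * c.2 - η * c.1)) (by
    have e1 : inward γ s (h * (ξ * c.1 + η * c.2), h * (ξ * c.2 - η * c.1))
        = h * (ξ * α + η * β) := by
      simp only [inward, hα, hβ]; ring
    have e2 : (h * (ξ * c.1 + η * c.2)) ^ 2 + (h * (ξ * c.2 - η * c.1)) ^ 2
        = h * (h * (ξ ^ 2 + η ^ 2)) := by
      linear_combination h ^ 2 * (ξ ^ 2 + η ^ 2) * hc2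
    simp only at e1 e2 ⊢
    rw [e1, e2, show 2 * r * (h * (ξ * α + η * β)) = h * (2 * r * (ξ * α + η * β)) by ring]
    refine mul_le_mul_of_nonneg_left ?_ hh.le
    have h1 : -1 ≤ ξ * α := by
      have := abs_mul ξ α ▸ mul_le_mul hξ1 hα1 (abs_nonneg _) zero_le_one
      rw [mul_one] at this
      exact (abs_le.1 this).1
    have h2 : 10 * (7 / 10) ≤ η * β := mul_le_mul hη1 hβ1 (by norm_num) (by linarith)
    have h3 : ξ ^ 2 ≤ 1 := by rw [← sq_abs]; exact pow_le_one₀ (abs_nonneg _) hξ1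
    have h4 : η ^ 2 ≤ 12 ^ 2 := pow_le_pow_left₀ (by linarith) hη2 2
    have h5 : h * (ξ ^ 2 + η ^ 2) ≤ h * 145 := mul_le_mul_of_nonneg_left (by linarith) hh.le
    have h6 : 2 * r * 6 ≤ 2 * r * (ξ * α + η * β) :=
      mul_le_mul_of_nonneg_left (by linarith) (by linarith)
    linarith)
  show (h * ((framePoint c x y).1 : ℝ), h * ((framePoint c x y).2 : ℝ)) ∈ S
  convert hv using 1
  ext <;> simp only [framePoint, Prod.fst_add, Prod.snd_add] <;> push_cast
  · linear_combination c.1 * hξ - c.2 * hη + (γ s).1 * hc2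
  · linear_combination c.2 * hξ + c.1 * hη + (γ s).2 * hc2

/-- For small grid steps, some maximal segment lies below every boundary point. -/
theorem IsShape.exists_estimate {S : Set (ℝ × ℝ)} (hS : IsShape S) :
    ∃ h₀ : ℝ, 0 < h₀ ∧ ∀ h, 0 < h → h < h₀ → ∀ (γ : ℝ → ℝ × ℝ) (L s : ℝ),
      IsBoundaryParam S γ L → (estimates maximalSegmentEstimator S h γ s).Nonempty := by
  obtain ⟨r, R, hr, hrR, hroll⟩ := hS.exists_isRolling
  obtain ⟨D, hD0, hD⟩ := hS.exists_bound
  have hR : 0 < R := hr.trans_le hrR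
  refine ⟨r / 200, by positivity, fun h hh hh₀ γ L s hγ => ?_⟩
  have hrol := hroll γ L hγ
  have hK := (hS.roundBody hγ hr hR hrol).scaled hh hR
  have hhr : 200 * h ≤ r := by linarith
  have hρ : 200 ≤ r / h := by rwa [le_div_iff₀ hh]
  have hρϱ : r / h ≤ R / h := by gcongr
  have hDK : ∀ P ∈ scaled h S, ∀ Q ∈ scaled h S, |P.1 - Q.1| ≤ D / h ∧ |P.2 - Q.2| ≤ D / h := by
    intro P hP Q hQ
    obtain ⟨h1, h2⟩ := hD _ hP _ hQ
    simp only [← mul_sub, abs_mul, abs_of_pos hh] at h1 h2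
    exact ⟨by rwa [le_div_iff₀' hh], by rwa [le_div_iff₀' hh]⟩
  have hfin : (digital (scaled h S)).Finite := digital_finite hDK
  obtain ⟨c, hc⟩ := exists_isOctantAxis (-deriv γ s)
  have hcu := hc.1
  have hcsq : c.1 ^ 2 + c.2 ^ 2 = 1 := by
    rcases eq_of_unit hcu with e | e | e | e <;> rw [e] <;> norm_num
  have hturn : turnLeft c ≠ c ∧ c ≠ -c ∧ turnLeft c ≠ -c := by
    rcases eq_of_unit hcu with e | e | e | e <;> rw [e] <;> decide
  obtain ⟨x₀, hx₀⟩ : ∃ x₀, x₀ = ⌊(c.1 * (γ s).1 + c.2 * (γ s).2) / h⌋ := ⟨_, rfl⟩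
  obtain ⟨y₀, hy₀⟩ : ∃ y₀, y₀ = ⌊(c.1 * (γ s).2 - c.2 * (γ s).1) / h⌋ - 10 := ⟨_, rfl⟩
  have hx1 : h * x₀ ≤ c.1 * (γ s).1 + c.2 * (γ s).2 := by
    rw [hx₀, ← le_div_iff₀' hh]; exact Int.floor_le _
  have hx2 : c.1 * (γ s).1 + c.2 * (γ s).2 ≤ h * (x₀ + 1) := by
    rw [hx₀, ← div_le_iff₀' hh]; exact (Int.lt_floor_add_one _).le
  have hmem : ∀ x y, (x = x₀ ∨ x = x₀ + 1) → (y = y₀ ∨ y = y₀ - 1) →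
      framePoint c x y ∈ digital (scaled h S) := by
    intro x y hx hy
    have f1 := Int.floor_le ((c.1 * (γ s).1 + c.2 * (γ s).2) / h)
    have f2 := Int.lt_floor_add_one ((c.1 * (γ s).1 + c.2 * (γ s).2) / h)
    have f3 := Int.floor_le ((c.1 * (γ s).2 - c.2 * (γ s).1) / h)
    have f4 := Int.lt_floor_add_one ((c.1 * (γ s).2 - c.2 * (γ s).1) / h)
    have g1 : (x₀ : ℝ) = ⌊(c.1 * (γ s).1 + c.2 * (γ s).2) / h⌋ := by rw [hx₀]
    have g2 : (y₀ : ℝ) = ⌊(c.1 * (γ s).2 - c.2 * (γ s).1) / h⌋ - 10 := by rw [hy₀]; push_cast; ring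
    refine hγ.framePoint_mem hrol hh hhr hc
      (ξ := x - (c.1 * (γ s).1 + c.2 * (γ s).2) / h)
      (η := (c.1 * (γ s).2 - c.2 * (γ s).1) / h - y) ?_ ?_ ?_ ?_ ?_
    · rw [mul_sub, mul_div_cancel₀ _ hh.ne']; ring
    · rw [mul_sub, mul_div_cancel₀ _ hh.ne']; ring
    · rw [abs_le]
      rcases hx with e | e <;> rw [e] <;> push_cast <;> constructor <;> linarith
    · rcases hy with e | e <;> rw [e] <;> push_cast <;> linarith
    · rcases hy with e | e <;> rw [e] <;> push_cast <;> linarith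
  -- the highest step from abscissa `x₀` to `x₀ + 1` inside the digitization is on the contour
  obtain ⟨y, ⟨hy1, hy2⟩, hymax⟩ := Int.exists_greatest_of_bdd
    (P := fun y => framePoint c x₀ y ∈ digital (scaled h S) ∧
      framePoint c (x₀ + 1) y ∈ digital (scaled h S))
    (by
      refine ⟨y₀ + ⌈D / h⌉ + ⌈D / h⌉, fun z hz => ?_⟩
      obtain ⟨h1, h2⟩ := hDK _ hz.1 _ (hmem x₀ y₀ (Or.inl rfl) (Or.inl rfl))
      have h1 := h1.trans (Int.le_ceil _)
      have h2 := h2.trans (Int.le_ceil _)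
      simp only [pt_fst, pt_snd] at h1 h2
      norm_cast at h1 h2
      simp only [framePoint] at h1 h2
      rw [abs_le] at h1 h2
      rcases eq_of_unit hcu with e | e | e | e <;> rw [e] at h1 h2 <;> simp only at h1 h2 <;> omega)
    ⟨y₀, hmem x₀ y₀ (Or.inl rfl) (Or.inl rfl), hmem _ y₀ (Or.inr rfl) (Or.inl rfl)⟩
  have hyy : y₀ ≤ y :=
    hymax _ ⟨hmem x₀ y₀ (Or.inl rfl) (Or.inl rfl), hmem _ y₀ (Or.inr rfl) (Or.inl rfl)⟩
  have hbelow1 : framePoint c x₀ (y - 1) ∈ digital (scaled h S) :=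
    framePoint_mem_of_le hK.convex hcu (hmem x₀ (y₀ - 1) (Or.inl rfl) (Or.inr rfl)) hy1
      (by omega) (by omega)
  have hbelow2 : framePoint c (x₀ + 1) (y - 1) ∈ digital (scaled h S) :=
    framePoint_mem_of_le hK.convex hcu (hmem _ (y₀ - 1) (Or.inr rfl) (Or.inr rfl)) hy2
      (by omega) (by omega)
  obtain ⟨C, hC, hC0, hC1⟩ := exists_contour hfin (P := framePoint c x₀ y) (c := c)
    ⟨hcu, by simpa only [framePoint_add] using hy2, by simpa only [add_sub_cancel_right] using hy1, by
      simp only [add_sub_cancel_right]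
      simp only [framePoint_add, framePoint_add_turnLeft]
      by_contra hcon
      push Not at hcon
      have := hymax _ hcon
      omega⟩
  have h01 : C 1 = C 0 + c := by rw [hC0, hC1]
  -- the contour does not turn back at the ends of this step, as both points have a neighbour below
  have hu0 : C 1 ≠ C (-1) := by
    intro e
    have h1 : C 0 = C (0 - 1) + -c := by rw [zero_sub, ← e, h01]; abel
    have h2 : C (0 + 1) = C 0 + c := h01
    have tn : turnLeft (-c) = -turnLeft c := by ext <;> simp [turnLeft]
    rcases hC.next_cases 0 h1 h2 with g | g | g | g
    · exact hturn.2.2 (neg_eq_iff_eq_neg.1 (by rw [← tn]; exact g.2.symm))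
    · exact hturn.2.1 g.2.2
    · exact hturn.1 (by have := g.2.2.2; rw [tn, neg_neg] at this; exact this.symm)
    · refine g.1 ?_
      rw [hC0, tn, ← sub_eq_add_neg, framePoint_sub_turnLeft]
      exact hbelow1
  have hu2 : C 2 ≠ C 0 := by
    intro e
    have h1 : C 1 = C (1 - 1) + c := h01
    have h2 : C (1 + 1) = C 1 + -c := by
      rw [show (1 : ℤ) + 1 = 2 by norm_num, e, h01]; abel
    rcases hC.next_cases 1 h1 h2 with g | g | g | g
    · exact hturn.2.2 g.2.symm
    · exact hturn.2.1 g.2.2.symm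
    · exact hturn.1 (neg_injective g.2.2.2.symm)
    · refine g.2.2.1 ?_
      rw [hC1, framePoint_add, framePoint_sub_turnLeft]
      exact hbelow2
  obtain ⟨m, n, hm, hn, hmax⟩ := hC.exists_maximalSegment hK hρ hρϱ hDK
  obtain ⟨-, a, b, μ, hline⟩ := hmax.1
  obtain ⟨a', b', μ', hchar⟩ := exists_isCharacteristic hline
  obtain ⟨α, hα⟩ := exists_angle a' b'
  obtain ⟨hl1, hl2⟩ := hC.digitalAbscissa_le hK hρ hcu h01 hu0 hu2 hm hn
    (fun i h1 h2 => hline ⟨i, ⟨h1, h2⟩, rfl⟩)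
  have e0 : digitalAbscissa c (C 0) = x₀ := by
    rw [hC0]; simp only [digitalAbscissa, framePoint]; linear_combination x₀ * hcsq
  have e1 : digitalAbscissa c (C 1) = x₀ + 1 := by
    rw [hC1, framePoint_add]; simp only [digitalAbscissa, framePoint]
    linear_combination (x₀ + 1) * hcsq
  rw [e0] at hl1
  rw [e1] at hl2
  have hl1' : (digitalAbscissa c (C m) : ℝ) ≤ x₀ := by exact_mod_cast hl1
  have hl2' : (x₀ : ℝ) + 1 ≤ digitalAbscissa c (C n) := by exact_mod_cast hl2
  refine ⟨α, c, hc, C, m, n, a', b', μ', hC, hmax, ⟨by omega, ?_, ?_⟩, hchar, hα⟩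
  · exact (mul_le_mul_of_nonneg_left hl1' hh.le).trans hx1
  · exact hx2.trans (mul_le_mul_of_nonneg_left hl2' hh.le)

/-! ### Convex combinations of directions -/

theorem angleError_le_abs (α θ : ℝ) (k : ℤ) : angleError α θ ≤ |α - θ - k * Real.pi| := by
  have hπ := Real.pi_pos
  have h := mul_le_mul_of_nonneg_right (round_le ((α - θ) / Real.pi) k) hπ.le
  rw [← abs_of_pos hπ, ← abs_mul, ← abs_mul, abs_of_pos hπ, sub_mul, sub_mul,
    div_mul_cancel₀ _ hπ.ne'] at h
  exact h

/-- The angles with error less than `e ≤ π / 4` form open intervals that are at least `π / 2` apart, so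
that an open interval of length `π / 2` meets only one of them. -/
theorem convex_setOf_angleError_lt (β θ : ℝ) {e : ℝ} (he : e ≤ Real.pi / 4) :
    Convex ℝ {x | x ∈ Ioo β (β + Real.pi / 2) ∧ angleError x θ < e} := by
  have hπ := Real.pi_pos
  rw [convex_iff_ordConnected]
  refine ⟨fun x hx y hy z hz => ⟨⟨hx.1.1.trans_le hz.1, hz.2.trans_lt hy.1.2⟩, ?_⟩⟩
  obtain ⟨⟨hx1, hx2⟩, hx3⟩ := hx
  obtain ⟨⟨hy1, hy2⟩, hy3⟩ := hy
  obtain ⟨hz1, hz2⟩ := hz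
  unfold angleError at hx3 hy3
  rw [abs_lt] at hx3 hy3
  have hkl : round ((x - θ) / Real.pi) = round ((y - θ) / Real.pi) := by
    obtain ⟨k, hk⟩ : ∃ k, k = round ((x - θ) / Real.pi) := ⟨_, rfl⟩
    obtain ⟨l, hl⟩ : ∃ l, l = round ((y - θ) / Real.pi) := ⟨_, rfl⟩
    rw [← hk] at hx3 ⊢
    rw [← hl] at hy3 ⊢
    have h1 : ((l : ℝ) - k) * Real.pi < 1 * Real.pi := by linarith
    have h2 : ((k : ℝ) - l) * Real.pi < 1 * Real.pi := by linarith
    have h1 := lt_of_mul_lt_mul_right h1 hπ.le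
    have h2 := lt_of_mul_lt_mul_right h2 hπ.le
    have h1 : l - k < 1 := by exact_mod_cast h1
    have h2 : k - l < 1 := by exact_mod_cast h2
    omega
  refine (angleError_le_abs z θ (round ((x - θ) / Real.pi))).trans_lt (abs_lt.2 ⟨by linarith, ?_⟩)
  rw [hkl]
  linarith

/-- If the errors of the angles of a set are less than `π / 4`, the error of a convex combination
of them is at most the error of one of them. -/
theorem exists_angleError_le {E : Set ℝ} {β θ α : ℝ} (hE : ∀ x ∈ E, angleError x θ < Real.pi / 4)
    (hα : α ∈ convexHull ℝ (E ∩ Ioo β (β + Real.pi / 2))) :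
    ∃ x ∈ E, angleError α θ ≤ angleError x θ := by
  by_contra hcon
  push Not at hcon
  have hsub : E ∩ Ioo β (β + Real.pi / 2) ⊆ {x | x ∈ Ioo β (β + Real.pi / 2) ∧
      angleError x θ < min (angleError α θ) (Real.pi / 4)} :=
    fun x hx => ⟨hx.2, lt_min (hcon x hx.1) (hE x hx.1)⟩
  have h := convexHull_min hsub (convex_setOf_angleError_lt β θ (min_le_right _ _)) hα
  exact absurd (h.2.trans_le (min_le_left _ _)) (lt_irrefl _)

theorem estimates_combined_nonempty {S : Set (ℝ × ℝ)} {h : ℝ} {γ : ℝ → ℝ × ℝ} {s : ℝ}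
    (hne : (estimates maximalSegmentEstimator S h γ s).Nonempty) :
    (estimates combinedEstimator S h γ s).Nonempty := by
  have hπ := Real.pi_pos
  obtain ⟨α, c, hc, hα⟩ := hne
  exact ⟨α, c, hc, α - Real.pi / 4,
    subset_convexHull ℝ _ ⟨hα, by constructor <;> linarith⟩⟩

/-- The main error estimate, for both estimators: the error is bounded by a multiple of the length
`l` of a piece of the contour, and this length restricts the position of the tangent with respect
to some small integer vector `w`. -/
theorem IsShape.exists_error_bound {S : Set (ℝ × ℝ)} (hS : IsShape S) {A : TangentEstimator}
    (hA : A = maximalSegmentEstimator ∨ A = combinedEstimator) :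
    ∃ c h₀ : ℝ, 0 < c ∧ 0 < h₀ ∧ ∀ h, 0 < h → h < h₀ → ∀ (γ : ℝ → ℝ × ℝ) (L s : ℝ),
      IsBoundaryParam S γ L → (estimates A S h γ s).Nonempty ∧ ∀ α ∈ estimates A S h γ s,
      ∃ (l : ℝ) (w : ℤ × ℤ), 0 < l ∧ w ≠ 0 ∧ angleError α (tangentAngle γ s) ≤ c * l ∧
        (|(w.1 : ℝ)| + |(w.2 : ℝ)|) * l ^ 2 ≤ c * h ∧
        |w.1 * (deriv γ s).2 - w.2 * (deriv γ s).1| * l ≤ c * h := by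
  obtain ⟨c, h₁, hc, hh₁, hbd⟩ := hS.exists_pointwise_bound
  obtain ⟨h₂, hh₂, hne⟩ := hS.exists_estimate
  refine ⟨c, min (min h₁ h₂) (1 / (4 * c ^ 3)), hc, by positivity, fun h hh hlt γ L s hγ => ?_⟩
  obtain ⟨hlt, hlt3⟩ := lt_min_iff.1 hlt
  obtain ⟨hlt1, hlt2⟩ := lt_min_iff.1 hlt
  have hbd := hbd h hh hlt1 γ L s hγ
  have hne := hne h hh hlt2 γ L s hγ
  rcases hA with rfl | rfl
  · exact ⟨hne, hbd⟩
  · refine ⟨estimates_combined_nonempty hne, fun α ⟨k, hk, β, hα⟩ => ?_⟩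
    obtain ⟨x, hx, hle⟩ := exists_angleError_le (θ := tangentAngle γ s) (fun x hx => by
      obtain ⟨l, w, hl, hw, h1, h2, -⟩ := hbd x ⟨k, hk, hx⟩
      have h3 := mul_le_mul_of_nonneg_right (one_le_abs_add_abs hw) (sq_nonneg l)
      have h4 : (c * l) ^ 2 < (1 / 2) ^ 2 := by
        rw [lt_div_iff₀ (by positivity)] at hlt3
        have := mul_le_mul_of_nonneg_left (h3.trans h2) (sq_nonneg c)
        linarith
      have h5 := lt_of_pow_lt_pow_left₀ 2 (by norm_num) h4
      linarith [Real.pi_gt_three]) hα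
    obtain ⟨l, w, hl, hw, h1, h2⟩ := hbd x ⟨k, hk, hx⟩
    exact ⟨l, w, hl, hw, hle.trans h1, h2⟩

/-! ### Multigrid convergence -/

/-- The error is `O(√h)` with a constant depending on the shape, hence at most `h ^ (1 / 4)`, which
does not depend on it, for small `h`. -/
theorem multigridConvergentAt {A : TangentEstimator}
    (hA : A = maximalSegmentEstimator ∨ A = combinedEstimator) (M : ℝ × ℝ) :
    MultigridConvergentAt A M := by
  refine ⟨fun h => √√h, fun h hh => Real.sqrt_pos.2 (Real.sqrt_pos.2 hh), ?_, fun S hS _ => ?_⟩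
  · have : Tendsto (fun h : ℝ => √√h) (𝓝 0) (𝓝 √√0) :=
      (Real.continuous_sqrt.comp Real.continuous_sqrt).tendsto 0
    rw [Real.sqrt_zero, Real.sqrt_zero] at this
    exact this.mono_left nhdsWithin_le_nhds
  obtain ⟨c, h₁, hc, hh₁, hbd⟩ := hS.exists_error_bound hA
  refine ⟨min h₁ (1 / (c ^ 3) ^ 2), by positivity, fun h hh hlt γ L s hγ _ => ?_⟩
  obtain ⟨hlt1, hlt2⟩ := lt_min_iff.1 hlt
  obtain ⟨hne, hbd⟩ := hbd h hh hlt1 γ L s hγ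
  refine ⟨hne, fun α hα => ?_⟩
  obtain ⟨l, w, hl, hw, h1, h2, -⟩ := hbd α hα
  have h3 := mul_le_mul_of_nonneg_right (one_le_abs_add_abs hw) (sq_nonneg l)
  refine h1.trans (abs_le_of_sq_le_sq' ?_ (Real.sqrt_nonneg _)).2
  have hs := Real.mul_self_sqrt hh.le
  have hs0 := Real.sqrt_nonneg h
  have h4 : c ^ 3 * √h ≤ 1 := by
    refine (abs_le_of_sq_le_sq' ?_ zero_le_one).2
    rw [lt_div_iff₀ (by positivity)] at hlt2
    have e : (c ^ 3 * √h) ^ 2 = h * (c ^ 3) ^ 2 := by rw [mul_pow, sq √h, hs]; ring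
    rw [e]
    linarith
  have h5 := mul_le_mul_of_nonneg_right h4 hs0
  have h6 := mul_le_mul_of_nonneg_left (h3.trans h2) (sq_nonneg c)
  rw [Real.sq_sqrt hs0]
  have e : c ^ 3 * √h * √h = c ^ 3 * h := by rw [mul_assoc, hs]
  rw [e] at h5
  linarith

/-! ### Boundary points whose tangent is close to a given direction -/

namespace IsBoundaryParam

variable {S : Set (ℝ × ℝ)} {γ : ℝ → ℝ × ℝ} {L r R : ℝ}

/-- The mean value theorem for the component of `γ` along `(a, b)`. -/
theorem exists_chord_eq (hγ : IsBoundaryParam S γ L) (a b : ℝ) {s t : ℝ} (hst : t < s) :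
    ∃ z ∈ Ioo t s, a * ((γ s).1 - (γ t).1) + b * ((γ s).2 - (γ t).2)
      = (a * (deriv γ z).1 + b * (deriv γ z).2) * (s - t) := by
  have hd : ∀ z, HasDerivAt (fun z => a * (γ z).1 + b * (γ z).2)
      (a * (deriv γ z).1 + b * (deriv γ z).2) z := fun z =>
    ((hγ.hasDerivAt_fst z).const_mul a).add ((hγ.hasDerivAt_snd z).const_mul b)
  obtain ⟨z, hz, e⟩ := exists_hasDerivAt_eq_slope _ _ hst
    (fun z _ => (hd z).continuousAt.continuousWithinAt) (fun z _ => hd z)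
  refine ⟨z, hz, ?_⟩
  rw [e, div_mul_cancel₀ _ (sub_pos.2 hst).ne']
  ring

theorem dot_deriv_le (hγ : IsBoundaryParam S γ L) (a b s : ℝ) :
    a * (deriv γ s).1 + b * (deriv γ s).2 ≤ √(a ^ 2 + b ^ 2) := by
  refine Real.le_sqrt_of_sq_le ?_
  have hu := hγ.unit_speed s
  have e : (a ^ 2 + b ^ 2) * ((deriv γ s).1 ^ 2 + (deriv γ s).2 ^ 2) = a ^ 2 + b ^ 2 := by
    rw [hu, mul_one]
  have := sq_nonneg (a * (deriv γ s).2 - b * (deriv γ s).1)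
  linarith

theorem sq_chord_le (hγ : IsBoundaryParam S γ L) {s t : ℝ} (hst : t ≤ s) :
    ((γ s).1 - (γ t).1) ^ 2 + ((γ s).2 - (γ t).2) ^ 2 ≤ (s - t) ^ 2 := by
  rcases hst.eq_or_lt with rfl | hst
  · simp
  obtain ⟨d₁, hd₁⟩ : ∃ d, d = (γ s).1 - (γ t).1 := ⟨_, rfl⟩
  obtain ⟨d₂, hd₂⟩ : ∃ d, d = (γ s).2 - (γ t).2 := ⟨_, rfl⟩
  obtain ⟨z, -, e⟩ := hγ.exists_chord_eq d₁ d₂ hst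
  rw [← hd₁, ← hd₂] at e ⊢
  have h1 := mul_le_mul_of_nonneg_right (hγ.dot_deriv_le d₁ d₂ z) (sub_pos.2 hst).le
  have h2 := Real.mul_self_sqrt (show 0 ≤ d₁ ^ 2 + d₂ ^ 2 by positivity)
  rw [← e] at h1
  obtain ⟨q, hq⟩ : ∃ q, q = √(d₁ ^ 2 + d₂ ^ 2) := ⟨_, rfl⟩
  have hq0 : 0 ≤ q := by rw [hq]; positivity
  rw [← hq] at h1 h2
  have h3 : q * q ≤ q * (s - t) := by linarith
  have h4 : q ≤ s - t := by
    by_contra hlt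
    push Not at hlt
    have : 0 < q := (sub_pos.2 hst).trans hlt
    exact absurd (mul_lt_mul_of_pos_left hlt this) (by linarith)
  rw [← h2, ← sq]
  exact pow_le_pow_left₀ hq0 h4 2

/-- The inner rolling ball bounds the variation of the tangent by the chord. -/
theorem mul_sq_deriv_sub_le (hγ : IsBoundaryParam S γ L) (hS : IsShape S)
    (hrol : IsRolling S γ r R) (s t : ℝ) :
    r * (((deriv γ s).1 - (deriv γ t).1) ^ 2 + ((deriv γ s).2 - (deriv γ t).2) ^ 2)
      ≤ ((deriv γ s).2 - (deriv γ t).2) * ((γ s).1 - (γ t).1)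
        - ((deriv γ s).1 - (deriv γ t).1) * ((γ s).2 - (γ t).2) := by
  have key : ∀ s t, r * (1 - ((deriv γ s).1 * (deriv γ t).1 + (deriv γ s).2 * (deriv γ t).2))
      ≤ inward γ t (γ s - γ t) := by
    intro s t
    have hs := hγ.unit_speed s
    have ht := hγ.unit_speed t
    have h1 := hrol.inner s (r * (-(deriv γ s).2 + (deriv γ t).2),
      r * ((deriv γ s).1 - (deriv γ t).1)) (by
        simp only [inward]
        refine le_of_eq ?_
        linear_combination r ^ 2 * (ht - hs))
    have h2 := hγ.inward_nonneg hS t h1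
    simp only [inward, Prod.fst_sub, Prod.snd_sub, Prod.fst_add, Prod.snd_add] at h2 ⊢
    linear_combination h2 - r * ht
  have h1 := key s t
  have h2 := key t s
  have hs := hγ.unit_speed s
  have ht := hγ.unit_speed t
  simp only [inward, Prod.fst_sub, Prod.snd_sub] at h1 h2
  linear_combination h1 + h2 + r * hs + r * ht

theorem sq_deriv_sub_le (hγ : IsBoundaryParam S γ L) (hS : IsShape S) (hr : 0 < r)
    (hrol : IsRolling S γ r R) (s t : ℝ) :
    r ^ 2 * (((deriv γ s).1 - (deriv γ t).1) ^ 2 + ((deriv γ s).2 - (deriv γ t).2) ^ 2)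
      ≤ ((γ s).1 - (γ t).1) ^ 2 + ((γ s).2 - (γ t).2) ^ 2 := by
  have h := hγ.mul_sq_deriv_sub_le hS hrol s t
  obtain ⟨x, hx⟩ : ∃ x, x = (deriv γ s).1 - (deriv γ t).1 := ⟨_, rfl⟩
  obtain ⟨y, hy⟩ : ∃ y, y = (deriv γ s).2 - (deriv γ t).2 := ⟨_, rfl⟩
  obtain ⟨a, ha⟩ : ∃ a, a = (γ s).1 - (γ t).1 := ⟨_, rfl⟩
  obtain ⟨b, hb⟩ : ∃ b, b = (γ s).2 - (γ t).2 := ⟨_, rfl⟩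
  rw [← hx, ← hy, ← ha, ← hb] at h ⊢
  have h1 := mul_le_mul_of_nonneg_left h hr.le
  have h2 := sq_nonneg (r * y - a)
  have h3 := sq_nonneg (r * x + b)
  linarith

/-- The outer rolling ball bounds the chord by the variation of the tangent. -/
theorem sq_chord_le_deriv_sub (hγ : IsBoundaryParam S γ L) (hS : IsShape S)
    (hrol : IsRolling S γ r R) (s t : ℝ) :
    ((γ s).1 - (γ t).1) ^ 2 + ((γ s).2 - (γ t).2) ^ 2
      ≤ R ^ 2 * (((deriv γ s).1 - (deriv γ t).1) ^ 2 + ((deriv γ s).2 - (deriv γ t).2) ^ 2) := by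
  have h1 := hrol.outer s _ (hγ.mem hS t)
  have h2 := hrol.outer t _ (hγ.mem hS s)
  simp only [inward, Prod.fst_sub, Prod.snd_sub] at h1 h2
  obtain ⟨x, hx⟩ : ∃ x, x = (deriv γ s).1 - (deriv γ t).1 := ⟨_, rfl⟩
  obtain ⟨y, hy⟩ : ∃ y, y = (deriv γ s).2 - (deriv γ t).2 := ⟨_, rfl⟩
  obtain ⟨a, ha⟩ : ∃ a, a = (γ s).1 - (γ t).1 := ⟨_, rfl⟩
  obtain ⟨b, hb⟩ : ∃ b, b = (γ s).2 - (γ t).2 := ⟨_, rfl⟩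
  have h : a ^ 2 + b ^ 2 ≤ R * (y * a - x * b) := by
    rw [hx, hy, ha, hb]; linear_combination (h1 + h2) / 2
  rw [← hx, ← hy, ← ha, ← hb]
  have h2 := sq_nonneg (R * y - a)
  have h3 := sq_nonneg (R * x + b)
  linarith

theorem arc_le_chord (hγ : IsBoundaryParam S γ L) (hS : IsShape S) (hr : 0 < r)
    (hrol : IsRolling S γ r R) {s t : ℝ} (hst : t ≤ s) (hsr : s - t ≤ r / 4) :
    (3 / 4 * (s - t)) ^ 2 ≤ ((γ s).1 - (γ t).1) ^ 2 + ((γ s).2 - (γ t).2) ^ 2 := by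
  rcases hst.eq_or_lt with rfl | hst
  · simp
  obtain ⟨z, hz, e⟩ := hγ.exists_chord_eq (deriv γ t).1 (deriv γ t).2 hst
  have h1 := hγ.sq_deriv_sub_le hS hr hrol z t
  have h2 := hγ.sq_chord_le hz.1.le
  have h3 : (z - t) ^ 2 ≤ (r / 4) ^ 2 :=
    pow_le_pow_left₀ (by linarith [hz.1]) (by linarith [hz.2]) 2
  have h4 : ((deriv γ z).1 - (deriv γ t).1) ^ 2 + ((deriv γ z).2 - (deriv γ t).2) ^ 2
      ≤ 1 / 16 := by
    refine le_of_mul_le_mul_left ?_ (show 0 < r ^ 2 by positivity)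
    linarith
  have hz1 := hγ.unit_speed z
  have ht1 := hγ.unit_speed t
  have h5 : 3 / 4 ≤ (deriv γ t).1 * (deriv γ z).1 + (deriv γ t).2 * (deriv γ z).2 := by linarith
  have h6 := mul_le_mul_of_nonneg_right h5 (sub_pos.2 hst).le
  rw [← e] at h6
  obtain ⟨a, ha⟩ : ∃ a, a = (γ s).1 - (γ t).1 := ⟨_, rfl⟩
  obtain ⟨b, hb⟩ : ∃ b, b = (γ s).2 - (γ t).2 := ⟨_, rfl⟩
  rw [← ha, ← hb] at h6 ⊢
  have h7 := pow_le_pow_left₀ (by linarith) h6 2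
  have h8 := sq_nonneg ((deriv γ t).1 * b - (deriv γ t).2 * a)
  have e2 : ((deriv γ t).1 * a + (deriv γ t).2 * b) ^ 2
      + ((deriv γ t).1 * b - (deriv γ t).2 * a) ^ 2 = a ^ 2 + b ^ 2 := by
    linear_combination (a ^ 2 + b ^ 2) * ht1
  linarith

/-- The perimeter is bounded below by the radius of the inner rolling ball. -/
theorem le_length (hγ : IsBoundaryParam S γ L) (hS : IsShape S) (hr : 0 < r)
    (hrol : IsRolling S γ r R) : r / 4 ≤ L := by
  by_contra hlt
  push Not at hlt
  have hL := hγ.length_pos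
  have h := hγ.arc_le_chord hS hr hrol (s := 0 + L) (t := 0) (by linarith) (by linarith)
  rw [hγ.periodic 0] at h
  have h0 : 0 < (3 / 4 * L) ^ 2 := by positivity
  rw [zero_add, sub_zero, sub_self, sub_self] at h
  linarith

/-- On a short piece of the boundary, two points where the tangent makes a small angle with a given
direction are close. -/
theorem sq_arc_le (hγ : IsBoundaryParam S γ L) (hS : IsShape S) (hr : 0 < r)
    (hrol : IsRolling S γ r R) {s t : ℝ} (hst : t ≤ s) (hsr : s - t ≤ r / 4) {w₁ w₂ ε : ℝ}
    (hs : |w₁ * (deriv γ s).2 - w₂ * (deriv γ s).1| ≤ ε)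
    (ht : |w₁ * (deriv γ t).2 - w₂ * (deriv γ t).1| ≤ ε) :
    (w₁ ^ 2 + w₂ ^ 2) * (s - t) ^ 2 ≤ 16 * R ^ 2 * ε ^ 2 := by
  have h1 := hγ.arc_le_chord hS hr hrol hst hsr
  have h2 := hγ.sq_chord_le_deriv_sub hS hrol s t
  have h3 := hγ.sq_deriv_sub_le hS hr hrol s t
  have h4 := hγ.sq_chord_le hst
  have h5 : (s - t) ^ 2 ≤ (r / 4) ^ 2 := pow_le_pow_left₀ (by linarith) hsr 2
  have hs1 := hγ.unit_speed s
  have ht1 := hγ.unit_speed t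
  obtain ⟨x, hx⟩ : ∃ x, x = (deriv γ s).1 - (deriv γ t).1 := ⟨_, rfl⟩
  obtain ⟨y, hy⟩ : ∃ y, y = (deriv γ s).2 - (deriv γ t).2 := ⟨_, rfl⟩
  obtain ⟨p, hp⟩ : ∃ p, p = (deriv γ s).1 + (deriv γ t).1 := ⟨_, rfl⟩
  obtain ⟨q, hq⟩ : ∃ q, q = (deriv γ s).2 + (deriv γ t).2 := ⟨_, rfl⟩
  -- the sum and the difference of two unit vectors are orthogonal
  have hortho : p * x + q * y = 0 := by
    rw [hp, hx, hq, hy]; linear_combination hs1 - ht1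
  have hsum : p ^ 2 + q ^ 2 + (x ^ 2 + y ^ 2) = 4 := by
    rw [hp, hx, hq, hy]; linear_combination 2 * hs1 + 2 * ht1
  have hcx : (w₁ * y - w₂ * x) ^ 2 ≤ (2 * ε) ^ 2 := by
    rw [abs_le] at hs ht
    refine sq_le_sq' ?_ ?_ <;> rw [hx, hy] <;> linarith
  have hcp : (w₁ * q - w₂ * p) ^ 2 ≤ (2 * ε) ^ 2 := by
    rw [abs_le] at hs ht
    refine sq_le_sq' ?_ ?_ <;> rw [hp, hq] <;> linarith
  rw [← hx, ← hy] at h2 h3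
  have hx16 : x ^ 2 + y ^ 2 ≤ 1 / 16 := by
    refine le_of_mul_le_mul_left ?_ (show 0 < r ^ 2 by positivity)
    linarith
  have key : (w₁ ^ 2 + w₂ ^ 2) * (p ^ 2 + q ^ 2) * (x ^ 2 + y ^ 2)
      = (w₁ * y - w₂ * x) ^ 2 * (p ^ 2 + q ^ 2) + (w₁ * q - w₂ * p) ^ 2 * (x ^ 2 + y ^ 2) := by
    linear_combination
      ((w₁ ^ 2 - w₂ ^ 2) * (p * x - q * y) + 2 * w₁ * w₂ * (y * p + x * q)) * hortho
  have h6 : (w₁ ^ 2 + w₂ ^ 2) * (p ^ 2 + q ^ 2) * (x ^ 2 + y ^ 2) ≤ 16 * ε ^ 2 := by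
    rw [key]
    have := mul_le_mul_of_nonneg_right hcx (show 0 ≤ p ^ 2 + q ^ 2 by positivity)
    have := mul_le_mul_of_nonneg_right hcp (show 0 ≤ x ^ 2 + y ^ 2 by positivity)
    have e : (2 * ε) ^ 2 * (p ^ 2 + q ^ 2) + (2 * ε) ^ 2 * (x ^ 2 + y ^ 2) = 16 * ε ^ 2 := by
      rw [← mul_add, hsum]; ring
    linarith
  obtain ⟨V, hV⟩ : ∃ V, V = (w₁ ^ 2 + w₂ ^ 2) * (x ^ 2 + y ^ 2) := ⟨_, rfl⟩
  have hV0 : 0 ≤ V := by rw [hV]; positivity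
  have h7 : V * (63 / 16) ≤ 16 * ε ^ 2 := by
    have : V * (63 / 16) ≤ V * (p ^ 2 + q ^ 2) := mul_le_mul_of_nonneg_left (by linarith) hV0
    have e : (w₁ ^ 2 + w₂ ^ 2) * (p ^ 2 + q ^ 2) * (x ^ 2 + y ^ 2) = V * (p ^ 2 + q ^ 2) := by
      rw [hV]; ring
    linarith
  have h8 := mul_le_mul_of_nonneg_left (h1.trans h2) (show 0 ≤ w₁ ^ 2 + w₂ ^ 2 by positivity)
  have h9 := mul_le_mul_of_nonneg_left h7 (sq_nonneg R)
  have e : (w₁ ^ 2 + w₂ ^ 2) * (R ^ 2 * (x ^ 2 + y ^ 2)) = R ^ 2 * V := by rw [hV]; ring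
  rw [e] at h8
  have h10 : 0 ≤ R ^ 2 * ε ^ 2 := by positivity
  linarith

end IsBoundaryParam

namespace IsBoundaryParam

variable {S : Set (ℝ × ℝ)} {γ : ℝ → ℝ × ℝ} {L r R : ℝ}

/-- The length of the part of the boundary where the tangent is close to the direction of a
vector `w`. -/
theorem volume_cross_le (hγ : IsBoundaryParam S γ L) (hS : IsShape S) (hr : 0 < r) (hR : 0 < R)
    (hrol : IsRolling S γ r R) {w₁ w₂ k ε : ℝ} (hk : 0 < k) (hw : |w₁| + |w₂| = k) (hε : 0 ≤ ε) :
    volume {s | s ∈ Ioc 0 L ∧ |w₁ * (deriv γ s).2 - w₂ * (deriv γ s).1| ≤ ε}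
      ≤ ENNReal.ofReal (96 * (R / r) * L * (ε / k)) := by
  have hL := hγ.length_pos
  have hrL := hγ.le_length hS hr hrol
  obtain ⟨G, hG⟩ : ∃ G, G = {s | |w₁ * (deriv γ s).2 - w₂ * (deriv γ s).1| ≤ ε} := ⟨_, rfl⟩
  obtain ⟨η, hη⟩ : ∃ η, η = r / 4 := ⟨_, rfl⟩
  have hη0 : 0 < η := by rw [hη]; positivity
  obtain ⟨n, hn⟩ : ∃ n, n = ⌈L / η⌉₊ := ⟨_, rfl⟩
  have hcover : {s | s ∈ Ioc 0 L ∧ |w₁ * (deriv γ s).2 - w₂ * (deriv γ s).1| ≤ ε}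
      ⊆ ⋃ j ∈ Finset.range n, (Icc (j * η) ((j + 1) * η) ∩ G) := by
    rintro s ⟨⟨hs0, hsL⟩, hs⟩
    have hsη : 0 ≤ s / η := by positivity
    have h1 := Nat.ceil_lt_add_one hsη
    have h2 := Nat.le_ceil (s / η)
    have h3 : 0 < ⌈s / η⌉₊ := Nat.ceil_pos.2 (by positivity)
    have h4 : ⌈s / η⌉₊ ≤ n := by rw [hn]; exact Nat.ceil_mono (by gcongr)
    obtain ⟨j, hj⟩ := Nat.exists_eq_succ_of_ne_zero h3.ne'
    rw [hj] at h1 h2 h4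
    push_cast at h1 h2
    rw [div_le_iff₀ hη0] at h2
    have h1 : (j : ℝ) ≤ s / η := by linarith
    rw [le_div_iff₀ hη0] at h1
    simp only [mem_iUnion, Finset.mem_range]
    exact ⟨j, by omega, ⟨h1, h2⟩, by rw [hG]; exact hs⟩
  have hpiece : ∀ j ∈ Finset.range n, volume (Icc ((j : ℝ) * η) ((j + 1) * η) ∩ G)
      ≤ ENNReal.ofReal (12 * R * (ε / k)) := by
    intro j _
    rcases (Icc ((j : ℝ) * η) ((j + 1) * η) ∩ G).eq_empty_or_nonempty with h | ⟨t, ht⟩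
    · rw [h, measure_empty]; exact zero_le
    have hdist : ∀ s t, t ≤ s → s ∈ Icc ((j : ℝ) * η) ((j + 1) * η) ∩ G →
        t ∈ Icc ((j : ℝ) * η) ((j + 1) * η) ∩ G → s - t ≤ 6 * R * (ε / k) := by
      rintro s t hts ⟨⟨hs1, hs2⟩, hs3⟩ ⟨⟨ht1, ht2⟩, ht3⟩
      rw [hG] at hs3 ht3
      have h1 := hγ.sq_arc_le hS hr hrol hts (by linarith) hs3 ht3
      have h2 : k ^ 2 ≤ 2 * (w₁ ^ 2 + w₂ ^ 2) := by
        rw [← hw, ← sq_abs w₁, ← sq_abs w₂]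
        have := sq_nonneg (|w₁| - |w₂|)
        linarith
      have h3 := mul_le_mul_of_nonneg_right h2 (sq_nonneg (s - t))
      have h4 : (k * (s - t)) ^ 2 ≤ (6 * R * ε) ^ 2 := by
        have : 0 ≤ R ^ 2 * ε ^ 2 := by positivity
        rw [mul_pow]
        linarith
      have h5 := (abs_le_of_sq_le_sq' h4 (by positivity)).2
      rw [← mul_div_assoc, le_div_iff₀ hk]
      linarith
    have hsub : Icc ((j : ℝ) * η) ((j + 1) * η) ∩ G
        ⊆ Icc (t - 6 * R * (ε / k)) (t + 6 * R * (ε / k)) := by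
      intro s hs
      have h0 : 0 ≤ 6 * R * (ε / k) := by positivity
      rcases le_total t s with h | h
      · have := hdist s t h hs ht
        constructor <;> linarith
      · have := hdist t s h ht hs
        constructor <;> linarith
    refine (measure_mono hsub).trans ?_
    rw [Real.volume_Icc]
    exact ENNReal.ofReal_le_ofReal (by linarith)
  refine (measure_mono hcover).trans ((measure_biUnion_finset_le _ _).trans
    ((Finset.sum_le_sum hpiece).trans ?_))
  rw [Finset.sum_const, Finset.card_range, ← ENNReal.ofReal_nsmul, nsmul_eq_mul]
  refine ENNReal.ofReal_le_ofReal ?_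
  have h1 : (n : ℝ) ≤ 8 * (L / r) := by
    have h2 : (n : ℝ) < L / η + 1 := by rw [hn]; exact Nat.ceil_lt_add_one (by positivity)
    have h3 : 1 ≤ L / η := by rw [le_div_iff₀ hη0]; linarith
    have h4 : L / η = 4 * (L / r) := by rw [hη]; field_simp
    linarith
  have h2 := mul_le_mul_of_nonneg_right h1 (show 0 ≤ 12 * R * (ε / k) by positivity)
  refine h2.trans (le_of_eq ?_)
  ring

/-- The length of the part of the boundary where the tangent is close to the direction of some
integer vector of size at most `W`: there are at most `2 k + 1` directions of size `k`, each of
which contributes `O(ε / k)`. -/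
theorem volume_exists_cross_le (hγ : IsBoundaryParam S γ L) (hS : IsShape S) (hr : 0 < r)
    (hR : 0 < R) (hrol : IsRolling S γ r R) {W ε : ℝ} (hW : 0 ≤ W) (hε : 0 ≤ ε) :
    volume {s | s ∈ Ioc 0 L ∧ ∃ w : ℤ × ℤ, w ≠ 0 ∧ |(w.1 : ℝ)| + |(w.2 : ℝ)| ≤ W ∧
        |w.1 * (deriv γ s).2 - w.2 * (deriv γ s).1| ≤ ε}
      ≤ ENNReal.ofReal (288 * (R / r) * L * (W * ε)) := by
  have hL := hγ.length_pos
  have hcover : {s | s ∈ Ioc 0 L ∧ ∃ w : ℤ × ℤ, w ≠ 0 ∧ |(w.1 : ℝ)| + |(w.2 : ℝ)| ≤ W ∧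
        |w.1 * (deriv γ s).2 - w.2 * (deriv γ s).1| ≤ ε}
      ⊆ ⋃ k ∈ Finset.Icc 1 ⌊W⌋₊, ⋃ a ∈ Finset.Icc (-(k : ℤ)) k,
        {s | s ∈ Ioc 0 L ∧
          |(a : ℝ) * (deriv γ s).2 - ((k : ℝ) - |(a : ℝ)|) * (deriv γ s).1| ≤ ε} := by
    rintro s ⟨hs, w, hw, hwW, hcr⟩
    -- the sign of `w` does not matter
    obtain ⟨v, hv2, hv, hvW, hcr⟩ : ∃ v : ℤ × ℤ, 0 ≤ v.2 ∧ v ≠ 0 ∧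
        |(v.1 : ℝ)| + |(v.2 : ℝ)| ≤ W ∧ |v.1 * (deriv γ s).2 - v.2 * (deriv γ s).1| ≤ ε := by
      rcases le_total 0 w.2 with h | h
      · exact ⟨w, h, hw, hwW, hcr⟩
      · refine ⟨-w, by simpa using h, neg_ne_zero.2 hw, by simpa using hwW, ?_⟩
        rw [← abs_neg]
        convert hcr using 2
        simp only [Prod.fst_neg, Prod.snd_neg]
        push_cast
        ring
    have hv1 := one_le_abs_add_abs hv
    obtain ⟨k, hk⟩ := Int.eq_ofNat_of_zero_le (show 0 ≤ |v.1| + |v.2| by positivity)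
    have hk' : |(v.1 : ℝ)| + |(v.2 : ℝ)| = k := by exact_mod_cast hk
    rw [hk'] at hv1 hvW
    have hk1 : 1 ≤ k := by exact_mod_cast hv1
    simp only [mem_iUnion, Finset.mem_Icc]
    refine ⟨k, ⟨hk1, Nat.le_floor hvW⟩, v.1, ?_, hs, ?_⟩
    · rw [abs_of_nonneg hv2] at hk
      exact abs_le.1 (by omega)
    · rw [← hk', add_sub_cancel_left, abs_of_nonneg (by exact_mod_cast hv2 : (0 : ℝ) ≤ v.2)]
      exact hcr
  obtain ⟨B, hB⟩ : ∃ B, B = 96 * (R / r) * L * ε := ⟨_, rfl⟩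
  have hB0 : 0 ≤ B := by rw [hB]; positivity
  refine (measure_mono hcover).trans ((measure_biUnion_finset_le _ _).trans
    ((Finset.sum_le_sum (g := fun _ => ENNReal.ofReal (3 * B)) fun k hk => ?_).trans ?_))
  · have hk1 := (Finset.mem_Icc.1 hk).1
    have hk0 : (0 : ℝ) < k := by exact_mod_cast hk1
    refine (measure_biUnion_finset_le _ _).trans
      ((Finset.sum_le_sum (g := fun _ => ENNReal.ofReal (B / k)) fun a ha => ?_).trans ?_)
    · have ha' : |(a : ℝ)| ≤ k := by exact_mod_cast abs_le.2 (Finset.mem_Icc.1 ha)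
      refine (hγ.volume_cross_le hS hr hR hrol hk0 ?_ hε).trans (le_of_eq ?_)
      · rw [abs_of_nonneg (sub_nonneg.2 ha')]; ring
      · rw [hB, mul_div_assoc]
    · rw [Finset.sum_const, Int.card_Icc, ← ENNReal.ofReal_nsmul, nsmul_eq_mul]
      refine ENNReal.ofReal_le_ofReal ?_
      have e : (((k : ℤ) + 1 - -(k : ℤ)).toNat : ℝ) = 2 * k + 1 := by
        have : ((k : ℤ) + 1 - -(k : ℤ)).toNat = 2 * k + 1 := by omega
        rw [this]; push_cast; ring
      rw [e]
      have hk1' : (1 : ℝ) ≤ k := by exact_mod_cast hk1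
      have := mul_le_mul_of_nonneg_right (show 2 * (k : ℝ) + 1 ≤ 3 * k by linarith)
        (show 0 ≤ B / k by positivity)
      refine this.trans (le_of_eq ?_)
      rw [mul_assoc, mul_div_cancel₀ _ hk0.ne']
  · rw [Finset.sum_const, Nat.card_Icc, ← ENNReal.ofReal_nsmul, nsmul_eq_mul, Nat.add_sub_cancel]
    refine ENNReal.ofReal_le_ofReal ?_
    refine (mul_le_mul_of_nonneg_right (Nat.floor_le hW) (by positivity)).trans (le_of_eq ?_)
    rw [hB]; ring

end IsBoundaryParam

/-! ### Average speed of convergence -/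

/-- The error exceeds `h ^ (2 / 3)` by a factor `2 ^ i` only on a part of the boundary of length
`O(8⁻ⁱ)`; the sum over `i` is dominated by a geometric series. -/
theorem IsShape.hasAverageSpeed {S : Set (ℝ × ℝ)} (hS : IsShape S) {A : TangentEstimator}
    (hA : A = maximalSegmentEstimator ∨ A = combinedEstimator) : HasAverageSpeed A S (2 / 3) := by
  obtain ⟨r, R, hr, hrR, hroll⟩ := hS.exists_isRolling
  have hR : 0 < R := hr.trans_le hrR
  obtain ⟨c, h₀, hc, hh₀, hbd⟩ := hS.exists_error_bound hA
  obtain ⟨B, hB⟩ : ∃ B, B = 288 * (R / r) * c ^ 3 := ⟨_, rfl⟩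
  have hB0 : 0 < B := by rw [hB]; positivity
  refine ⟨c + 4 * B, h₀, by positivity, hh₀, fun h hh hlt γ L hγ =>
    ⟨fun s => (hbd h hh hlt γ L s hγ).1, ?_⟩⟩
  have hL := hγ.length_pos
  have hrol := hroll γ L hγ
  obtain ⟨q, hq⟩ : ∃ q, q = h ^ (2 / 3 : ℝ) := ⟨_, rfl⟩
  have hq0 : 0 < q := by rw [hq]; positivity
  have hq3 : q ^ 3 = h ^ 2 := by
    rw [hq, ← Real.rpow_natCast (h ^ (2 / 3 : ℝ)) 3, ← Real.rpow_mul hh.le, ← Real.rpow_natCast h 2]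
    norm_num
  rw [← hq]
  -- the points where the error may exceed `c * (2 ^ i * q)`
  obtain ⟨G, hG⟩ : ∃ G : ℕ → Set ℝ, G = fun i => {s | ∃ w : ℤ × ℤ, w ≠ 0 ∧
      |(w.1 : ℝ)| + |(w.2 : ℝ)| ≤ c * h / (2 ^ i * q) ^ 2 ∧
      |w.1 * (deriv γ s).2 - w.2 * (deriv γ s).1| ≤ c * h / (2 ^ i * q)} := ⟨_, rfl⟩
  have hGm : ∀ i, MeasurableSet (G i) := by
    intro i
    have e : G i = ⋃ w : ℤ × ℤ, {s | w ≠ 0 ∧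
        |(w.1 : ℝ)| + |(w.2 : ℝ)| ≤ c * h / (2 ^ i * q) ^ 2 ∧
        |w.1 * (deriv γ s).2 - w.2 * (deriv γ s).1| ≤ c * h / (2 ^ i * q)} := by
      ext s
      simp only [hG, mem_iUnion, mem_ofPred_eq]
    rw [e]
    refine MeasurableSet.iUnion fun w => (MeasurableSet.const _).inter
      ((MeasurableSet.const _).inter (IsClosed.measurableSet ?_))
    have hcont : Continuous (deriv γ) := hγ.contDiff_deriv.continuous
    have hf : Continuous fun s => |(w.1 : ℝ) * (deriv γ s).2 - w.2 * (deriv γ s).1| := by fun_prop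
    exact isClosed_le hf continuous_const
  have hpt : ∀ s, (⨆ α ∈ estimates A S h γ s, ENNReal.ofReal (angleError α (tangentAngle γ s)))
      ≤ ENNReal.ofReal (c * q)
        + ∑' i, (G i).indicator (fun _ => ENNReal.ofReal (c * (2 ^ (i + 1) * q))) s := by
    intro s
    refine iSup₂_le fun α hα => ?_
    obtain ⟨l, w, hl, hw, h1, h2, h3⟩ := (hbd h hh hlt γ L s hγ).2 α hα
    rcases le_or_gt l q with hlq | hlq
    · refine (ENNReal.ofReal_le_ofReal (h1.trans ?_)).trans le_self_add
      exact mul_le_mul_of_nonneg_left hlq hc.le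
    · obtain ⟨i, hi1, hi2⟩ := exists_nat_pow_near (x := l / q) (y := 2)
        ((one_le_div hq0).2 hlq.le) one_lt_two
      rw [le_div_iff₀ hq0] at hi1
      rw [div_lt_iff₀ hq0] at hi2
      have hiq : 0 < 2 ^ i * q := by positivity
      have hs : s ∈ G i := by
        rw [hG]
        refine ⟨w, hw, ?_, ?_⟩
        · rw [le_div_iff₀ (by positivity)]
          refine le_trans ?_ h2
          exact mul_le_mul_of_nonneg_left (pow_le_pow_left₀ hiq.le hi1 2) (by positivity)
        · rw [le_div_iff₀ hiq]
          exact (mul_le_mul_of_nonneg_left hi1 (abs_nonneg _)).trans h3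
      refine le_trans ?_ ((ENNReal.le_tsum i).trans le_add_self)
      rw [indicator_of_mem hs]
      exact ENNReal.ofReal_le_ofReal (h1.trans (mul_le_mul_of_nonneg_left hi2.le hc.le))
  have hterm : ∀ i, ∫⁻ s in Ioc 0 L,
      (G i).indicator (fun _ => ENNReal.ofReal (c * (2 ^ (i + 1) * q))) s
      ≤ ENNReal.ofReal (2 * B * q * L * (1 / 2) ^ i) := by
    intro i
    have hiq : 0 < 2 ^ i * q := by positivity
    rw [lintegral_indicator_const (hGm i), Measure.restrict_apply (hGm i)]
    have hv := hγ.volume_exists_cross_le hS hr hR hrol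
      (show 0 ≤ c * h / (2 ^ i * q) ^ 2 by positivity) (show 0 ≤ c * h / (2 ^ i * q) by positivity)
    have hsub : G i ∩ Ioc 0 L ⊆ {s | s ∈ Ioc 0 L ∧ ∃ w : ℤ × ℤ, w ≠ 0 ∧
        |(w.1 : ℝ)| + |(w.2 : ℝ)| ≤ c * h / (2 ^ i * q) ^ 2 ∧
        |w.1 * (deriv γ s).2 - w.2 * (deriv γ s).1| ≤ c * h / (2 ^ i * q)} := by
      rw [hG]
      exact fun s hs => ⟨hs.2, hs.1⟩
    refine (mul_le_mul_right ((measure_mono hsub).trans hv) _).trans ?_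
    rw [← ENNReal.ofReal_mul (by positivity)]
    refine ENNReal.ofReal_le_ofReal ?_
    have e : c * h / (2 ^ i * q) ^ 2 * (c * h / (2 ^ i * q)) = c ^ 2 / (2 ^ i) ^ 3 := by
      rw [div_mul_div_comm, div_eq_div_iff (by positivity) (by positivity)]
      linear_combination -(c ^ 2 * (2 ^ i) ^ 3 * (2 ^ i) ^ 0) * hq3
    rw [e]
    have e2 : c * (2 ^ (i + 1) * q) * (288 * (R / r) * L * (c ^ 2 / (2 ^ i) ^ 3))
        = 2 * B * q * L * (1 / (2 ^ i) ^ 2) := by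
      rw [hB, pow_succ]
      field_simp
    rw [e2]
    refine mul_le_mul_of_nonneg_left ?_ (by positivity)
    rw [one_div_pow]
    refine one_div_le_one_div_of_le (by positivity) ?_
    exact le_self_pow₀ (one_le_pow₀ one_le_two) two_ne_zero
  have hsum : ∑' i, ENNReal.ofReal (2 * B * q * L * (1 / 2) ^ i)
      = ENNReal.ofReal (4 * B * q * L) := by
    rw [← ENNReal.ofReal_tsum_of_nonneg (fun i => by positivity)
      (summable_geometric_two.mul_left _), tsum_mul_left, tsum_geometric_two]
    congr 1
    ring
  have hint : ∫⁻ s in Ioc 0 L,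
      ⨆ α ∈ estimates A S h γ s, ENNReal.ofReal (angleError α (tangentAngle γ s))
      ≤ ENNReal.ofReal L * ENNReal.ofReal ((c + 4 * B) * q) := by
    refine (lintegral_mono hpt).trans ?_
    rw [lintegral_add_left measurable_const, lintegral_const, Measure.restrict_apply_univ,
      Real.volume_Ioc, sub_zero,
      lintegral_tsum (fun i => (measurable_const.indicator (hGm i)).aemeasurable)]
    refine (add_le_add_right ((ENNReal.tsum_le_tsum hterm).trans hsum.le) _).trans (le_of_eq ?_)
    rw [← ENNReal.ofReal_mul (by positivity), ← ENNReal.ofReal_mul hL.le,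
      ← ENNReal.ofReal_add (by positivity) (by positivity)]
    congr 1
    ring
  refine (mul_le_mul_right hint _).trans (le_of_eq ?_)
  rw [← mul_assoc, ENNReal.inv_mul_cancel (by simpa using hL) ENNReal.ofReal_ne_top, one_mul]

end DigitalTangent

theorem theorem2 (A : DigitalTangent.TangentEstimator)
    (hA : A = DigitalTangent.maximalSegmentEstimator ∨ A = DigitalTangent.combinedEstimator) :
    (∀ M : ℝ × ℝ, DigitalTangent.MultigridConvergentAt A M) ∧
    (∀ S : Set (ℝ × ℝ), DigitalTangent.IsShape S → DigitalTangent.EdgeParameterGrowth S →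
      DigitalTangent.HasAverageSpeed A S (2 / 3)) :=
  ⟨DigitalTangent.multigridConvergentAt hA, fun _ hS _ => hS.hasAverageSpeed hA⟩
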